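/- **Setting.** Let $L_0$ and $I$ be self-adjoint (possibly unbounded) operators on a complex Hilbert space $\mathcal H$, and let $\Delta_0>0$ be such that $L=L(\Delta)=L_0+\Delta I$ is self-adjoint for $|\Delta|\le\Delta_0$ (with domain $\mathrm{dom}\,L_0\cap\mathrm{dom}\,I$ if $\Delta\ne0$; $L(0)=L_0$). Suppose that $L_0$ has finitely many eigenvalues $e$, of finite multiplicities $m_e$; let $P_e$ be the orthogonal projection onto the eigenspace of $e$ and $P_e^\perp=1-P_e$. Every eigenvalue of $L_0$ is either *unstable* or *partially stable*: to each partially stable $e$ belongs a real $E_e=E_e(\Delta)$ with $E_e\to e$ as $\Delta\to0$, which for $0<|\Delta|\le\Delta_0$ is a simple eigenvalue of $L$, and for these $\Delta$ every eigenvalue of $L$ is one of the $E_e$. Let $\Pi_{E_e}$ be the orthogonal projection onto the eigenspace of $L$ at $E_e$. Write $R_z=(L-z)^{-1}$, and let $R_z^{P_e}$ be $(P_e^\perp LP_e^\perp-z)^{-1}$ on $\mathrm{Ran}\,P_e^\perp$, extended by $0$ to $\mathrm{Ran}\,P_e$; let $\mathbb C_-$ be the open lower half plane. The inner product $\langle\cdot,\cdot\rangle$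 is conjugate linear in its first argument. Assume: * **(A1)** $P_eIP_e=0$ for all eigenvalues $e$ of $L_0$ (in particular $\mathrm{Ran}\,P_e\subset\mathrm{dom}\,I$). * **(A2)** There are a dense set $\mathcal D\subset\mathcal H$ with $\mathrm{Ran}\,IP_e\subset\mathcal D$ for all $e$, and an $\alpha>0$, such that for all $\phi,\psi\in\mathcal D$ there is a constant $C(\phi,\psi)<\infty$ such that for all $|\Delta|\le\Delta_0$: $|\frac{d^k}{dz^k}\langle\phi,R_z^{P_e}\psi\rangle|\le C(\phi,\psi)$ for $k=0,\dots,3$, all $e$ and all $z\in\mathbb C_-$ with $|\mathrm{Re}\,z-e|\le\alpha$; and $|\frac{d^k}{dz^k}\langle\phi,R_z\psi\rangle|\le C(\phi,\psi)$ for $k=0,1$ and all $z\in\mathbb C_-$ with $|\mathrm{Re}\,z-e|>\alpha$ for all $e$. * **(A3)** The derivative $\frac{d}{d\Delta}P_eIR_z^{P_e}IP_e$ exists and is bounded in operator norm, uniformly in $z\in\mathbb C_-$ with $|\mathrm{Re}\,z-e|\le\alpha$ and in $|\Delta|\le\Delta_0$, for all $e$. * **(A4)** Each level shift operator $\Lambda_e=-\lim_{\epsilon\to0_+}P_eIP_e^\perp(L_0-e+\mathrm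 i\epsilon)^{-1}IP_e$, viewed as an operator on the $m_e$-dimensional space $\mathrm{Ran}\,P_e$, has $m_e$ distinct eigenvalues $\lambda_{e,0},\dots,\lambda_{e,m_e-1}$. All of them have strictly positive imaginary part, except that for partially stable $e$ the eigenvalue $\lambda_{e,0}$ is real. Let $P_{e,j}$ be the rank one spectral (Riesz) projection of $\Lambda_e$ for $\lambda_{e,j}$, extended by $0$ to $\mathrm{Ran}\,P_e^\perp$. Below, $(e,j)$ runs over the pairs with $e$ unstable, $0\le j\le m_e-1$, or $e$ partially stable, $1\le j\le m_e-1$. **Theorem 1.1 (Resonance expansion of the propagator).** There is a constant $c\in(0,\Delta_0]$ and, for $0<|\Delta|<c$, there are complex numbers $a_{e,j}=a_{e,j}(\Delta)$ with $\mathrm{Im}\,a_{e,j}>0$ and sesquilinear forms $\Pi'_{e,j}=\Pi'_{e,j}(\Delta)$ on the linear span of $\mathcal D$ (we write $\langle\phi,\Pi'_{e,j}\psi\rangle$ for their values), such that $$a_{e,j}=\lambda_{e,j}+O(\Delta),\qquad \langle\phi,\Pi'_{e,j}\psi\rangle=\langle\phi,P_{e,j}\psi\rangle+O(\Delta)\quad(\phi,\psi\in\mathcal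 D),$$ and such that for all $\phi,\psi\in\mathcal D\cap\mathrm{dom}\,L$ with $L\phi,L\psi\in\mathcal D$ and all $t>0$, $$\langle\phi,e^{\mathrm itL}\psi\rangle=\sum_{e\text{ partially stable}}\Big\{e^{\mathrm itE_e}\langle\phi,\Pi_{E_e}\psi\rangle+\sum_{j=1}^{m_e-1}e^{\mathrm it(e+\Delta^2a_{e,j})}\langle\phi,\Pi'_{e,j}\psi\rangle\Big\}+\sum_{e\text{ unstable}}\ \sum_{j=0}^{m_e-1}e^{\mathrm it(e+\Delta^2a_{e,j})}\langle\phi,\Pi'_{e,j}\psi\rangle+R(t),\qquad |R(t)|\le\frac{C}{t}.$$ The constant in $a_{e,j}=\lambda_{e,j}+O(\Delta)$ is independent of $\Delta$. The constant in the second relation and the constant $C$ depend on $\phi,\psi$ only, not on $\Delta$ or $t$. -/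

import Mathlib

namespace Resonance

open Filter Topology

section Stone

set_option linter.unusedSectionVars false

/-- `R` is the (bounded, everywhere defined) resolvent `(A - z)⁻¹` of the unbounded operator `A`. -/
def IsResolvent {H : Type*} [NormedAddCommGroup H] [InnerProductSpace ℂ H]
    (A : H →ₗ.[ℂ] H) (z : ℂ) (R : H →L[ℂ] H) : Prop :=
  (∀ y, ∃ h : R y ∈ A.domain, A ⟨R y, h⟩ - z • R y = y) ∧
    ∀ x : A.domain, R (A x - z • (x : H)) = x

/-- `U` is a strongly continuous one-parameter unitary group whose generator extends `i A`.
For self-adjoint `A` there is exactly one such `U`, namely `U t = exp (i t A)`. -/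
structure IsUnitaryGroup {H : Type*} [NormedAddCommGroup H] [InnerProductSpace ℂ H]
    (A : H →ₗ.[ℂ] H) (U : ℝ → H →L[ℂ] H) : Prop where
  zero : U 0 = 1
  add : ∀ s t, U (s + t) = U s * U t
  norm_map : ∀ t x, ‖U t x‖ = ‖x‖
  continuous : ∀ x, Continuous fun t => U t x
  hasDerivAt : ∀ x : A.domain, HasDerivAt (fun t => U t (x : H)) (Complex.I • A x) 0

variable {H : Type*} [NormedAddCommGroup H] [InnerProductSpace ℂ H] [CompleteSpace H]
  {A : H →ₗ.[ℂ] H}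

theorem inner_symm (hA : IsSelfAdjoint A) (x y : A.domain) :
    inner ℂ (A x) (y : H) = inner ℂ (x : H) (A y) := by
  have h := LinearPMap.adjoint_isFormalAdjoint hA.dense_domain
  rw [LinearPMap.isSelfAdjoint_def.mp hA] at h
  exact h x y

theorem mem_domain_of_inner (hA : IsSelfAdjoint A) (y w : H)
    (h : ∀ x : A.domain, inner ℂ w (x : H) = inner ℂ y (A x)) :
    ∃ hy : y ∈ A.domain, A ⟨y, hy⟩ = w := by
  have e := LinearPMap.isSelfAdjoint_def.mp hA
  have h1 := LinearPMap.mem_adjoint_domain_of_exists (T := A) y ⟨w, h⟩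
  have h2 := LinearPMap.adjoint_apply_eq hA.dense_domain ⟨y, h1⟩ h
  have key : ∀ B : H →ₗ.[ℂ] H, B = A → ∀ hB : y ∈ B.domain, B ⟨y, hB⟩ = w →
      ∃ hy : y ∈ A.domain, A ⟨y, hy⟩ = w := by
    rintro B rfl hB hw
    exact ⟨hB, hw⟩
  exact key _ e h1 h2

theorem im_mul_norm_le (hA : IsSelfAdjoint A) (z : ℂ) (x : A.domain) :
    |z.im| * ‖(x : H)‖ ≤ ‖A x - z • (x : H)‖ := by
  have h1 : (inner ℂ (x : H) (A x)).im = 0 := by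
    have := inner_symm hA x x
    rw [← inner_conj_symm] at this
    exact Complex.conj_eq_iff_im.mp this
  have h2 : (inner ℂ (x : H) (A x - z • (x : H))).im = - (z.im * ‖(x : H)‖ ^ 2) := by
    rw [inner_sub_right, inner_smul_right, inner_self_eq_norm_sq_to_K, Complex.sub_im, h1]
    have h : ((‖(x : H)‖ : ℂ)) ^ 2 = ((‖(x : H)‖ ^ 2 : ℝ) : ℂ) := by push_cast; rfl
    simp only [Complex.coe_algebraMap, h, Complex.mul_im, Complex.ofReal_re, Complex.ofReal_im]
    ring
  have h3 : |z.im| * ‖(x : H)‖ ^ 2 ≤ ‖(x : H)‖ * ‖A x - z • (x : H)‖ := by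
    calc |z.im| * ‖(x : H)‖ ^ 2 = |(inner ℂ (x : H) (A x - z • (x : H))).im| := by
          rw [h2, abs_neg, abs_mul, abs_of_nonneg (sq_nonneg ‖(x : H)‖)]
      _ ≤ ‖inner ℂ (x : H) (A x - z • (x : H))‖ := Complex.abs_im_le_norm _
      _ ≤ _ := norm_inner_le_norm _ _
  rcases eq_or_lt_of_le (norm_nonneg (x : H)) with h0 | h0
  · rw [← h0]; simp
  · nlinarith

theorem exists_isResolvent (hA : IsSelfAdjoint A) {z : ℂ} (hz : z.im ≠ 0) :
    ∃ R : H →L[ℂ] H, IsResolvent A z R ∧ ∀ y, |z.im| * ‖R y‖ ≤ ‖y‖ := by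
  have hz' : 0 < |z.im| := abs_pos.mpr hz
  let f : A.domain →ₗ[ℂ] H := A.toFun - z • A.domain.subtype
  have hf : ∀ x, f x = A x - z • (x : H) := fun x => rfl
  have hinj : Function.Injective f := by
    rw [injective_iff_map_eq_zero]
    intro x hx
    have := im_mul_norm_le hA z x
    rw [← hf, hx, norm_zero] at this
    have h0 : ‖(x : H)‖ = 0 := by nlinarith [norm_nonneg (x : H)]
    simpa using h0
  have hclosed : IsClosed (LinearMap.range f : Set H) := by
    refine isClosed_of_closure_subset fun y hy => ?_
    obtain ⟨u, hu, hlim⟩ := mem_closure_iff_seq_limit.mp hy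
    choose v hv using hu
    have hc : CauchySeq fun n => (v n : H) := by
      have hcu := hlim.cauchySeq
      rw [Metric.cauchySeq_iff] at hcu ⊢
      intro ε hε
      obtain ⟨N, hN⟩ := hcu (|z.im| * ε) (by positivity)
      refine ⟨N, fun m hm n hn => ?_⟩
      have h1 := hN m hm n hn
      have h2 := im_mul_norm_le hA z (v m - v n)
      rw [← hf, map_sub, hv, hv] at h2
      rw [dist_eq_norm] at h1 ⊢
      have h3 : |z.im| * ‖(v m : H) - v n‖ < |z.im| * ε := lt_of_le_of_lt h2 h1
      exact lt_of_mul_lt_mul_left h3 hz'.le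
    obtain ⟨x, hx⟩ := cauchySeq_tendsto_of_complete hc
    have hAv : Filter.Tendsto (fun n => A (v n)) Filter.atTop (nhds (y + z • x)) := by
      have : (fun n => A (v n)) = fun n => u n + z • (v n : H) := by
        funext n; rw [← hv n, hf]; abel
      rw [this]; exact hlim.add (hx.const_smul z)
    obtain ⟨hxd, hAx⟩ := mem_domain_of_inner hA x (y + z • x) fun w => by
      have h1 : Filter.Tendsto (fun n => inner ℂ (A (v n)) (w : H)) Filter.atTop
          (nhds (inner ℂ (y + z • x) (w : H))) := hAv.inner tendsto_const_nhds
      have h2 : Filter.Tendsto (fun n => inner ℂ (A (v n)) (w : H)) Filter.atTop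
          (nhds (inner ℂ x (A w))) := by
        simp only [inner_symm hA]
        exact hx.inner tendsto_const_nhds
      exact tendsto_nhds_unique h1 h2
    exact ⟨⟨x, hxd⟩, by rw [hf, hAx]; simp⟩
  have hsurj : Function.Surjective f := by
    rw [← LinearMap.range_eq_top]
    have : CompleteSpace (LinearMap.range f) := hclosed.completeSpace_coe
    rw [← Submodule.orthogonal_eq_bot_iff, Submodule.eq_bot_iff]
    intro y hy
    have hy' : ∀ x : A.domain, inner ℂ ((starRingEnd ℂ z) • y) (x : H) = inner ℂ y (A x) := by
      intro x
      have := (Submodule.mem_orthogonal' _ _).mp hy (f x) ⟨x, rfl⟩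
      rw [hf, inner_sub_right, inner_smul_right, sub_eq_zero] at this
      rw [inner_smul_left, this]; simp
    obtain ⟨hyd, hAy⟩ := mem_domain_of_inner hA y _ hy'
    have := im_mul_norm_le hA (starRingEnd ℂ z) ⟨y, hyd⟩
    rw [hAy] at this
    simp only [Complex.conj_im, abs_neg, sub_self, norm_zero] at this
    have h0 : ‖y‖ = 0 := by nlinarith [norm_nonneg y]
    simpa using h0
  let g := LinearEquiv.ofBijective f ⟨hinj, hsurj⟩
  have hg : ∀ y, f (g.symm y) = y := fun y => g.apply_symm_apply y
  have hb : ∀ y, |z.im| * ‖(g.symm y : H)‖ ≤ ‖y‖ := fun y => by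
    have := im_mul_norm_le hA z (g.symm y)
    rwa [← hf, hg] at this
  refine ⟨LinearMap.mkContinuous (A.domain.subtype ∘ₗ g.symm.toLinearMap) (|z.im|)⁻¹ fun y => ?_,
    ⟨fun y => ⟨(g.symm y).2, hg y⟩, fun x => ?_⟩, hb⟩
  · rw [inv_mul_eq_div, le_div_iff₀ hz', mul_comm]; exact hb y
  · have : g.symm (f x) = x := g.symm_apply_apply x
    exact congrArg Subtype.val this

theorem IsResolvent.apply_map {z : ℂ} {R : H →L[ℂ] H} (h : IsResolvent A z R) (x : A.domain) :
    R (A x) = x + z • R x := by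
  have := h.2 x
  rw [map_sub, map_smul, sub_eq_iff_eq_add] at this
  exact this

theorem IsResolvent.sub_apply {z w : ℂ} {R S : H →L[ℂ] H} (hR : IsResolvent A z R)
    (hS : IsResolvent A w S) (x : H) : R x - S x = (z - w) • R (S x) := by
  obtain ⟨h, e⟩ := hS.1 x
  have h1 := hR.apply_map ⟨S x, h⟩
  rw [sub_eq_iff_eq_add] at e
  rw [e, map_add, map_smul, ← sub_eq_iff_eq_add'] at h1
  rw [sub_smul, ← h1]
  abel

theorem IsResolvent.comm {z w : ℂ} {R S : H →L[ℂ] H} (hR : IsResolvent A z R)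
    (hS : IsResolvent A w S) (hzw : z ≠ w) (x : H) : R (S x) = S (R x) := by
  have h1 := hR.sub_apply hS x
  have h2 := hS.sub_apply hR x
  have h3 : (z - w) • (R (S x) - S (R x)) = 0 := by
    rw [smul_sub, ← h1, ← neg_sub w z, neg_smul, ← h2]; abel
  exact sub_eq_zero.mp ((smul_eq_zero.mp h3).resolve_left (sub_ne_zero.mpr hzw))

theorem IsResolvent.inner_left (hA : IsSelfAdjoint A) {z : ℂ} {R S : H →L[ℂ] H}
    (hR : IsResolvent A z R) (hS : IsResolvent A (starRingEnd ℂ z) S) (x y : H) :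
    inner ℂ (R x) y = inner ℂ x (S y) := by
  obtain ⟨h, e⟩ := hR.1 x
  obtain ⟨h', e'⟩ := hS.1 y
  have := inner_symm hA ⟨R x, h⟩ ⟨S y, h'⟩
  conv_lhs => rw [← e']
  conv_rhs => rw [← e]
  rw [inner_sub_left, inner_sub_right, inner_smul_left, inner_smul_right, this]

/-- The Yosida approximations of a self-adjoint operator. -/
theorem exists_approx (hA : IsSelfAdjoint A) :
    ∃ B : ℕ → H →L[ℂ] H, (∀ n, IsSelfAdjoint (B n)) ∧ (∀ m n, Commute (B m) (B n)) ∧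
      (∀ n (x : A.domain), ‖B n x‖ ≤ ‖A x‖) ∧
      ∀ x : A.domain, Filter.Tendsto (fun n => B n x) Filter.atTop (nhds (A x)) := by
  have hex : ∀ z : {z : ℂ // z.im ≠ 0}, ∃ R : H →L[ℂ] H, IsResolvent A z R ∧
      ∀ y, |(z : ℂ).im| * ‖R y‖ ≤ ‖y‖ := fun z => exists_isResolvent hA z.2
  choose R hR hb using hex
  let N : ℕ → ℝ := fun n => n + 1
  have hN : ∀ n, 0 < N n := fun n => by positivity
  let p : ℕ → {z : ℂ // z.im ≠ 0} := fun n => ⟨Complex.I * (N n : ℂ), by simpa using (hN n).ne'⟩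
  let q : ℕ → {z : ℂ // z.im ≠ 0} := fun n => ⟨-(Complex.I * (N n : ℂ)), by simpa using (hN n).ne'⟩
  have hpb : ∀ n y, N n * ‖R (p n) y‖ ≤ ‖y‖ := fun n y => by
    simpa [p, abs_of_pos (hN n)] using hb (p n) y
  have hqb : ∀ n y, N n * ‖R (q n) y‖ ≤ ‖y‖ := fun n y => by
    simpa [q, abs_of_pos (hN n)] using hb (q n) y
  have hcomm : ∀ z w, Commute (R z) (R w) := fun z w => by
    by_cases h : z = w
    · rw [h]
    · ext x
      exact (hR z).comm (hR w) (fun h' => h (Subtype.ext h')) x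
  let B : ℕ → H →L[ℂ] H := fun n => ((N n : ℂ) ^ 2 / 2) • (R (p n) + R (q n))
  let K : ℕ → H →L[ℂ] H := fun n => ((N n : ℂ) / (2 * Complex.I)) • (R (p n) - R (q n))
  have hBK : ∀ n (x : A.domain), B n x = K n (A x) := fun n x => by
    simp only [B, K, smul_apply, add_apply,
      sub_apply, (hR (p n)).apply_map, (hR (q n)).apply_map]
    simp only [p, q, add_sub_add_left_eq_sub, neg_smul, sub_neg_eq_add, ← smul_add, smul_smul]
    congr 1
    field_simp
  have hKb : ∀ n y, ‖K n y‖ ≤ ‖y‖ := fun n y => by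
    have h1 : ‖K n y‖ ≤ N n / 2 * (‖R (p n) y‖ + ‖R (q n) y‖) := by
      simp only [K, smul_apply, sub_apply, norm_smul,
        norm_div, norm_mul, Complex.norm_I, Complex.norm_real, mul_one,
        Real.norm_of_nonneg (hN n).le, RCLike.norm_ofNat]
      gcongr
      exact norm_sub_le _ _
    linarith [hpb n y, hqb n y]
  have hNt : Filter.Tendsto (fun n => (N n)⁻¹) Filter.atTop (nhds 0) := by
    simpa [N, one_div] using tendsto_one_div_add_atTop_nhds_zero_nat (𝕜 := ℝ)
  have hKd : ∀ n (x : A.domain), ‖K n x - x‖ ≤ (N n)⁻¹ * ‖A x‖ := fun n x => by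
    have hz : (N n : ℂ) ≠ 0 := by exact_mod_cast (hN n).ne'
    have h1 : K n x - x = (-(1 / 2) : ℂ) • (R (p n) (A x) + R (q n) (A x)) := by
      simp only [K, smul_apply,
        sub_apply, (hR (p n)).apply_map, (hR (q n)).apply_map]
      simp only [p, q]
      match_scalars <;> field_simp <;> norm_num
    have h2 : ‖K n x - x‖ ≤ 1 / 2 * (‖R (p n) (A x)‖ + ‖R (q n) (A x)‖) := by
      rw [h1, norm_smul]
      have : ‖(-(1 / 2) : ℂ)‖ = 1 / 2 := by norm_num
      rw [this]
      gcongr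
      exact norm_add_le _ _
    rw [inv_mul_eq_div, le_div_iff₀ (hN n)]
    nlinarith [hpb n (A x), hqb n (A x), hN n]
  have hKt : ∀ y, Filter.Tendsto (fun n => K n y) Filter.atTop (nhds y) := fun y => by
    rw [Metric.tendsto_atTop]
    intro ε hε
    obtain ⟨x, hx, hxy⟩ := Metric.dense_iff.mp hA.dense_domain y (ε / 3) (by positivity)
    have h0 := hNt.mul_const ‖A ⟨x, hxy⟩‖
    rw [zero_mul] at h0
    obtain ⟨M, hM⟩ := Filter.eventually_atTop.mp (h0.eventually_lt_const (show 0 < ε / 3 by positivity))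
    refine ⟨M, fun n hn => ?_⟩
    have h1 := lt_of_le_of_lt (hKd n ⟨x, hxy⟩) (hM n hn)
    have h2 : ‖K n (y - x)‖ ≤ ‖y - x‖ := hKb n _
    have h3 : ‖y - x‖ < ε / 3 := by rwa [← dist_eq_norm, dist_comm]
    have h4 : K n y - y = K n (y - x) + (K n x - x) - (y - x) := by rw [map_sub]; abel
    rw [dist_eq_norm, h4]
    have h5 := norm_sub_le (K n (y - x) + (K n x - x)) (y - x)
    have h6 := norm_add_le (K n (y - x)) (K n x - x)
    simp only at h1
    linarith
  refine ⟨B, fun n => ?_, fun m n => ?_, fun n x => ?_, fun x => ?_⟩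
  · rw [ContinuousLinearMap.isSelfAdjoint_iff_isSymmetric]
    intro x y
    have hpq : (starRingEnd ℂ) ((p n : ℂ)) = q n := by simp [p, q]
    have hqp : (starRingEnd ℂ) ((q n : ℂ)) = p n := by simp [p, q]
    have h1 := (hR (p n)).inner_left hA (hpq ▸ hR (q n)) x y
    have h2 := (hR (q n)).inner_left hA (hqp ▸ hR (p n)) x y
    simp only [B, ContinuousLinearMap.coe_coe, smul_apply,
      add_apply, inner_smul_left, inner_smul_right, inner_add_left,
      inner_add_right, h1, h2]
    simp only [map_div₀, map_pow, Complex.conj_ofReal, map_ofNat]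
    ring
  · refine ((?_ : Commute _ _).smul_left _).smul_right _
    exact ((hcomm _ _).add_left (hcomm _ _)).add_right ((hcomm _ _).add_left (hcomm _ _))
  · rw [hBK]; exact hKb _ _
  · simp only [hBK]; exact hKt _

theorem norm_exp_apply {C : H →L[ℂ] H} (hC : IsSelfAdjoint C) (t : ℝ) (x : H) :
    ‖NormedSpace.exp (t • (Complex.I • C)) x‖ = ‖x‖ := by
  have hs : IsSelfAdjoint ((t : ℂ) • C) :=
    IsSelfAdjoint.smul (Complex.conj_ofReal t : IsSelfAdjoint (t : ℂ)) hC
  have h := ContinuousLinearMap.norm_map_of_mem_unitary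
    (selfAdjoint.expUnitary ⟨(t : ℂ) • C, hs⟩).2 x
  have h' : t • (Complex.I • C) = Complex.I • ((t : ℂ) • C) := by
    ext y
    simp only [smul_apply, smul_comm Complex.I, Complex.coe_smul]
  rw [h']
  exact h

theorem hasDerivAt_exp_apply (C : H →L[ℂ] H) (t : ℝ) (x : H) :
    HasDerivAt (fun s : ℝ => NormedSpace.exp (s • (Complex.I • C)) x)
      (NormedSpace.exp (t • (Complex.I • C)) (Complex.I • C x)) t := by
  have h := hasDerivAt_exp_smul_const (𝕂 := ℝ) (Complex.I • C) t
  exact ((ContinuousLinearMap.apply ℂ H x).restrictScalars ℝ).hasFDerivAt.comp_hasDerivAt t h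

theorem norm_exp_apply_sub_le {C : H →L[ℂ] H} (hC : IsSelfAdjoint C) (t : ℝ) (x : H) :
    ‖NormedSpace.exp (t • (Complex.I • C)) x - x‖ ≤ |t| * ‖C x‖ := by
  have h := Convex.norm_image_sub_le_of_norm_hasDerivWithin_le (s := Set.univ) (x := (0 : ℝ))
    (y := t) (C := ‖C x‖) (fun s _ => (hasDerivAt_exp_apply C s x).hasDerivWithinAt)
    (fun s _ => by rw [norm_exp_apply hC, norm_smul, Complex.norm_I, one_mul])
    convex_univ trivial trivial
  simpa [mul_comm] using h

theorem norm_exp_sub_exp_le {B C : H →L[ℂ] H} (hB : IsSelfAdjoint B) (hC : IsSelfAdjoint C)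
    (hBC : Commute B C) (t : ℝ) (x : H) :
    ‖NormedSpace.exp (t • (Complex.I • B)) x - NormedSpace.exp (t • (Complex.I • C)) x‖ ≤
      |t| * ‖B x - C x‖ := by
  let +nondep : NormedAlgebra ℚ (H →L[ℂ] H) := .restrictScalars ℚ ℂ _
  have h : t • (Complex.I • B) = t • (Complex.I • C) + t • (Complex.I • (B - C)) := by
    rw [smul_sub, smul_sub]; abel
  have hc : Commute (t • (Complex.I • C)) (t • (Complex.I • (B - C))) :=
    ((((hBC.symm.sub_right (Commute.refl C)).smul_right _).smul_left _).smul_right _).smul_left _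
  rw [h, NormedSpace.exp_add_of_commute hc, mul_apply_eq_comp, ← map_sub,
    norm_exp_apply hC]
  exact norm_exp_apply_sub_le (hB.sub hC) t x

/-- Stone's theorem (existence part). -/
theorem exists_isUnitaryGroup (hA : IsSelfAdjoint A) :
    ∃ U : ℝ → H →L[ℂ] H, IsUnitaryGroup A U := by
  let +nondep : NormedAlgebra ℚ (H →L[ℂ] H) := .restrictScalars ℚ ℂ _
  obtain ⟨B, hB, hcomm, hbd, hlim⟩ := exists_approx hA
  let V : ℕ → ℝ → H →L[ℂ] H := fun n t => NormedSpace.exp (t • (Complex.I • B n))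
  have hVn : ∀ n t x, ‖V n t x‖ = ‖x‖ := fun n t x => norm_exp_apply (hB n) t x
  have hcauchy : ∀ t x, CauchySeq fun n => V n t x := by
    intro t x
    rw [Metric.cauchySeq_iff]
    intro ε hε
    obtain ⟨y, hy, hyd⟩ := Metric.dense_iff.mp hA.dense_domain x (ε / 3) (by positivity)
    obtain ⟨M, hM⟩ := Metric.cauchySeq_iff.mp (hlim ⟨y, hyd⟩).cauchySeq (ε / 3 / (|t| + 1))
      (by positivity)
    refine ⟨M, fun m hm n hn => ?_⟩
    have h1 := hM m hm n hn
    have h2 := norm_exp_sub_exp_le (hB m) (hB n) (hcomm m n) t y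
    rw [lt_div_iff₀ (by positivity), dist_eq_norm] at h1
    have h3 : ‖x - y‖ < ε / 3 := by rwa [← dist_eq_norm, dist_comm]
    have h4 : V m t x - V n t x = V m t (x - y) - V n t (x - y) + (V m t y - V n t y) := by
      rw [map_sub, map_sub]; abel
    have h5 := norm_add_le (V m t (x - y) - V n t (x - y)) (V m t y - V n t y)
    have h6 := norm_sub_le (V m t (x - y)) (V n t (x - y))
    rw [hVn, hVn] at h6
    have h7 : ‖V m t y - V n t y‖ ≤ |t| * ‖B m y - B n y‖ := h2
    rw [dist_eq_norm, h4]
    simp only at h1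
    nlinarith [norm_nonneg (B m y - B n y), abs_nonneg t]
  choose f hf using fun t x => cauchySeq_tendsto_of_complete (hcauchy t x)
  let U : ℝ → H →L[ℂ] H := fun t => continuousLinearMapOfTendsto (fun n => V n t)
    (tendsto_pi_nhds.mpr (hf t))
  have hU : ∀ t x, Filter.Tendsto (fun n => V n t x) Filter.atTop (nhds (U t x)) := hf
  have hUn : ∀ t x, ‖U t x‖ = ‖x‖ := fun t x => by
    have := (hU t x).norm
    simp only [hVn] at this
    exact (tendsto_nhds_unique this tendsto_const_nhds)
  have hU0 : U 0 = 1 := by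
    ext x
    have := hU 0 x
    simp only [V, zero_smul, NormedSpace.exp_zero] at this
    exact tendsto_nhds_unique this tendsto_const_nhds
  have hUadd : ∀ s t, U (s + t) = U s * U t := fun s t => by
    ext x
    refine tendsto_nhds_unique (hU (s + t) x) ?_
    have h1 : ∀ n, V n (s + t) x = V n s (U t x) + V n s (V n t x - U t x) := fun n => by
      rw [map_sub]
      have : V n (s + t) = V n s * V n t := by
        simp only [V, add_smul]
        exact NormedSpace.exp_add_of_commute (((Commute.refl _).smul_left _).smul_right _)
      rw [this, mul_apply_eq_comp]; abel
    have h2 : Filter.Tendsto (fun n => V n s (V n t x - U t x)) Filter.atTop (nhds 0) := by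
      rw [tendsto_zero_iff_norm_tendsto_zero]
      simp only [hVn]
      rw [← tendsto_iff_norm_sub_tendsto_zero]
      exact hU t x
    simp only [h1]
    simpa using (hU s (U t x)).add h2
  have hUd : ∀ t (x : A.domain), ‖U t x - x‖ ≤ |t| * ‖A x‖ := fun t x => by
    refine le_of_tendsto ((hU t x).sub_const (x : H)).norm (Filter.Eventually.of_forall fun n => ?_)
    exact (norm_exp_apply_sub_le (hB n) t x).trans (by gcongr; exact hbd n x)
  have hU0t : ∀ x, Filter.Tendsto (fun t => U t x) (nhds 0) (nhds x) := fun x => by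
    rw [Metric.tendsto_nhds_nhds]
    intro ε hε
    obtain ⟨y, hy, hyd⟩ := Metric.dense_iff.mp hA.dense_domain x (ε / 3) (by positivity)
    refine ⟨ε / 3 / (‖A ⟨y, hyd⟩‖ + 1), by positivity, fun {t} ht => ?_⟩
    rw [lt_div_iff₀ (by positivity), dist_zero_right, Real.norm_eq_abs] at ht
    have h1 := hUd t ⟨y, hyd⟩
    have h3 : ‖x - y‖ < ε / 3 := by rwa [← dist_eq_norm, dist_comm]
    have h4 : U t x - x = U t (x - y) + (U t y - y) - (x - y) := by rw [map_sub]; abel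
    have h5 := norm_sub_le (U t (x - y) + (U t y - y)) (x - y)
    have h6 := norm_add_le (U t (x - y)) (U t y - y)
    rw [hUn] at h6
    rw [dist_eq_norm, h4]
    simp only at h1
    nlinarith [abs_nonneg t]
  have hUc : ∀ x, Continuous fun t => U t x := fun x => by
    rw [continuous_iff_continuousAt]
    intro t
    have h1 : (fun s => U s x) = fun s => U t (U (s - t) x) := by
      funext s
      rw [← mul_apply_eq_comp, ← hUadd]; simp
    rw [ContinuousAt, h1]
    refine ((U t).continuous.tendsto x).comp ((hU0t x).comp ?_)
    have : Filter.Tendsto (fun s : ℝ => s - t) (nhds t) (nhds (t - t)) :=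
      (continuous_id.sub continuous_const).tendsto t
    simpa using this
  have hint : ∀ (x : A.domain) (t : ℝ),
      ∫ s in (0 : ℝ)..t, U s (Complex.I • A x) = U t x - x := fun x t => by
    have hV' : ∀ n, ∫ s in (0 : ℝ)..t, V n s (Complex.I • B n x) = V n t x - x := fun n => by
      have hcont : Continuous fun s => V n s (Complex.I • B n x) := by
        rw [continuous_iff_continuousAt]
        exact fun s => (hasDerivAt_exp_apply (B n) s _).continuousAt
      rw [intervalIntegral.integral_eq_sub_of_hasDerivAt
        (fun s _ => hasDerivAt_exp_apply (B n) s x) (hcont.intervalIntegrable _ _)]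
      simp [V]
    refine tendsto_nhds_unique (f := fun n => ∫ s in (0 : ℝ)..t, V n s (Complex.I • B n x))
      (l := Filter.atTop) ?_ ?_
    · refine intervalIntegral.tendsto_integral_filter_of_dominated_convergence
        (fun _ => ‖A x‖) (Filter.Eventually.of_forall fun n => ?_)
        (Filter.Eventually.of_forall fun n => Filter.Eventually.of_forall fun s _ => ?_)
        intervalIntegrable_const (Filter.Eventually.of_forall fun s _ => ?_)
      · have hcont : Continuous fun s => V n s (Complex.I • B n x) := by
          rw [continuous_iff_continuousAt]
          exact fun s => (hasDerivAt_exp_apply (B n) s _).continuousAt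
        exact hcont.aestronglyMeasurable
      · rw [hVn, norm_smul, Complex.norm_I, one_mul]; exact hbd n x
      · have h1 : ∀ n, V n s (Complex.I • B n x) =
            V n s (Complex.I • A x) + V n s (Complex.I • B n x - Complex.I • A x) := fun n => by
          rw [map_sub]; abel
        have h2 : Filter.Tendsto (fun n => V n s (Complex.I • B n x - Complex.I • A x))
            Filter.atTop (nhds 0) := by
          rw [tendsto_zero_iff_norm_tendsto_zero]
          simp only [hVn]
          rw [← tendsto_iff_norm_sub_tendsto_zero]
          exact (hlim x).const_smul _
        simp only [h1]
        simpa using (hU s (Complex.I • A x)).add h2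
    · simp only [hV']
      exact (hU t x).sub_const _
  refine ⟨U, hU0, hUadd, hUn, hUc, fun x => ?_⟩
  have h1 := intervalIntegral.integral_hasDerivAt_right (a := 0) (b := 0)
    ((hUc (Complex.I • A x)).intervalIntegrable _ _)
    ((hUc (Complex.I • A x)).stronglyMeasurableAtFilter _ _) (hUc (Complex.I • A x)).continuousAt
  simp only [hint x, hU0, one_apply_eq_self] at h1
  simpa using h1.add_const (x : H)

end Stone

noncomputable section

variable {H : Type*} [NormedAddCommGroup H] [InnerProductSpace ℂ H]

open Classical in
/-- The resolvent `(A - z)⁻¹` as a bounded operator (`0` if `z` is not in the resolvent set). -/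
def resolvent (A : H →ₗ.[ℂ] H) (z : ℂ) : H →L[ℂ] H :=
  if h : ∃ R, IsResolvent A z R then h.choose else 0

open Classical in
/-- The propagator `exp (i t A)` of a self-adjoint operator `A`. -/
def propagator (A : H →ₗ.[ℂ] H) : ℝ → H →L[ℂ] H :=
  if h : ∃ U, IsUnitaryGroup A U then h.choose else fun _ => 1

theorem isResolvent_resolvent [CompleteSpace H] {A : H →ₗ.[ℂ] H} (hA : IsSelfAdjoint A) {z : ℂ}
    (hz : z.im ≠ 0) : IsResolvent A z (resolvent A z) := by
  have h : ∃ R, IsResolvent A z R := (exists_isResolvent hA hz).imp fun _ h => h.1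
  rw [resolvent, dif_pos h]
  exact h.choose_spec

theorem isUnitaryGroup_propagator [CompleteSpace H] {A : H →ₗ.[ℂ] H} (hA : IsSelfAdjoint A) :
    IsUnitaryGroup A (propagator A) := by
  have h := exists_isUnitaryGroup hA
  rw [propagator, dif_pos h]
  exact h.choose_spec

/-- The eigenspace `{x ∈ dom A | A x = z x}`. -/
def eigenspace (A : H →ₗ.[ℂ] H) (z : ℂ) : Submodule ℂ H where
  carrier := {x | ∃ h : x ∈ A.domain, A ⟨x, h⟩ = z • x}
  zero_mem' := ⟨A.domain.zero_mem, by rw [smul_zero]; exact A.map_zero⟩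
  add_mem' := by
    rintro x y ⟨hx, ex⟩ ⟨hy, ey⟩
    refine ⟨A.domain.add_mem hx hy, ?_⟩
    have h := A.map_add ⟨x, hx⟩ ⟨y, hy⟩
    rw [ex, ey, ← smul_add] at h
    exact h
  smul_mem' := by
    rintro c x ⟨hx, ex⟩
    refine ⟨A.domain.smul_mem c hx, ?_⟩
    have h := A.map_smul c ⟨x, hx⟩
    rw [ex, smul_comm] at h
    exact h

/-- `e` is an eigenvalue of `A`. -/
def IsEigenvalue (A : H →ₗ.[ℂ] H) (e : ℝ) : Prop := eigenspace A e ≠ ⊥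

open Classical in
/-- The operator `L = L₀ + Δ W`, on its natural domain `dom L₀ ∩ dom W` if `Δ ≠ 0`; it is `L₀`
(with its own domain) if `Δ = 0`. -/
def perturbed (L₀ W : H →ₗ.[ℂ] H) (Δ : ℝ) : H →ₗ.[ℂ] H :=
  if Δ = 0 then L₀ else L₀ + (Δ : ℂ) • W

open Classical in
/-- The bounded operator `W P : x ↦ W (P x)`, for a projection `P` of finite rank with range in
`dom W`. -/
def boundedComp (W : H →ₗ.[ℂ] H) (P : H →L[ℂ] H) : H →L[ℂ] H :=
  if h : ∃ T : H →L[ℂ] H, ∀ x, ∃ hx : P x ∈ W.domain, T x = W ⟨P x, hx⟩ then h.choose else 0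

variable [CompleteSpace H]

/-- The orthogonal projection onto (the closure of) `V`. -/
def orthProj (V : Submodule ℂ H) : H →L[ℂ] H := V.topologicalClosure.starProjection

/-- The operator `Q^⊥ A Q^⊥` on `Ran Q^⊥ = V^⊥`, where `Q` is the orthogonal projection onto `V`. -/
def compression (A : H →ₗ.[ℂ] H) (V : Submodule ℂ H) : Vᗮ →ₗ.[ℂ] Vᗮ where
  domain := A.domain.comap Vᗮ.subtype
  toFun := (Vᗮ.orthogonalProjectionOnto : H →ₗ[ℂ] Vᗮ) ∘ₗ A.toFun ∘ₗ
    Vᗮ.subtype.restrict (p := A.domain.comap Vᗮ.subtype) (q := A.domain) fun _ h => h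

/-- The reduced resolvent `R_z^Q = (Q^⊥ A Q^⊥ - z)⁻¹` on `Ran Q^⊥`, extended by `0` to `Ran Q`. -/
def reducedResolvent (A : H →ₗ.[ℂ] H) (V : Submodule ℂ H) (z : ℂ) : H →L[ℂ] H :=
  Vᗮ.subtypeL ∘L resolvent (compression A V) z ∘L Vᗮ.orthogonalProjectionOnto

/-- The spectral projection `P_e` of `L₀` onto its eigenspace at `e`. -/
def eigProj (L₀ : H →ₗ.[ℂ] H) (e : ℝ) : H →L[ℂ] H := orthProj (eigenspace L₀ e)

/-- The operator `P_e W R_z^{P_e} W P_e` for `L = L₀ + Δ W`. Here `P_e W` is the bounded operator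
`(W P_e)^*`, which extends `P_e W` since `W` is self-adjoint. -/
def feshbachTerm (L₀ W : H →ₗ.[ℂ] H) (e : ℝ) (z : ℂ) (Δ : ℝ) : H →L[ℂ] H :=
  ContinuousLinearMap.adjoint (boundedComp W (eigProj L₀ e)) ∘L
    reducedResolvent (perturbed L₀ W Δ) (eigenspace L₀ e) z ∘L boundedComp W (eigProj L₀ e)

/-- The level shift operator
`Λ_e = - lim_{ε → 0+} P_e W P_e^⊥ (L₀ - e + i ε)⁻¹ W P_e`. -/
def levelShift (L₀ W : H →ₗ.[ℂ] H) (e : ℝ) : H →L[ℂ] H :=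
  limUnder (𝓝[>] (0 : ℝ)) fun ε : ℝ =>
    -(ContinuousLinearMap.adjoint (boundedComp W (eigProj L₀ e)) ∘L (1 - eigProj L₀ e) ∘L
      resolvent L₀ (e - Complex.I * ε) ∘L boundedComp W (eigProj L₀ e))

/-- The eigenspace of `Λ_e`, as an operator on the finite dimensional space `Ran P_e`. -/
def levelEigenspace (L₀ W : H →ₗ.[ℂ] H) (e : ℝ) (μ : ℂ) : Submodule ℂ H :=
  eigenspace L₀ e ⊓ Module.End.eigenspace (levelShift L₀ W e : H →ₗ[ℂ] H) μ

/-- The kernel of the spectral projection of `Λ_e` for a simple eigenvalue `μ`: the range of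
`Λ_e - μ` on `Ran P_e`, plus the orthogonal complement of `Ran P_e`. -/
def levelCoeigenspace (L₀ W : H →ₗ.[ℂ] H) (e : ℝ) (μ : ℂ) : Submodule ℂ H :=
  (eigenspace L₀ e).map ((levelShift L₀ W e : H →ₗ[ℂ] H) - μ • LinearMap.id) ⊔
    (eigenspace L₀ e)ᗮ

open Classical in
/-- The spectral (Riesz) projection of `Λ_e` at a simple eigenvalue `μ`, extended by `0` to
`Ran P_e^⊥`. It is in general not an orthogonal projection. -/
def levelProj (L₀ W : H →ₗ.[ℂ] H) (e : ℝ) (μ : ℂ) : H →ₗ[ℂ] H :=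
  if h : IsCompl (levelEigenspace L₀ W e μ) (levelCoeigenspace L₀ W e μ) then
    Submodule.projection _ _ h
  else 0

/-- The multiplicity `m_e` of the eigenvalue `e` of `L₀`. -/
def mult (L₀ : H →ₗ.[ℂ] H) (e : ℝ) : ℕ := Module.finrank ℂ (eigenspace L₀ e)

/-- The eigenvalues of `L₀` are the elements of the finite set `stab ∪ unst`, with finite
multiplicities. For small `Δ ≠ 0` the eigenvalues of `L` are simple, and they are exactly the
`E e Δ` with `e ∈ stab` (partially stable), where `E e Δ → e` as `Δ → 0`. -/
structure EigenvalueAssumptions (L₀ W : H →ₗ.[ℂ] H) (Δ₀ : ℝ) (stab unst : Finset ℝ)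
    (E : ℝ → ℝ → ℝ) : Prop where
  disjoint : Disjoint stab unst
  isEigenvalue_iff : ∀ e, IsEigenvalue L₀ e ↔ e ∈ stab ∪ unst
  finiteDimensional : ∀ e, FiniteDimensional ℂ (eigenspace L₀ e)
  tendsto : ∀ e ∈ stab, Tendsto (E e) (𝓝[≠] 0) (𝓝 e)
  simple : ∀ Δ, Δ ≠ 0 → |Δ| ≤ Δ₀ → ∀ e ∈ stab,
    Module.finrank ℂ (eigenspace (perturbed L₀ W Δ) (E e Δ)) = 1
  all : ∀ Δ, Δ ≠ 0 → |Δ| ≤ Δ₀ → ∀ x, IsEigenvalue (perturbed L₀ W Δ) x → ∃ e ∈ stab, x = E e Δ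

/-- The first order correction vanishes: `P_e W P_e = 0`. -/
def FirstOrderVanishes (L₀ W : H →ₗ.[ℂ] H) (ev : Finset ℝ) : Prop :=
  ∀ e ∈ ev, ∀ x ∈ eigenspace L₀ e, ∃ hx : x ∈ W.domain, eigProj L₀ e (W ⟨x, hx⟩) = 0

/-- The limiting absorption principle, for `P_e^⊥ L P_e^⊥` in the strips of half width `α` around the
eigenvalues `e`, and for `L` outside of these strips. The constants are independent of `z` and of
`Δ ∈ [-Δ₀, Δ₀]`. -/
structure LimitingAbsorption (L₀ W : H →ₗ.[ℂ] H) (Δ₀ α : ℝ) (D : Set H) (ev : Finset ℝ) :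
    Prop where
  dense : Dense D
  range_subset : ∀ e ∈ ev, ∀ x ∈ eigenspace L₀ e, ∃ hx : x ∈ W.domain, W ⟨x, hx⟩ ∈ D
  near : ∀ φ ∈ D, ∀ ψ ∈ D, ∃ C : ℝ, ∀ Δ : ℝ, |Δ| ≤ Δ₀ → ∀ e ∈ ev, ∀ z : ℂ, z.im < 0 →
    |z.re - e| ≤ α → ∀ k ≤ 3,
      ‖iteratedDeriv k (fun ζ => inner ℂ φ
        (reducedResolvent (perturbed L₀ W Δ) (eigenspace L₀ e) ζ ψ)) z‖ ≤ C
  away : ∀ φ ∈ D, ∀ ψ ∈ D, ∃ C : ℝ, ∀ Δ : ℝ, |Δ| ≤ Δ₀ → ∀ z : ℂ, z.im < 0 →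
    (∀ e ∈ ev, α < |z.re - e|) → ∀ k ≤ 1,
      ‖iteratedDeriv k (fun ζ => inner ℂ φ (resolvent (perturbed L₀ W Δ) ζ ψ)) z‖ ≤ C

/-- Regularity in the coupling: `(d/dΔ) P_e W R_z^{P_e} W P_e` exists and is bounded, uniformly in `z` and
`|Δ| ≤ Δ₀` (with one-sided derivatives at the end points). -/
def RegularInCoupling (L₀ W : H →ₗ.[ℂ] H) (Δ₀ α : ℝ) (ev : Finset ℝ) : Prop :=
  ∃ C : ℝ, ∀ e ∈ ev, ∀ z : ℂ, z.im < 0 → |z.re - e| ≤ α → ∀ Δ ∈ Set.Icc (-Δ₀) Δ₀,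
    ∃ T : H →L[ℂ] H, HasDerivWithinAt (feshbachTerm L₀ W e z) T (Set.Icc (-Δ₀) Δ₀) Δ ∧ ‖T‖ ≤ C

/-- The Fermi golden rule condition: `Λ_e` has the `m_e` distinct eigenvalues `lam e j`,
`j < m_e`. They have positive imaginary part, except that `lam e 0` is real if `e` is partially
stable. -/
structure FermiGoldenRule (L₀ W : H →ₗ.[ℂ] H) (stab unst : Finset ℝ) (lam : ℝ → ℕ → ℂ) :
    Prop where
  isEigenvalue : ∀ e ∈ stab ∪ unst, ∀ j < mult L₀ e, levelEigenspace L₀ W e (lam e j) ≠ ⊥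
  simple : ∀ e ∈ stab ∪ unst, ∀ i < mult L₀ e, ∀ j < mult L₀ e, lam e i = lam e j → i = j
  unstable : ∀ e ∈ unst, ∀ j < mult L₀ e, 0 < (lam e j).im
  stable_zero : ∀ e ∈ stab, (lam e 0).im = 0
  stable : ∀ e ∈ stab, ∀ j, 1 ≤ j → j < mult L₀ e → 0 < (lam e j).im

/-- The indices `(e, j)` of the decaying terms: `j < m_e`, and `j ≠ 0` if `e` is partially
stable. -/
def IsDecayIndex (L₀ : H →ₗ.[ℂ] H) (stab unst : Finset ℝ) (e : ℝ) (j : ℕ) : Prop :=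
  j < mult L₀ e ∧ (e ∈ unst ∨ e ∈ stab ∧ 1 ≤ j)

/-- Sesquilinear forms on the span of `D` (conjugate linear in the first argument). -/
abbrev SesqForm (D : Set H) : Type _ :=
  Submodule.span ℂ D →ₗ⋆[ℂ] Submodule.span ℂ D →ₗ[ℂ] ℂ

end

end Resonance

/-! In the lower half plane the Laplace transform of ⟨φ, e^{itL}ψ⟩ is i⟨φ, R_zψ⟩, and that of
e^{itb} is i/(b - z). So the remainder r has transform iF, where F is ⟨φ, R_zψ⟩ minus finitely many
simple poles, and -it r(t) has transform iF'. If |F'(x - iη)| ≤ g(x) for all η > 0 with g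
integrable, Fourier inversion bounds e^{-ηt} t|r(t)| by ∫ g, and η → 0 gives |r(t)| ≤ C/t
(`norm_le_div_of_laplace_bound`). The task is therefore to bound F' by a multiple of 1/(1 + x²) plus
Lorentzians of width Δ² centred at the eigenvalues e. The mass of such a Lorentzian is π for every
Δ, so the constant is uniform (`ResonanceAssumptions.exists_resonances`).

Near e the Feshbach reduction turns (L - z)u = ψ into a finite system with matrix e - z + Δ²M, where
M = -P_e W R_z^{P_e} W P_e; there is no term linear in Δ because P_e W P_e = 0. By limiting
absorption M has three derivatives bounded up to the real axis, it is Lipschitz in Δ, and at Δ = 0,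
z → e it tends to Λ_e. As Λ_e has simple spectrum, M can be diagonalized near this limit by
functions that inherit these bounds (`exists_contDiffAt_diagonalization`, `exists_diagonalization`).
This gives ⟨φ, R_zψ⟩ = regular + Σ_j q_j(z)/(e - z + Δ²a_j(z)).

If Im a_j is bounded below, freezing a_j and q_j at z = e changes the derivative of the j-th term by
O(1 + Δ²/(|z - e| + Δ²)²) only (`norm_deriv_sub_pole_le`). The frozen values are the exponents and
the forms of the expansion. For a partially stable e the index 0 has no such lower bound. There the
denominator must vanish at the eigenvalue E_e, as otherwise its eigenvector would be zero
(`denom_eigenvalue`). Expanding at E_e, with three derivatives of a_0, the term agrees with a simple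
pole up to a bounded derivative (`norm_deriv_sub_real_pole_le`), and the residue is ⟨φ, Π_{E_e}ψ⟩
(`inner_eigProj_eq`).

In the strips around the e, but away from e itself, e - z dominates Δ²M and the resolvent is
bounded. Outside the strips limiting absorption for R_z applies directly. At high energy, moving L
onto φ and ψ gives the decay 1/|z|² of the derivative (`inner_resolvent_expansion`). The vectors Lφ
and Lψ depend on Δ there, and uniformity comes from comparing two admissible couplings. -/

namespace Resonance
open Filter Topology MeasureTheory

/-! ### Laplace transforms on the lower half plane and Fourier inversion. -/

noncomputable section LaplaceTransform

/-- The Laplace transform `∫₀^∞ exp (-i z t) r t dt` on the lower half plane. -/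
def laplace (r : ℝ → ℂ) (z : ℂ) : ℂ := ∫ t in Set.Ioi (0 : ℝ), Complex.exp (-Complex.I * z * t) * r t

theorem norm_exp_neg_I_mul (z : ℂ) (t : ℝ) :
    ‖Complex.exp (-Complex.I * z * t)‖ = Real.exp (z.im * t) := by
  rw [Complex.norm_exp]; congr 1; simp

theorem norm_exp_I_mul_le_one {b : ℂ} (hb : 0 ≤ b.im) {t : ℝ} (ht : 0 ≤ t) :
    ‖Complex.exp (Complex.I * t * b)‖ ≤ 1 := by
  rw [Complex.norm_exp, Real.exp_le_one_iff]
  have : 0 ≤ t * b.im := by positivity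
  simpa using this

/-- Half of the exponential decay pays for the factor t, since s t ≤ e^{st}. -/
theorem mul_exp_neg_le {s t : ℝ} (hs : 0 < s) :
    t * Real.exp (-(2 * s) * t) ≤ s⁻¹ * Real.exp (-s * t) := by
  have h1 : s * t ≤ Real.exp (s * t) := (by linarith : s * t ≤ s * t + 1).trans (Real.add_one_le_exp _)
  have h2 : t ≤ s⁻¹ * Real.exp (s * t) := by
    rw [inv_mul_eq_div, le_div_iff₀ hs]; linarith
  calc t * Real.exp (-(2 * s) * t) ≤ s⁻¹ * Real.exp (s * t) * Real.exp (-(2 * s) * t) := by gcongr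
    _ = s⁻¹ * Real.exp (-s * t) := by
      rw [mul_assoc, ← Real.exp_add]; congr 2; ring

theorem integrableOn_exp_neg_mul {s : ℝ} (hs : 0 < s) (c : ℝ) :
    IntegrableOn (fun t : ℝ => c * Real.exp (-s * t)) (Set.Ioi 0) :=
  (exp_neg_integrableOn_Ioi 0 hs).const_mul c

variable {r : ℝ → ℂ} {M : ℝ}

theorem integrableOn_laplace (hc : Continuous r) (hM : ∀ t, 0 ≤ t → ‖r t‖ ≤ M) {z : ℂ}
    (hz : z.im < 0) :
    IntegrableOn (fun t : ℝ => Complex.exp (-Complex.I * z * t) * r t) (Set.Ioi 0) := by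
  refine Integrable.mono' (integrableOn_exp_neg_mul (neg_pos.mpr hz) M)
    (by fun_prop : Continuous _).aestronglyMeasurable ?_
  filter_upwards [ae_restrict_mem measurableSet_Ioi] with t ht
  rw [norm_mul, norm_exp_neg_I_mul, neg_neg, mul_comm]
  gcongr
  exact hM t (le_of_lt ht)

theorem hasDerivAt_laplace (hc : Continuous r) (hM : ∀ t, 0 ≤ t → ‖r t‖ ≤ M) {z : ℂ}
    (hz : z.im < 0) :
    HasDerivAt (laplace r) (laplace (fun t => -Complex.I * t * r t) z) z := by
  have hM0 : 0 ≤ M := (norm_nonneg _).trans (hM 0 le_rfl)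
  -- With Im z = -4s the half plane Im w < -2s is a neighbourhood of z. Of the decay rate 2s
  -- available there, half absorbs the factor t of the derivative and half keeps the dominating
  -- function integrable.
  let s : ℝ := -z.im / 4
  have hs : 0 < s := by simp only [s]; linarith
  have h := hasDerivAt_integral_of_dominated_loc_of_deriv_le
    (μ := volume.restrict (Set.Ioi (0 : ℝ)))
    (F := fun (w : ℂ) (t : ℝ) => Complex.exp (-Complex.I * w * t) * r t)
    (F' := fun (w : ℂ) (t : ℝ) => Complex.exp (-Complex.I * w * t) * (-Complex.I * t * r t))
    (x₀ := z) (s := {w : ℂ | w.im < -(2 * s)})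
    (bound := fun t => s⁻¹ * M * Real.exp (-s * t))
    ?_ ?_ ?_ ?_ ?_ ?_ ?_
  · exact h.2
  · refine (isOpen_lt Complex.continuous_im continuous_const).mem_nhds ?_
    change z.im < -(2 * s)
    simp only [s]; linarith
  · exact Eventually.of_forall fun w => (by fun_prop : Continuous _).aestronglyMeasurable
  · exact integrableOn_laplace hc hM hz
  · exact (by fun_prop : Continuous _).aestronglyMeasurable
  · filter_upwards [ae_restrict_mem measurableSet_Ioi] with t ht w hw
    have ht' : 0 < t := ht
    rw [norm_mul, norm_exp_neg_I_mul, norm_mul, norm_mul, norm_neg, Complex.norm_I, one_mul,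
      Complex.norm_real, Real.norm_of_nonneg ht'.le]
    have h1 : Real.exp (w.im * t) ≤ Real.exp (-(2 * s) * t) :=
      Real.exp_le_exp.mpr (mul_le_mul_of_nonneg_right (le_of_lt hw) ht'.le)
    calc Real.exp (w.im * t) * (t * ‖r t‖) ≤ Real.exp (-(2 * s) * t) * (t * M) :=
          mul_le_mul h1 (mul_le_mul_of_nonneg_left (hM t ht'.le) ht'.le) (by positivity) (by positivity)
      _ = t * Real.exp (-(2 * s) * t) * M := by ring
      _ ≤ s⁻¹ * Real.exp (-s * t) * M := mul_le_mul_of_nonneg_right (mul_exp_neg_le hs) hM0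
      _ = _ := by ring
  · exact integrableOn_exp_neg_mul hs _
  · refine Eventually.of_forall fun t w _ => ?_
    have h1 : HasDerivAt (fun w : ℂ => -Complex.I * w * t) (-Complex.I * t) w := by
      simpa using ((hasDerivAt_id w).const_mul (-Complex.I)).mul_const (t : ℂ)
    exact (h1.cexp.mul_const (r t)).congr_deriv (by ring)

theorem laplace_exp {b z : ℂ} (h : z.im < b.im) :
    laplace (fun t => Complex.exp (Complex.I * t * b)) z = Complex.I / (b - z) := by
  have hre : (Complex.I * (b - z)).re < 0 := by simp; linarith
  have hne : b - z ≠ 0 := by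
    intro h0
    rw [sub_eq_zero] at h0
    rw [h0] at h; exact lt_irrefl _ h
  have h1 := integral_exp_mul_complex_Ioi hre 0
  simp only [laplace, ← Complex.exp_add]
  have h2 : ∀ t : ℝ, -Complex.I * z * t + Complex.I * t * b = Complex.I * (b - z) * t := fun t => by
    ring
  simp only [h2, h1]
  simp only [Complex.ofReal_zero, mul_zero, Complex.exp_zero]
  field_simp
  simp

/-- If the derivative of the Laplace transform of `r` is integrable along horizontal lines, uniformly
up to the real axis, then `r` decays like `1 / t`. -/
theorem norm_le_div_of_laplace_bound (hc : Continuous r) (hM : ∀ t, 0 ≤ t → ‖r t‖ ≤ M)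
    {η₀ C : ℝ} (hη₀ : 0 < η₀) {g : ℝ → ℝ} (hg : Integrable g) (hgC : ∫ x, g x ≤ C)
    (hb : ∀ η, 0 < η → η < η₀ → ∀ x : ℝ,
      ‖laplace (fun t => -Complex.I * t * r t) (x - Complex.I * η)‖ ≤ g x) {t : ℝ} (ht : 0 < t) :
    ‖r t‖ ≤ C / t := by
  have key : ∀ η, 0 < η → η < η₀ → Real.exp (-η * t) * (t * ‖r t‖) ≤ C := by
    intro η hη hη'
    -- For fixed η this is e^{-ηt}(-it r(t)) cut off to the half line. It is integrable, and its
    -- Fourier transform at ξ is the Laplace transform at 2πξ - iη, so inversion recovers t r(t) up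
    -- to the damping factor.
    let G : ℝ → ℂ := (Set.Ioi 0).indicator fun t =>
      Complex.exp (-Complex.I * ((0 : ℝ) - Complex.I * η) * t) * (-Complex.I * t * r t)
    have hInt : Integrable G := by
      rw [integrable_indicator_iff measurableSet_Ioi]
      refine Integrable.mono' (integrableOn_exp_neg_mul (half_pos hη) ((η / 2)⁻¹ * M))
        (by fun_prop : Continuous _).aestronglyMeasurable ?_
      filter_upwards [ae_restrict_mem measurableSet_Ioi] with t ht
      have ht' : 0 < t := ht
      rw [norm_mul, norm_exp_neg_I_mul, norm_mul, norm_mul, norm_neg, Complex.norm_I, one_mul,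
        Complex.norm_real, Real.norm_of_nonneg ht'.le]
      have h1 := mul_exp_neg_le (t := t) (half_pos hη)
      have h2 : (((0 : ℝ) : ℂ) - Complex.I * η).im = -(2 * (η / 2)) := by simp; ring
      have hM0 : 0 ≤ M := (norm_nonneg _).trans (hM 0 le_rfl)
      rw [h2]
      calc Real.exp (-(2 * (η / 2)) * t) * (t * ‖r t‖)
          ≤ Real.exp (-(2 * (η / 2)) * t) * (t * M) := by gcongr; exact hM t ht'.le
        _ = t * Real.exp (-(2 * (η / 2)) * t) * M := by ring
        _ ≤ (η / 2)⁻¹ * Real.exp (-(η / 2) * t) * M := mul_le_mul_of_nonneg_right h1 hM0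
        _ = _ := by ring
    have hF : ∀ ξ : ℝ, FourierTransform.fourier G ξ =
        laplace (fun t => -Complex.I * t * r t) ((2 * Real.pi * ξ : ℝ) - Complex.I * η) := by
      intro ξ
      rw [Real.fourier_eq', laplace, ← integral_indicator measurableSet_Ioi]
      congr 1
      funext v
      by_cases hv : v ∈ Set.Ioi (0 : ℝ)
      · simp only [G, Set.indicator_of_mem hv, smul_eq_mul, ← mul_assoc, ← Complex.exp_add]
        congr 4
        simp
        ring
      · simp only [G, Set.indicator_of_notMem hv, smul_zero]
    have hFb : ∀ ξ, ‖FourierTransform.fourier G ξ‖ ≤ g (2 * Real.pi * ξ) := fun ξ => by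
      rw [hF]; exact_mod_cast hb η hη hη' _
    have hgi : Integrable fun ξ => g (2 * Real.pi * ξ) := hg.comp_mul_left' (by positivity)
    have hFi : Integrable (FourierTransform.fourier G) := by
      refine hgi.mono' ?_ (Eventually.of_forall hFb)
      exact (VectorFourier.fourierIntegral_continuous Real.continuous_fourierChar
        (by exact continuous_inner) hInt).aestronglyMeasurable
    have hcont : ContinuousAt G t := by
      have : G =ᶠ[𝓝 t] fun t =>
          Complex.exp (-Complex.I * ((0 : ℝ) - Complex.I * η) * t) * (-Complex.I * t * r t) := by
        filter_upwards [isOpen_Ioi.mem_nhds (show t ∈ Set.Ioi 0 from ht)] with s hs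
        exact Set.indicator_of_mem hs _
      exact ContinuousAt.congr (by fun_prop : Continuous _).continuousAt this.symm
    have hinv := hInt.fourierInv_fourier_eq hFi hcont
    have hGt : ‖G t‖ = Real.exp (-η * t) * (t * ‖r t‖) := by
      simp only [G]
      rw [Set.indicator_of_mem (show t ∈ Set.Ioi 0 from ht), norm_mul, norm_exp_neg_I_mul, norm_mul,
        norm_mul, norm_neg, Complex.norm_I, one_mul, Complex.norm_real, Real.norm_of_nonneg ht.le]
      simp
    rw [← hGt, ← hinv, Real.fourierInv_eq']
    -- The substitution x = 2πξ yields a factor 1/(2π). It is replaced by 1, which is legitimate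
    -- because the integral is nonnegative.
    have hg0 : 0 ≤ ∫ x, g x := integral_nonneg fun x => by
      have := (norm_nonneg _).trans (hFb (x / (2 * Real.pi)))
      rwa [mul_div_cancel₀ _ (by positivity)] at this
    calc _ ≤ ∫ ξ, g (2 * Real.pi * ξ) := by
          refine norm_integral_le_of_norm_le hgi (Eventually.of_forall fun ξ => ?_)
          rw [norm_smul, Complex.norm_exp]
          simpa using hFb ξ
      _ = |(2 * Real.pi)⁻¹| * ∫ x, g x := by
          rw [Measure.integral_comp_mul_left g (2 * Real.pi), smul_eq_mul]
      _ ≤ 1 * ∫ x, g x := by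
          gcongr
          rw [abs_of_pos (by positivity)]
          exact inv_le_one_of_one_le₀ (by nlinarith [Real.pi_gt_three])
      _ ≤ C := by rwa [one_mul]
  rw [le_div_iff₀ ht, mul_comm]
  have hlim : Tendsto (fun η : ℝ => Real.exp (-η * t) * (t * ‖r t‖)) (𝓝[>] 0)
      (𝓝 (Real.exp (-0 * t) * (t * ‖r t‖))) :=
    ((by fun_prop : Continuous fun η : ℝ => Real.exp (-η * t) * (t * ‖r t‖)).tendsto 0).mono_left
      nhdsWithin_le_nhds
  rw [neg_zero, zero_mul, Real.exp_zero, one_mul] at hlim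
  refine le_of_tendsto hlim ?_
  filter_upwards [Ioo_mem_nhdsGT hη₀] with η hη using key η hη.1 hη.2

variable {H : Type*} [NormedAddCommGroup H] [InnerProductSpace ℂ H] {A : H →ₗ.[ℂ] H}
  {U : ℝ → H →L[ℂ] H}

/-- The derivative at 0 is transported to t by the group law U_s = U_t U_{s-t}. -/
theorem IsUnitaryGroup.hasDerivAt_apply (hU : IsUnitaryGroup A U) (x : A.domain) (t : ℝ) :
    HasDerivAt (fun s => U s (x : H)) (U t (Complex.I • A x)) t := by
  have h0 : HasDerivAt (fun s => U s (x : H)) (Complex.I • A x) (t - t) := by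
    rw [sub_self]; exact hU.hasDerivAt x
  have h1 : HasDerivAt (fun s => U (s - t) (x : H)) (Complex.I • A x) t := by
    simpa [Function.comp_def] using HasDerivAt.scomp (h := fun s => s - t) t h0 ((hasDerivAt_id' t).sub_const t)
  have h2 := ((U t).restrictScalars ℝ).hasFDerivAt.comp_hasDerivAt t h1
  refine h2.congr_of_eventuallyEq (Eventually.of_forall fun s => ?_)
  change U s x = U t (U (s - t) x)
  rw [← mul_apply_eq_comp, ← hU.add]
  congr 2; ring

/-- The Laplace transform of the propagator is the resolvent. -/
theorem laplace_unitaryGroup (hU : IsUnitaryGroup A U) {z : ℂ} (hz : z.im < 0) {R : H →L[ℂ] H}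
    (hR : IsResolvent A z R) (φ ψ : H) :
    laplace (fun t => inner ℂ φ (U t ψ)) z = Complex.I * inner ℂ φ (R ψ) := by
  obtain ⟨hx, hAx⟩ := hR.1 ψ
  set x : A.domain := ⟨R ψ, hx⟩
  -- With x = R_zψ in the domain, the integrand has an explicit primitive, because U_t(A - z)x =
  -- U_tψ. The primitive vanishes at infinity, and its value at 0 gives the resolvent matrix
  -- element.
  have hd : ∀ t ∈ Set.Ici (0 : ℝ), HasDerivAt
      (fun t : ℝ => -Complex.I * (Complex.exp (-Complex.I * z * t) * inner ℂ φ (U t x)))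
      (Complex.exp (-Complex.I * z * t) * inner ℂ φ (U t ψ)) t := by
    intro t _
    have h1 : HasDerivAt (fun t : ℝ => Complex.exp (-Complex.I * z * t))
        (Complex.exp (-Complex.I * z * t) * (-Complex.I * z)) t := by
      have : HasDerivAt (fun t : ℝ => -Complex.I * z * (t : ℂ)) (-Complex.I * z) t := by
        simpa using (Complex.ofRealCLM.hasDerivAt (x := t)).const_mul (-Complex.I * z)
      exact this.cexp
    have h2 : HasDerivAt (fun t : ℝ => inner ℂ φ (U t x)) (inner ℂ φ (U t (Complex.I • A x))) t :=
      ((innerSL ℂ φ).restrictScalars ℝ).hasFDerivAt.comp_hasDerivAt t (hU.hasDerivAt_apply x t)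
    refine ((h1.mul h2).const_mul (-Complex.I)).congr_deriv ?_
    have h3 : A x = ψ + z • (x : H) := by rw [← hAx]; simp [x]
    rw [h3, map_smul, map_add, map_smul, inner_smul_right, inner_add_right, inner_smul_right]
    linear_combination (-(Complex.exp (-Complex.I * z * t) * inner ℂ φ (U t ψ))) * Complex.I_sq
  have hc : Continuous fun t => inner ℂ φ (U t ψ) := continuous_const.inner (hU.continuous ψ)
  have hb : ∀ y t, ‖inner ℂ φ (U t y)‖ ≤ ‖φ‖ * ‖y‖ := fun y t => by
    rw [← hU.norm_map t y]; exact norm_inner_le_norm _ _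
  have hlim : Tendsto (fun t : ℝ => -Complex.I * (Complex.exp (-Complex.I * z * t) *
      inner ℂ φ (U t x))) atTop (𝓝 0) := by
    refine squeeze_zero_norm (a := fun t => Real.exp (z.im * t) * (‖φ‖ * ‖(x : H)‖)) (fun t => ?_) ?_
    · rw [norm_mul, norm_mul, norm_neg, Complex.norm_I, one_mul, norm_exp_neg_I_mul]
      gcongr
      exact hb _ _
    · have : Tendsto (fun t : ℝ => Real.exp (z.im * t)) atTop (𝓝 0) :=
        Real.tendsto_exp_atBot.comp (tendsto_id.const_mul_atTop_of_neg hz)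
      simpa using this.mul_const (‖φ‖ * ‖(x : H)‖)
  have h := integral_Ioi_of_hasDerivAt_of_tendsto' hd
    (integrableOn_laplace hc (fun t _ => hb ψ t) hz) hlim
  rw [laplace, h]
  simp [hU.zero, x]

end LaplaceTransform

/-! ### Families of holomorphic functions with uniformly bounded derivatives. -/

section BoundedDerivatives

variable {ι G : Type*} [NormedAddCommGroup G] [NormedSpace ℂ G]

/-- The functions `f i`, `i ∈ s`, are holomorphic on `Ω`, and their derivatives of order at most `n`
are bounded there, uniformly in `i`. -/
def UnifBddDeriv (n : ℕ) (s : Set ι) (Ω : Set ℂ) (f : ι → ℂ → G) : Prop :=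
  ∃ C : ℝ, ∀ i ∈ s, DifferentiableOn ℂ (f i) Ω ∧ ∀ k ≤ n, ∀ z ∈ Ω, ‖iteratedDeriv k (f i) z‖ ≤ C

variable {n : ℕ} {s : Set ι} {Ω : Set ℂ} {f g : ι → ℂ → G}

theorem UnifBddDeriv.mono (hf : UnifBddDeriv n s Ω f) {m : ℕ} {s' : Set ι} {Ω' : Set ℂ} (hm : m ≤ n)
    (hs : s' ⊆ s) (hΩ : Ω' ⊆ Ω) : UnifBddDeriv m s' Ω' f := by
  obtain ⟨C, hC⟩ := hf
  exact ⟨C, fun i hi => ⟨(hC i (hs hi)).1.mono hΩ, fun k hk z hz =>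
    (hC i (hs hi)).2 k (hk.trans hm) z (hΩ hz)⟩⟩

theorem UnifBddDeriv.congr (hΩ : IsOpen Ω) (hf : UnifBddDeriv n s Ω f)
    (h : ∀ i ∈ s, ∀ z ∈ Ω, g i z = f i z) : UnifBddDeriv n s Ω g := by
  obtain ⟨C, hC⟩ := hf
  refine ⟨C, fun i hi => ⟨(hC i hi).1.congr (h i hi), fun k hk z hz => ?_⟩⟩
  have : g i =ᶠ[𝓝 z] f i := by
    filter_upwards [hΩ.mem_nhds hz] with w hw using h i hi w hw
  rw [this.iteratedDeriv_eq k]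
  exact (hC i hi).2 k hk z hz

theorem unifBddDeriv_const {c : ι → G} {C : ℝ} (hc : ∀ i ∈ s, ‖c i‖ ≤ C) :
    UnifBddDeriv n s Ω fun i _ => c i := by
  refine ⟨max C 0, fun i hi => ⟨differentiableOn_const _, fun k _ z _ => ?_⟩⟩
  rw [iteratedDeriv_const]
  split_ifs
  · exact (hc i hi).trans (le_max_left _ _)
  · simp

theorem norm_iteratedFDerivWithin_eq (hΩ : IsOpen Ω) (k : ℕ) {u : ℂ → G} {z : ℂ} (hz : z ∈ Ω) :
    ‖iteratedFDerivWithin ℂ k u Ω z‖ = ‖iteratedDeriv k u z‖ := by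
  rw [iteratedFDerivWithin_of_isOpen k hΩ hz, norm_iteratedFDeriv_eq_norm_iteratedDeriv]

variable [CompleteSpace G]

theorem UnifBddDeriv.add (hΩ : IsOpen Ω) (hf : UnifBddDeriv n s Ω f) (hg : UnifBddDeriv n s Ω g) :
    UnifBddDeriv n s Ω fun i z => f i z + g i z := by
  obtain ⟨C, hC⟩ := hf
  obtain ⟨C', hC'⟩ := hg
  refine ⟨C + C', fun i hi => ⟨(hC i hi).1.add (hC' i hi).1, fun k hk z hz => ?_⟩⟩
  rw [iteratedDeriv_fun_add (((hC i hi).1.contDiffOn hΩ).contDiffAt (hΩ.mem_nhds hz))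
    (((hC' i hi).1.contDiffOn hΩ).contDiffAt (hΩ.mem_nhds hz))]
  exact (norm_add_le _ _).trans (add_le_add ((hC i hi).2 k hk z hz) ((hC' i hi).2 k hk z hz))

theorem UnifBddDeriv.sum {κ : Type*} (hΩ : IsOpen Ω) (t : Finset κ) {f : κ → ι → ℂ → G}
    (hf : ∀ j ∈ t, UnifBddDeriv n s Ω (f j)) :
    UnifBddDeriv n s Ω fun i z => ∑ j ∈ t, f j i z := by
  classical
  induction t using Finset.induction_on with
  | empty => simpa using unifBddDeriv_const (c := fun _ : ι => (0 : G)) (C := 0) (by simp)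
  | insert a t ha ih =>
    simp only [Finset.sum_insert ha]
    exact (hf a (Finset.mem_insert_self _ _)).add hΩ
      (ih fun j hj => hf j (Finset.mem_insert_of_mem hj))

theorem UnifBddDeriv.smul (hΩ : IsOpen Ω) {c : ι → ℂ → ℂ} (hc : UnifBddDeriv n s Ω c)
    (hf : UnifBddDeriv n s Ω f) : UnifBddDeriv n s Ω fun i z => c i z • f i z := by
  obtain ⟨C, hC⟩ := hc
  obtain ⟨C', hC'⟩ := hf
  -- The Leibniz bounds of all orders up to n are added so that one constant serves every order.
  refine ⟨∑ l ∈ Finset.range (n + 1), ∑ j ∈ Finset.range (l + 1), (l.choose j : ℝ) * |C| * |C'|,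
    fun i hi => ⟨(hC i hi).1.smul (hC' i hi).1, fun k hk z hz => ?_⟩⟩
  rw [← norm_iteratedFDerivWithin_eq hΩ k hz]
  refine ((ContinuousLinearMap.lsmul ℂ ℂ :
    ℂ →L[ℂ] G →L[ℂ] G).norm_iteratedFDerivWithin_le_of_bilinear_of_le_one
      ((hC i hi).1.contDiffOn hΩ) ((hC' i hi).1.contDiffOn hΩ) hΩ.uniqueDiffOn hz le_rfl
      ContinuousLinearMap.opNorm_lsmul_le).trans ?_
  refine le_trans ?_ (Finset.single_le_sum (f := fun l => ∑ j ∈ Finset.range (l + 1),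
    (l.choose j : ℝ) * |C| * |C'|) (fun _ _ => by positivity) (Finset.mem_range.mpr
      (Nat.lt_succ_of_le hk)))
  refine Finset.sum_le_sum fun j hj => ?_
  rw [norm_iteratedFDerivWithin_eq hΩ _ hz, norm_iteratedFDerivWithin_eq hΩ _ hz]
  have hj' : j ≤ k := Nat.lt_succ_iff.mp (Finset.mem_range.mp hj)
  gcongr
  · exact ((hC i hi).2 j (hj'.trans hk) z hz).trans (le_abs_self _)
  · exact ((hC' i hi).2 (k - j) ((Nat.sub_le _ _).trans hk) z hz).trans (le_abs_self _)

theorem UnifBddDeriv.mul (hΩ : IsOpen Ω) {c d : ι → ℂ → ℂ} (hc : UnifBddDeriv n s Ω c)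
    (hd : UnifBddDeriv n s Ω d) : UnifBddDeriv n s Ω fun i z => c i z * d i z :=
  hc.smul hΩ hd

/-- Faà di Bruno: the derivatives of the composition are controlled by those of θ on the range of
the family. This carries the bounds on the Feshbach matrix over to its eigenvalues and eigenvectors.
-/
theorem UnifBddDeriv.comp {F : Type*} [NormedAddCommGroup F] [NormedSpace ℂ F] [CompleteSpace F] (hΩ : IsOpen Ω)
    (hf : UnifBddDeriv n s Ω f) {U : Set G} (hU : IsOpen U) {θ : G → F} (hθ : ContDiffOn ℂ n θ U)
    {K : ℝ} (hK : ∀ k ≤ n, ∀ x ∈ U, ‖iteratedFDeriv ℂ k θ x‖ ≤ K)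
    (hn : n ≠ 0) (hm : ∀ i ∈ s, ∀ z ∈ Ω, f i z ∈ U) : UnifBddDeriv n s Ω fun i z => θ (f i z) := by
  obtain ⟨C, hC⟩ := hf
  -- Since C' ≥ 1, a bound by C on the l-th derivative is also a bound by C'^l when l ≥ 1, the form
  -- in which the composition estimate takes it.
  let C' := max C 1
  refine ⟨∑ l ∈ Finset.range (n + 1), (l.factorial : ℝ) * |K| * C' ^ l, fun i hi => ⟨?_, fun k hk z hz => ?_⟩⟩
  · exact (hθ.differentiableOn (by exact_mod_cast hn)).comp (hC i hi).1 (hm i hi)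
  rw [← norm_iteratedFDerivWithin_eq hΩ k hz]
  have h1 : (1 : ℝ) ≤ C' := le_max_right _ _
  refine (norm_iteratedFDerivWithin_comp_le (g := θ) (f := f i) hθ ((hC i hi).1.contDiffOn hΩ)
    (n := k) (by exact_mod_cast hk) hU.uniqueDiffOn hΩ.uniqueDiffOn (hm i hi) hz (C := |K|) (D := C')
    ?_ ?_).trans ?_
  · intro l hl
    rw [iteratedFDerivWithin_of_isOpen l hU (hm i hi z hz)]
    exact (hK l (hl.trans hk) _ (hm i hi z hz)).trans (le_abs_self _)
  · intro l hl hl'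
    rw [norm_iteratedFDerivWithin_eq hΩ _ hz]
    exact ((hC i hi).2 l (hl'.trans hk) z hz).trans ((le_max_left _ _).trans
      (le_self_pow₀ h1 (by omega)))
  · exact Finset.single_le_sum (f := fun l : ℕ => (l.factorial : ℝ) * |K| * C' ^ l)
      (fun _ _ => by positivity) (Finset.mem_range.mpr (Nat.lt_succ_of_le hk))

end BoundedDerivatives

/-! ### Taylor expansions at points of the boundary. -/

section BoundaryTaylor

variable {Ω : Set ℂ} {p : ℂ} {f : ℂ → ℂ} {C : ℝ}

/-- By convexity and the mean value inequality f is Lipschitz near p, hence Cauchy along a sequence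
tending to p. On the part of Ω within distance ρ of p the Lipschitz constant is Cρ^k, and letting
one of the two points tend to p gives the power k + 1. Applied to successive derivatives, this
produces Taylor expansions at p although f is not defined there. -/
theorem exists_boundary_value (hconv : Convex ℝ Ω) (hp : p ∈ closure Ω) {f' : ℂ → ℂ}
    (hf : ∀ z ∈ Ω, HasDerivAt f (f' z) z) (k : ℕ) (hC : 0 ≤ C)
    (hb : ∀ z ∈ Ω, ‖f' z‖ ≤ C * ‖z - p‖ ^ k) :
    ∃ c, ∀ z ∈ Ω, ‖f z - c‖ ≤ C * ‖z - p‖ ^ (k + 1) := by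
  have key : ∀ ρ, ∀ z ∈ Ω, ∀ w ∈ Ω, ‖z - p‖ ≤ ρ → ‖w - p‖ ≤ ρ →
      ‖f z - f w‖ ≤ C * ρ ^ k * ‖z - w‖ := by
    intro ρ z hz w hw hzρ hwρ
    refine Convex.norm_image_sub_le_of_norm_hasDerivWithin_le (s := Ω ∩ Metric.closedBall p ρ)
      (f' := f') (fun x hx => (hf x hx.1).hasDerivWithinAt) (fun x hx => ?_)
      (hconv.inter (convex_closedBall p ρ)) ⟨hw, by simpa [dist_eq_norm] using hwρ⟩
      ⟨hz, by simpa [dist_eq_norm] using hzρ⟩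
    refine (hb x hx.1).trans ?_
    have : ‖x - p‖ ≤ ρ := by simpa [dist_eq_norm] using hx.2
    gcongr
  obtain ⟨w, hw, hlim⟩ := mem_closure_iff_seq_limit.mp hp
  have hlim' : Tendsto (fun n => ‖w n - p‖) atTop (𝓝 0) := by
    simpa using (hlim.sub_const p).norm
  have hcau : CauchySeq fun n => f (w n) := by
    have hcw := hlim.cauchySeq
    rw [Metric.cauchySeq_iff] at hcw ⊢
    intro ε hε
    obtain ⟨N, hN⟩ := hcw (ε / (C + 1)) (by positivity)
    obtain ⟨N', hN'⟩ := eventually_atTop.mp (hlim'.eventually_lt_const one_pos)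
    refine ⟨max N N', fun m hm n hn => ?_⟩
    have h1 := hN m ((le_max_left _ _).trans hm) n ((le_max_left _ _).trans hn)
    have h2 := key 1 (w m) (hw m) (w n) (hw n) (hN' m ((le_max_right _ _).trans hm)).le
      (hN' n ((le_max_right _ _).trans hn)).le
    rw [dist_eq_norm] at h1 ⊢
    rw [lt_div_iff₀ (by positivity)] at h1
    rw [one_pow, mul_one] at h2
    nlinarith [norm_nonneg (w m - w n)]
  obtain ⟨c, hc⟩ := cauchySeq_tendsto_of_complete hcau
  refine ⟨c, fun z hz => ?_⟩
  have h1 : Tendsto (fun n => ‖f z - f (w n)‖) atTop (𝓝 ‖f z - c‖) := (hc.const_sub _).norm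
  have h2 : Tendsto (fun n => C * (max ‖z - p‖ ‖w n - p‖) ^ k * ‖z - w n‖) atTop
      (𝓝 (C * (max ‖z - p‖ 0) ^ k * ‖z - p‖)) :=
    (((tendsto_const_nhds.max hlim').pow k).const_mul C).mul (hlim.const_sub z).norm
  rw [max_eq_left (norm_nonneg _)] at h2
  have h3 := le_of_tendsto_of_tendsto' h1 h2 fun n =>
    key _ z hz (w n) (hw n) (le_max_left _ _) (le_max_right _ _)
  rw [pow_succ, ← mul_assoc]; exact h3

theorem tendsto_of_norm_sub_le {c : ℂ} (k : ℕ) (h : ∀ z ∈ Ω, ‖f z - c‖ ≤ C * ‖z - p‖ ^ (k + 1)) :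
    Tendsto f (𝓝[Ω] p) (𝓝 c) := by
  rw [tendsto_iff_norm_sub_tendsto_zero]
  have h1 : Tendsto (fun z => C * ‖z - p‖ ^ (k + 1)) (𝓝[Ω] p) (𝓝 (C * ‖p - p‖ ^ (k + 1))) :=
    ((by fun_prop : Continuous fun z : ℂ => C * ‖z - p‖ ^ (k + 1)).tendsto p).mono_left
      nhdsWithin_le_nhds
  rw [sub_self, norm_zero, zero_pow (by omega), mul_zero] at h1
  exact squeeze_zero' (Eventually.of_forall fun _ => norm_nonneg _)
    (eventually_nhdsWithin_of_forall h) h1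

theorem norm_boundary_value_le {c : ℂ} (hp : p ∈ closure Ω) {B : ℝ} (hB : ∀ z ∈ Ω, ‖f z‖ ≤ B)
    (h : Tendsto f (𝓝[Ω] p) (𝓝 c)) : ‖c‖ ≤ B :=
  have := mem_closure_iff_nhdsWithin_neBot.mp hp
  le_of_tendsto h.norm (eventually_nhdsWithin_of_forall hB)

theorem hasDerivAt_deriv (hΩ : IsOpen Ω) (hf : DifferentiableOn ℂ f Ω) {z : ℂ} (hz : z ∈ Ω) :
    HasDerivAt (deriv f) (iteratedDeriv 2 f z) z := by
  rw [iteratedDeriv_succ, iteratedDeriv_one]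
  exact ((hf.deriv hΩ).differentiableAt (hΩ.mem_nhds hz)).hasDerivAt

theorem boundary_taylor_one (hΩ : IsOpen Ω) (hconv : Convex ℝ Ω) (hp : p ∈ closure Ω)
    (hf : DifferentiableOn ℂ f Ω) (hb : ∀ k ≤ 1, ∀ z ∈ Ω, ‖iteratedDeriv k f z‖ ≤ C) (hC : 0 ≤ C) :
    ∃ c, ‖c‖ ≤ C ∧ ∀ z ∈ Ω, ‖f z - c‖ ≤ C * ‖z - p‖ := by
  obtain ⟨c, hc⟩ := exists_boundary_value hconv hp
    (fun z hz => (hf.differentiableAt (hΩ.mem_nhds hz)).hasDerivAt) 0 hC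
    (fun z hz => by simpa using hb 1 le_rfl z hz)
  refine ⟨c, ?_, fun z hz => by simpa using hc z hz⟩
  exact norm_boundary_value_le hp (fun z hz => by simpa using hb 0 (by omega) z hz)
    (tendsto_of_norm_sub_le 0 hc)

/-- The boundary value c₁ of f' comes first. Then f - c₁(z - p) has a derivative of size O(|z - p|),
and integrating it gives the quadratic error. -/
theorem boundary_taylor_two (hΩ : IsOpen Ω) (hconv : Convex ℝ Ω) (hp : p ∈ closure Ω)
    (hf : DifferentiableOn ℂ f Ω) (hb : ∀ k ≤ 2, ∀ z ∈ Ω, ‖iteratedDeriv k f z‖ ≤ C) (hC : 0 ≤ C) :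
    ∃ c₀ c₁, ‖c₀‖ ≤ C ∧ ‖c₁‖ ≤ C ∧ (∀ z ∈ Ω, ‖f z - c₀‖ ≤ C * ‖z - p‖) ∧
      (∀ z ∈ Ω, ‖f z - c₀ - c₁ * (z - p)‖ ≤ C * ‖z - p‖ ^ 2) ∧
      ∀ z ∈ Ω, ‖deriv f z - c₁‖ ≤ C * ‖z - p‖ := by
  have hd0 : ∀ z ∈ Ω, HasDerivAt f (deriv f z) z := fun z hz =>
    (hf.differentiableAt (hΩ.mem_nhds hz)).hasDerivAt
  have hd1 : ∀ z ∈ Ω, HasDerivAt (deriv f) (iteratedDeriv 2 f z) z := fun z hz => hasDerivAt_deriv hΩ hf hz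
  obtain ⟨c₁, hc₁⟩ := exists_boundary_value hconv hp hd1 0 hC
    (fun z hz => by simpa using hb 2 le_rfl z hz)
  obtain ⟨c₀, hc₀, hc₀'⟩ := boundary_taylor_one hΩ hconv hp hf
    (fun k hk => hb k (by omega)) hC
  obtain ⟨c, hc⟩ := exists_boundary_value hconv hp (f := fun z => f z - c₁ * (z - p))
    (f' := fun z => deriv f z - c₁)
    (fun z hz => ((hd0 z hz).sub (((hasDerivAt_id z).sub_const p).const_mul c₁)).congr_deriv
      (by simp)) 1 hC
    (fun z hz => by simpa using hc₁ z hz)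
  -- The functions f and f - c₁(z - p) have the same boundary value at p, because the linear term
  -- tends to 0 there.
  have hcc : c = c₀ := by
    have := mem_closure_iff_nhdsWithin_neBot.mp hp
    have h1 : Tendsto (fun z => f z - c₁ * (z - p)) (𝓝[Ω] p) (𝓝 (c₀ - c₁ * (p - p))) :=
      (tendsto_of_norm_sub_le 0 (by simpa using hc₀')).sub
        (((by fun_prop : Continuous fun z : ℂ => c₁ * (z - p)).tendsto p).mono_left
          nhdsWithin_le_nhds)
    simpa using tendsto_nhds_unique (tendsto_of_norm_sub_le 1 hc) h1
  subst hcc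
  refine ⟨c, c₁, hc₀, ?_, hc₀', fun z hz => ?_, fun z hz => by simpa using hc₁ z hz⟩
  · exact norm_boundary_value_le hp (fun z hz => by simpa using hb 1 (by omega) z hz)
      (tendsto_of_norm_sub_le 0 hc₁)
  · rw [sub_right_comm]; exact hc z hz

/-- The second order expansion of f' is integrated once more. This order is needed for a denominator
that vanishes at a real point. -/
theorem boundary_taylor_three (hΩ : IsOpen Ω) (hconv : Convex ℝ Ω) (hp : p ∈ closure Ω)
    (hf : DifferentiableOn ℂ f Ω) (hb : ∀ k ≤ 3, ∀ z ∈ Ω, ‖iteratedDeriv k f z‖ ≤ C) (hC : 0 ≤ C) :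
    ∃ c₀ c₁ c₂, ‖c₀‖ ≤ C ∧ ‖c₁‖ ≤ C ∧ ‖c₂‖ ≤ C ∧ (∀ z ∈ Ω, ‖f z - c₀‖ ≤ C * ‖z - p‖) ∧
      (∀ z ∈ Ω, ‖f z - c₀ - c₁ * (z - p) - c₂ * (z - p) ^ 2‖ ≤ C * ‖z - p‖ ^ 3) ∧
      ∀ z ∈ Ω, ‖deriv f z - c₁ - 2 * c₂ * (z - p)‖ ≤ C * ‖z - p‖ ^ 2 := by
  have hd0 : ∀ z ∈ Ω, HasDerivAt f (deriv f z) z := fun z hz =>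
    (hf.differentiableAt (hΩ.mem_nhds hz)).hasDerivAt
  have hdd : DifferentiableOn ℂ (deriv f) Ω := hf.deriv hΩ
  obtain ⟨c₁, d, hc₁, hd, hc₁', hc₁2, -⟩ := boundary_taylor_two hΩ hconv hp hdd (C := C)
    (fun k hk z hz => by rw [← iteratedDeriv_succ']; exact hb (k + 1) (by omega) z hz) hC
  obtain ⟨c₀, hc₀, hc₀'⟩ := boundary_taylor_one hΩ hconv hp hf
    (fun k hk => hb k (by omega)) hC
  obtain ⟨c, hc⟩ := exists_boundary_value hconv hp
    (f := fun z => f z - c₁ * (z - p) - d / 2 * (z - p) ^ 2)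
    (f' := fun z => deriv f z - c₁ - d * (z - p))
    (fun z hz => by
      have h1 := ((hasDerivAt_id z).sub_const p)
      refine (((hd0 z hz).sub (h1.const_mul c₁)).sub ((h1.pow 2).const_mul (d / 2))).congr_deriv ?_
      simp; ring) 2 hC
    (fun z hz => by simpa using hc₁2 z hz)
  have hcc : c = c₀ := by
    have := mem_closure_iff_nhdsWithin_neBot.mp hp
    have h1 : Tendsto (fun z => f z - c₁ * (z - p) - d / 2 * (z - p) ^ 2) (𝓝[Ω] p)
        (𝓝 (c₀ - c₁ * (p - p) - d / 2 * (p - p) ^ 2)) :=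
      ((tendsto_of_norm_sub_le 0 (by simpa using hc₀')).sub
        (((by fun_prop : Continuous fun z : ℂ => c₁ * (z - p)).tendsto p).mono_left
          nhdsWithin_le_nhds)).sub
        (((by fun_prop : Continuous fun z : ℂ => d / 2 * (z - p) ^ 2).tendsto p).mono_left
          nhdsWithin_le_nhds)
    simpa using tendsto_nhds_unique (tendsto_of_norm_sub_le 2 hc) h1
  subst hcc
  refine ⟨c, c₁, d / 2, hc₀, hc₁, ?_, hc₀', fun z hz => ?_, fun z hz => ?_⟩
  · rw [norm_div, RCLike.norm_ofNat]; linarith [norm_nonneg d]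
  · convert hc z hz using 2; ring
  · convert hc₁2 z hz using 2; ring

end BoundaryTaylor

/-! ### Comparison of quotients with exact simple poles. -/

section PoleComparison

variable {q a : ℂ → ℂ} {C γ s : ℝ} {z : ℂ}

/-- The denominators `s a - y` are comparable to `‖y‖ + s` in the lower half plane, if `Im a ≥ γ`. -/
theorem norm_add_le_mul_norm_sub {w y : ℂ} (hγ : 0 < γ) (hw : γ ≤ w.im) (hwC : ‖w‖ ≤ C) (hs : 0 < s)
    (hy : y.im ≤ 0) : ‖y‖ + s ≤ (1 + (C + 1) / γ) * ‖s * w - y‖ := by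
  have h1 : s * γ ≤ ‖s * w - y‖ := by
    refine le_trans ?_ (Complex.im_le_norm _)
    have : (s * w - y : ℂ).im = s * w.im - y.im := by simp
    rw [this]; nlinarith
  have h2 : ‖y‖ ≤ ‖s * w - y‖ + s * C := by
    have h := norm_sub_le (s * w : ℂ) (s * w - y)
    rw [sub_sub_cancel, norm_mul, Complex.norm_real, Real.norm_of_nonneg hs.le] at h
    nlinarith [norm_nonneg w]
  have hC : 0 ≤ C := (norm_nonneg _).trans hwC
  have h3 : s ≤ ‖s * w - y‖ / γ := by rw [le_div_iff₀ hγ]; exact h1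
  have h4 : s * (C + 1) ≤ ‖s * w - y‖ / γ * (C + 1) := by gcongr
  calc ‖y‖ + s ≤ ‖s * w - y‖ + s * (C + 1) := by linarith
    _ ≤ ‖s * w - y‖ + ‖s * w - y‖ / γ * (C + 1) := by linarith
    _ = _ := by ring

theorem norm_inv_le_of_le_mul {d : ℂ} {ρ K : ℝ} (hρ : 0 < ρ) (h : ρ ≤ K * ‖d‖) :
    d ≠ 0 ∧ ‖d⁻¹‖ ≤ K / ρ := by
  have hd : 0 < ‖d‖ := by
    by_contra h0
    have : ‖d‖ = 0 := le_antisymm (not_lt.mp h0) (norm_nonneg _)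
    rw [this, mul_zero] at h; linarith
  refine ⟨norm_pos_iff.mp hd, ?_⟩
  rw [norm_inv, inv_eq_one_div, div_le_div_iff₀ hd hρ]; linarith

/-- Put y = z - e, ρ = |y| + s, and let d and d₀ be the true and the frozen denominators; both have
size at least of order ρ. The numerator of the derivative is q₀ + O(|y|²) plus terms carrying a
factor s. The O(|y|²) part over d² is bounded and the s-part is O(s/ρ²). Exchanging d for d₀ costs d
- d₀ = s(a - a₀) = O(sρ) against ρ⁻³, again O(s/ρ²). -/
theorem norm_deriv_sub_pole_le {e q' a' q₀ q₁ a₀ : ℂ} (hC : 0 ≤ C) (hγ : 0 < γ) (hs : 0 < s)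
    (hz : (z - e).im ≤ 0) (hza : γ ≤ (a z).im) (haC : ‖a z‖ ≤ C) (ha₀ : γ ≤ a₀.im) (ha₀C : ‖a₀‖ ≤ C)
    (hqC : ‖q z‖ ≤ C) (hq₀ : ‖q₀‖ ≤ C) (hq'C : ‖q'‖ ≤ C) (ha'C : ‖a'‖ ≤ C)
    (hq2 : ‖q z - q₀ - q₁ * (z - e)‖ ≤ C * ‖z - e‖ ^ 2) (hq1 : ‖q' - q₁‖ ≤ C * ‖z - e‖)
    (ha1 : ‖a z - a₀‖ ≤ C * ‖z - e‖) (hq : HasDerivAt q q' z) (ha : HasDerivAt a a' z) :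
    e - z + s * a z ≠ 0 ∧
    ‖deriv (fun w => q w / (e - w + s * a w)) z - q₀ / (e + s * a₀ - z) ^ 2‖ ≤
      2 * C * (1 + (C + 1) / γ) ^ 2 + (2 * C ^ 2 * (1 + (C + 1) / γ) ^ 2 +
        2 * C ^ 2 * (1 + (C + 1) / γ) ^ 3) * (s / (‖z - e‖ + s) ^ 2) := by
  set K := 1 + (C + 1) / γ
  set y := z - e
  set ρ := ‖y‖ + s
  have hK : 0 < K := by positivity
  have hρ : 0 < ρ := by positivity
  have hyρ : ‖y‖ ≤ ρ := by simp only [ρ]; linarith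
  obtain ⟨hd, hdi⟩ := norm_inv_le_of_le_mul hρ (norm_add_le_mul_norm_sub hγ hza haC hs hz)
  obtain ⟨hd0, hd0i⟩ := norm_inv_le_of_le_mul hρ (norm_add_le_mul_norm_sub hγ ha₀ ha₀C hs hz)
  set d := s * a z - y with hddef
  set d₀ := s * a₀ - y with hd0def
  have e1 : e - z + s * a z = d := by simp only [hddef, y]; ring
  have e2 : e + s * a₀ - z = d₀ := by simp only [hd0def, y]; ring
  have hder : HasDerivAt (fun w => q w / (e - w + s * a w))
      ((q' * d - q z * (-1 + s * a')) / d ^ 2) z := by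
    have h1 : HasDerivAt (fun w => e - w + s * a w) (-1 + s * a') z :=
      ((hasDerivAt_id z).const_sub e).add (ha.const_mul (s : ℂ))
    rw [← e1]
    exact hq.div h1 (by rw [e1]; exact hd)
  refine ⟨by rw [e1]; exact hd, ?_⟩
  rw [hder.deriv, e2]
  have hid : (q' * d - q z * (-1 + s * a')) / d ^ 2 - q₀ / d₀ ^ 2 =
      ((q z - q₀ - q₁ * y) - (q' - q₁) * y) * d⁻¹ ^ 2 + (s * (a z * q' - a' * q z)) * d⁻¹ ^ 2 -
        q₀ * (s * (a z - a₀)) * (d⁻¹ ^ 2 * d₀⁻¹ + d⁻¹ * d₀⁻¹ ^ 2) := by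
    have h1 : (s : ℂ) * (a z - a₀) = d - d₀ := by simp only [hddef, hd0def]; ring
    have h2 : q' * d - q z * (-1 + s * a') =
        ((q z - q₀ - q₁ * y) - (q' - q₁) * y) + s * (a z * q' - a' * q z) + q₀ := by
      simp only [hddef]; ring
    rw [h1, h2]
    field_simp
    ring
  rw [hid]
  have hsn : ‖(s : ℂ)‖ = s := by rw [Complex.norm_real, Real.norm_of_nonneg hs.le]
  have t1 : ‖((q z - q₀ - q₁ * y) - (q' - q₁) * y) * d⁻¹ ^ 2‖ ≤ 2 * C * K ^ 2 := by
    have : ‖(q z - q₀ - q₁ * y) - (q' - q₁) * y‖ ≤ 2 * C * ρ ^ 2 := by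
      calc _ ≤ ‖q z - q₀ - q₁ * y‖ + ‖q' - q₁‖ * ‖y‖ := by
            rw [← norm_mul]; exact norm_sub_le _ _
        _ ≤ C * ‖y‖ ^ 2 + C * ‖y‖ * ‖y‖ := by gcongr
        _ = 2 * C * ‖y‖ ^ 2 := by ring
        _ ≤ _ := by gcongr
    rw [norm_mul, norm_pow]
    calc _ ≤ 2 * C * ρ ^ 2 * (K / ρ) ^ 2 := by gcongr
      _ = _ := by field_simp
  have t2 : ‖(s * (a z * q' - a' * q z)) * d⁻¹ ^ 2‖ ≤ 2 * C ^ 2 * K ^ 2 * (s / ρ ^ 2) := by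
    have : ‖a z * q' - a' * q z‖ ≤ 2 * C ^ 2 := by
      calc _ ≤ ‖a z‖ * ‖q'‖ + ‖a'‖ * ‖q z‖ := by
            rw [← norm_mul, ← norm_mul]; exact norm_sub_le _ _
        _ ≤ C * C + C * C := by gcongr
        _ = _ := by ring
    rw [norm_mul, norm_pow, norm_mul, hsn]
    calc _ ≤ s * (2 * C ^ 2) * (K / ρ) ^ 2 := by gcongr
      _ = _ := by field_simp
  have t3 : ‖q₀ * (s * (a z - a₀)) * (d⁻¹ ^ 2 * d₀⁻¹ + d⁻¹ * d₀⁻¹ ^ 2)‖ ≤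
      2 * C ^ 2 * K ^ 3 * (s / ρ ^ 2) := by
    have : ‖d⁻¹ ^ 2 * d₀⁻¹ + d⁻¹ * d₀⁻¹ ^ 2‖ ≤ 2 * (K / ρ) ^ 3 := by
      refine (norm_add_le _ _).trans ?_
      simp only [norm_mul, norm_pow]
      calc _ ≤ (K / ρ) ^ 2 * (K / ρ) + (K / ρ) * (K / ρ) ^ 2 := by gcongr
        _ = _ := by ring
    rw [norm_mul, norm_mul, norm_mul, hsn]
    calc _ ≤ C * (s * (C * ρ)) * (2 * (K / ρ) ^ 3) := by
          have : ‖a z - a₀‖ ≤ C * ρ := ha1.trans (by gcongr)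
          gcongr
      _ = _ := by field_simp
  calc _ ≤ _ := norm_sub_le _ _
    _ ≤ _ := add_le_add_left (norm_add_le _ _) _
    _ ≤ 2 * C * K ^ 2 + 2 * C ^ 2 * K ^ 2 * (s / ρ ^ 2) + 2 * C ^ 2 * K ^ 3 * (s / ρ ^ 2) :=
        add_le_add (add_le_add t1 t2) t3
    _ = _ := by ring

/-- The derivative of a Laurent expansion with a simple pole has no term of order (z - E)⁻¹, so
after subtraction of the double pole the rest is bounded. Making the first order terms cancel
requires q to second and g to third order. -/
theorem norm_deriv_sub_real_pole_le {g : ℂ → ℂ} {E q' g' q₀ q₁ g₁ g₂ : ℂ} (hC : 0 ≤ C)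
    (hz0 : z ≠ E) (hz1 : ‖z - E‖ ≤ 1) (hg₁ : 1 / 2 ≤ ‖g₁‖) (hg₂C : ‖g₂‖ ≤ C)
    (hgz : ‖z - E‖ / 2 ≤ ‖g z‖) (hgC : ‖g z‖ ≤ C * ‖z - E‖) (hg'C : ‖g'‖ ≤ C)
    (hq₀ : ‖q₀‖ ≤ C) (hq₁ : ‖q₁‖ ≤ C)
    (hq2 : ‖q z - q₀ - q₁ * (z - E)‖ ≤ C * ‖z - E‖ ^ 2) (hq1 : ‖q' - q₁‖ ≤ C * ‖z - E‖)
    (hg3 : ‖g z - g₁ * (z - E) - g₂ * (z - E) ^ 2‖ ≤ C * ‖z - E‖ ^ 3)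
    (hg2 : ‖g' - g₁ - 2 * g₂ * (z - E)‖ ≤ C * ‖z - E‖ ^ 2)
    (hq : HasDerivAt q q' z) (hg : HasDerivAt g g' z) :
    ‖deriv (fun w => q w / g w) z - (-q₀ / g₁) / (E - z) ^ 2‖ ≤
      4 * (10 * C ^ 2 + 8 * C ^ 3) := by
  have hy0 : z - E ≠ 0 := sub_ne_zero.mpr hz0
  set y := z - E with hy
  have hyp : 0 < ‖y‖ := norm_pos_iff.mpr hy0
  have hgne : g z ≠ 0 := norm_pos_iff.mp (lt_of_lt_of_le (by positivity) hgz)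
  have hg1ne : g₁ ≠ 0 := norm_pos_iff.mp (lt_of_lt_of_le (by positivity) hg₁)
  have hder : HasDerivAt (fun w => q w / g w) ((q' * g z - q z * g') / g z ^ 2) z :=
    hq.div hg hgne
  rw [hder.deriv]
  -- The zero of g is factored out with relative error τ = O(|y|²). The difference then has
  -- denominator g(z)² and a numerator in which every summand is visibly O(|y|²).
  obtain ⟨τ, hτ⟩ : ∃ τ, g z = (g₁ + g₂ * y + τ) * y := ⟨g z / y - g₁ - g₂ * y, by field_simp; ring⟩
  have hτb : ‖τ‖ ≤ C * ‖y‖ ^ 2 := by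
    have h1 : g z - g₁ * y - g₂ * y ^ 2 = τ * y := by rw [hτ]; ring
    rw [h1, norm_mul] at hg3
    have h2 : ‖τ‖ * ‖y‖ ≤ (C * ‖y‖ ^ 2) * ‖y‖ := by linarith [hg3]
    exact le_of_mul_le_mul_right h2 hyp
  have hid : (q' * g z - q z * g') / g z ^ 2 - (-q₀ / g₁) / (E - z) ^ 2 =
      ((q' - q₁) * g z + q₁ * y * (g₂ * y + τ) - q₀ * (g' - g₁ - 2 * g₂ * y)
        - q₁ * y * (g' - g₁) - (q z - q₀ - q₁ * y) * g' + q₀ / g₁ * (g₂ * y + τ) ^ 2 + 2 * q₀ * τ) /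
        g z ^ 2 := by
    have h1 : E - z = -y := by simp [hy]
    rw [h1, neg_sq, eq_div_iff (pow_ne_zero 2 hgne), sub_mul, div_mul_cancel₀ _ (pow_ne_zero 2 hgne)]
    have h2 : (-q₀ / g₁) / y ^ 2 * g z ^ 2 = -(q₀ / g₁) * (g₁ + g₂ * y + τ) ^ 2 := by
      rw [hτ]; field_simp
    rw [h2, hτ]
    field_simp
    ring
  rw [hid, norm_div, norm_pow, div_le_iff₀ (by positivity)]
  have hy2 : ‖y‖ ^ 2 ≤ 1 := pow_le_one₀ (norm_nonneg _) hz1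
  have b1 : ‖g₂ * y + τ‖ ≤ 2 * C * ‖y‖ := by
    calc _ ≤ ‖g₂‖ * ‖y‖ + ‖τ‖ := by rw [← norm_mul]; exact norm_add_le _ _
      _ ≤ C * ‖y‖ + C * ‖y‖ ^ 2 := by gcongr
      _ ≤ C * ‖y‖ + C * ‖y‖ := by gcongr; nlinarith
      _ = _ := by ring
  have b2 : ‖g' - g₁‖ ≤ 3 * C * ‖y‖ := by
    have : g' - g₁ = (g' - g₁ - 2 * g₂ * y) + 2 * g₂ * y := by ring
    rw [this]
    calc _ ≤ ‖g' - g₁ - 2 * g₂ * y‖ + ‖2 * g₂ * y‖ := norm_add_le _ _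
      _ ≤ C * ‖y‖ ^ 2 + 2 * C * ‖y‖ := by
        rw [norm_mul, norm_mul, RCLike.norm_ofNat]; gcongr
      _ ≤ C * ‖y‖ + 2 * C * ‖y‖ := by gcongr; nlinarith
      _ = _ := by ring
  have b3 : ‖q₀ / g₁‖ ≤ 2 * C := by
    rw [norm_div, div_le_iff₀ (by linarith)]; nlinarith
  have c1 : ‖(q' - q₁) * g z‖ ≤ C ^ 2 * ‖y‖ ^ 2 := by
    rw [norm_mul]
    calc _ ≤ (C * ‖y‖) * (C * ‖y‖) := by gcongr
      _ = _ := by ring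
  have c2 : ‖q₁ * y * (g₂ * y + τ)‖ ≤ 2 * C ^ 2 * ‖y‖ ^ 2 := by
    rw [norm_mul, norm_mul]
    calc _ ≤ (C * ‖y‖) * (2 * C * ‖y‖) := by gcongr
      _ = _ := by ring
  have c3 : ‖q₀ * (g' - g₁ - 2 * g₂ * y)‖ ≤ C ^ 2 * ‖y‖ ^ 2 := by
    rw [norm_mul]
    calc _ ≤ C * (C * ‖y‖ ^ 2) := by gcongr
      _ = _ := by ring
  have c4 : ‖q₁ * y * (g' - g₁)‖ ≤ 3 * C ^ 2 * ‖y‖ ^ 2 := by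
    rw [norm_mul, norm_mul]
    calc _ ≤ (C * ‖y‖) * (3 * C * ‖y‖) := by gcongr
      _ = _ := by ring
  have c5 : ‖(q z - q₀ - q₁ * y) * g'‖ ≤ C ^ 2 * ‖y‖ ^ 2 := by
    rw [norm_mul]
    calc _ ≤ (C * ‖y‖ ^ 2) * C := by gcongr
      _ = _ := by ring
  have c6 : ‖q₀ / g₁ * (g₂ * y + τ) ^ 2‖ ≤ 8 * C ^ 3 * ‖y‖ ^ 2 := by
    rw [norm_mul, norm_pow]
    calc _ ≤ (2 * C) * (2 * C * ‖y‖) ^ 2 := by gcongr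
      _ = _ := by ring
  have c7 : ‖2 * q₀ * τ‖ ≤ 2 * C ^ 2 * ‖y‖ ^ 2 := by
    rw [norm_mul, norm_mul, RCLike.norm_ofNat]
    calc _ ≤ 2 * C * (C * ‖y‖ ^ 2) := by gcongr
      _ = _ := by ring
  have hnum : ∀ x₁ x₂ x₃ x₄ x₅ x₆ x₇ : ℂ, ‖x₁ + x₂ - x₃ - x₄ - x₅ + x₆ + x₇‖ ≤
      ‖x₁‖ + ‖x₂‖ + ‖x₃‖ + ‖x₄‖ + ‖x₅‖ + ‖x₆‖ + ‖x₇‖ := fun x₁ x₂ x₃ x₄ x₅ x₆ x₇ => by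
    have k1 := norm_add_le (x₁ + x₂ - x₃ - x₄ - x₅ + x₆) x₇
    have k2 := norm_add_le (x₁ + x₂ - x₃ - x₄ - x₅) x₆
    have k3 := norm_sub_le (x₁ + x₂ - x₃ - x₄) x₅
    have k4 := norm_sub_le (x₁ + x₂ - x₃) x₄
    have k5 := norm_sub_le (x₁ + x₂) x₃
    have k6 := norm_add_le x₁ x₂
    linarith
  have hsq : ‖y‖ ^ 2 / 4 ≤ ‖g z‖ ^ 2 := by
    calc ‖y‖ ^ 2 / 4 = (‖y‖ / 2) ^ 2 := by ring
      _ ≤ _ := by gcongr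
  calc _ ≤ _ := hnum _ _ _ _ _ _ _
    _ ≤ (10 * C ^ 2 + 8 * C ^ 3) * ‖y‖ ^ 2 := by linarith
    _ ≤ (10 * C ^ 2 + 8 * C ^ 3) * (4 * ‖g z‖ ^ 2) := by gcongr; linarith
    _ = _ := by ring

end PoleComparison

/-! ### Smooth diagonalization near a diagonal matrix with distinct entries. -/

section Diagonalization

/-- Continuity of the derivatives at x₀ bounds them nearby by their values at x₀ plus 1. The bound
holds on all sufficiently small balls, so finitely many functions can share one radius. -/
theorem exists_bdd_iteratedFDeriv {E F : Type*} [NormedAddCommGroup E] [NormedSpace ℂ E]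
    [NormedAddCommGroup F] [NormedSpace ℂ F] {θ : E → F} {x₀ : E} {n : ℕ} (hn : n ≠ 0)
    (hθ : ContDiffAt ℂ n θ x₀) :
    ∃ K : ℝ, ∀ᶠ r in 𝓝[>] (0 : ℝ), ContDiffOn ℂ n θ (Metric.ball x₀ r) ∧
      (∀ k ≤ n, ∀ x ∈ Metric.ball x₀ r, ‖iteratedFDeriv ℂ k θ x‖ ≤ K) ∧
      ∀ x ∈ Metric.ball x₀ r, ‖θ x - θ x₀‖ ≤ K * ‖x - x₀‖ := by
  have h1 : ∀ᶠ x in 𝓝 x₀, ContDiffAt ℂ n θ x := hθ.eventually (by simp)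
  let K : ℝ := ∑ k ∈ Finset.range (n + 1), (‖iteratedFDeriv ℂ k θ x₀‖ + 1)
  have hK : ∀ k ≤ n, ‖iteratedFDeriv ℂ k θ x₀‖ + 1 ≤ K := fun k hk =>
    Finset.single_le_sum (f := fun k => ‖iteratedFDeriv ℂ k θ x₀‖ + 1) (fun _ _ => by positivity)
      (Finset.mem_range.mpr (Nat.lt_succ_of_le hk))
  have h2 : ∀ᶠ x in 𝓝 x₀, ∀ k ∈ Finset.range (n + 1), ‖iteratedFDeriv ℂ k θ x‖ < K := by
    rw [Filter.eventually_all_finset]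
    intro k hk
    have hk' : k ≤ n := Nat.lt_succ_iff.mp (Finset.mem_range.mp hk)
    exact (hθ.continuousAt_iteratedFDeriv (by exact_mod_cast hk')).norm.eventually_lt_const
      (by linarith [hK k hk'])
  obtain ⟨R, hR, hball⟩ := Metric.eventually_nhds_iff_ball.mp (h1.and h2)
  refine ⟨K, ?_⟩
  filter_upwards [Ioo_mem_nhdsGT hR] with r hr
  have hsub : Metric.ball x₀ r ⊆ Metric.ball x₀ R := Metric.ball_subset_ball hr.2.le
  refine ⟨fun x hx => (hball x (hsub hx)).1.contDiffWithinAt, fun k hk x hx =>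
    ((hball x (hsub hx)).2 k (Finset.mem_range.mpr (Nat.lt_succ_of_le hk))).le, fun x hx => ?_⟩
  refine (convex_ball x₀ r).norm_image_sub_le_of_norm_fderiv_le (𝕜 := ℂ)
    (fun y hy => ((hball y (hsub hy)).1.differentiableAt (by exact_mod_cast hn))) (fun y hy => ?_)
    (Metric.mem_ball_self hr.1) hx
  rw [← norm_iteratedFDeriv_one]
  exact ((hball y (hsub hy)).2 1 (Finset.mem_range.mpr (by omega))).le

open scoped Matrix.Norms.Operator

variable {m : ℕ}

/-- The diagonal part of a matrix, as a continuous linear map. -/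
noncomputable def diagPart (m : ℕ) : Matrix (Fin m) (Fin m) ℂ →L[ℂ] Matrix (Fin m) (Fin m) ℂ :=
  (Matrix.diagonalLinearMap (Fin m) ℂ ℂ ∘ₗ Matrix.diagLinearMap (Fin m) ℂ ℂ).toContinuousLinearMap

theorem diagPart_apply (Y : Matrix (Fin m) (Fin m) ℂ) :
    diagPart m Y = Matrix.diagonal fun i => Y i i := rfl

/-- A matrix with distinct eigenvalues can be diagonalized smoothly in a neighbourhood. -/
theorem exists_contDiffAt_diagonalization (lam : Fin m → ℂ) (hlam : Function.Injective lam) :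
    ∃ Y : Matrix (Fin m) (Fin m) ℂ → Matrix (Fin m) (Fin m) ℂ,
      ContDiffAt ℂ 3 Y (Matrix.diagonal lam) ∧ Y (Matrix.diagonal lam) = Matrix.diagonal lam ∧
      ∀ᶠ M in 𝓝 (Matrix.diagonal lam),
        IsUnit (1 + (Y M - diagPart m (Y M))) ∧
        (1 + (Y M - diagPart m (Y M))) * diagPart m (Y M) *
          Ring.inverse (1 + (Y M - diagPart m (Y M))) = M := by
  have : CompleteSpace (Matrix (Fin m) (Fin m) ℂ) := FiniteDimensional.complete ℂ _
  set D₀ : Matrix (Fin m) (Fin m) ℂ := Matrix.diagonal lam with hD₀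
  have hdD : diagPart m D₀ = D₀ := by rw [diagPart_apply]; simp [hD₀]
  let off : Matrix (Fin m) (Fin m) ℂ →L[ℂ] Matrix (Fin m) (Fin m) ℂ :=
    ContinuousLinearMap.id ℂ _ - diagPart m
  have hoff : ∀ Y, off Y = Y - diagPart m Y := fun Y => rfl
  have hoD : off D₀ = 0 := by rw [hoff, hdD, sub_self]
  -- One matrix Y encodes the eigenvalues in its diagonal and the eigenvectors in its off-diagonal
  -- part, normalized so that the eigenvector matrix has diagonal 1. Diagonalizing M means solving
  -- Φ(Y) = M, and the inverse function theorem applies at D₀.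
  let Φ : Matrix (Fin m) (Fin m) ℂ → Matrix (Fin m) (Fin m) ℂ := fun Y =>
    (1 + off Y) * diagPart m Y * Ring.inverse (1 + off Y)
  have hΦD : Φ D₀ = D₀ := by simp [Φ, hoD, hdD]
  have hsmooth : ContDiffAt ℂ 3 Φ D₀ := by
    have h1 : ContDiffAt ℂ 3 (fun Y => 1 + off Y) D₀ := contDiffAt_const.add off.contDiff.contDiffAt
    have h2 : ContDiffAt ℂ 3 (fun Y => Ring.inverse (1 + off Y)) D₀ := by
      refine ContDiffAt.comp (g := Ring.inverse) D₀ ?_ h1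
      rw [hoD, add_zero]
      exact contDiffAt_ringInverse ℂ 1
    exact (h1.mul (diagPart m).contDiff.contDiffAt).mul h2
  let Φ' : Matrix (Fin m) (Fin m) ℂ →L[ℂ] Matrix (Fin m) (Fin m) ℂ := fderiv ℂ Φ D₀
  have hΦ' : HasFDerivAt Φ Φ' D₀ := (hsmooth.differentiableAt (by simp)).hasFDerivAt
  have hunit : ∀ᶠ Y in 𝓝 D₀, IsUnit (1 + off Y) := by
    have : ContinuousAt (fun Y => 1 + off Y) D₀ := by fun_prop
    refine this.eventually (Units.isOpen.mem_nhds ?_)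
    change IsUnit (1 + off D₀)
    rw [hoD, add_zero]; exact isUnit_one
  -- Differentiating the identity Φ(Y)(1 + off Y) = (1 + off Y) diag(Y) avoids the derivative of the
  -- inverse. The result is Φ'X = [off X, D₀] + diag X, which multiplies the entry (i, j) off the
  -- diagonal by λ_j - λ_i ≠ 0.
  have hder : ∀ X, Φ' X + D₀ * off X = off X * D₀ + diagPart m X := by
    have h1 : HasFDerivAt (fun Y => 1 + off Y) off D₀ := off.hasFDerivAt.const_add 1
    have h2 := hΦ'.mul' h1
    have h3 := h1.mul' (diagPart m).hasFDerivAt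
    have h4 : (fun Y => Φ Y * (1 + off Y)) =ᶠ[𝓝 D₀] fun Y => (1 + off Y) * diagPart m Y := by
      filter_upwards [hunit] with Y hY
      simp only [Φ]
      rw [mul_assoc, Ring.inverse_mul_cancel _ hY, mul_one]
    have h5 := h2.unique (h3.congr_of_eventuallyEq h4)
    intro X
    have h6 := congrArg (fun T : Matrix (Fin m) (Fin m) ℂ →L[ℂ] Matrix (Fin m) (Fin m) ℂ => T X) h5
    change Φ D₀ * off X + Φ' X * (1 + off D₀) =
      (1 + off D₀) * diagPart m X + off X * diagPart m D₀ at h6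
    rw [hΦD, hoD, hdD, add_zero, one_mul, mul_one] at h6
    rw [add_comm, h6, add_comm]
  have hinj : Function.Injective Φ' := by
    rw [injective_iff_map_eq_zero]
    intro X hX
    have h := hder X
    rw [hX, zero_add, hoff, diagPart_apply] at h
    ext i j
    have hij := congrFun (congrFun h i) j
    rw [hD₀] at hij
    simp only [Matrix.diagonal_mul, Matrix.add_apply, Matrix.mul_diagonal, Matrix.sub_apply] at hij
    rcases eq_or_ne i j with rfl | hne
    · simpa using hij.symm
    · rw [Matrix.diagonal_apply_ne _ hne, sub_zero, add_zero] at hij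
      have h2 : (lam i - lam j) * X i j = 0 := by linear_combination hij
      exact (mul_eq_zero.mp h2).resolve_left (sub_ne_zero.mpr (hlam.ne hne))
  let e : Matrix (Fin m) (Fin m) ℂ ≃L[ℂ] Matrix (Fin m) (Fin m) ℂ :=
    (LinearEquiv.ofInjectiveEndo (Φ' : Matrix (Fin m) (Fin m) ℂ →ₗ[ℂ] _) hinj).toContinuousLinearEquiv
  have he : HasFDerivAt Φ (e : Matrix (Fin m) (Fin m) ℂ →L[ℂ] _) D₀ := by
    have : (e : Matrix (Fin m) (Fin m) ℂ →L[ℂ] _) = Φ' := by ext1 X; rfl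
    rw [this]; exact hΦ'
  have h3 : (3 : WithTop ℕ∞) ≠ 0 := by simp
  refine ⟨hsmooth.localInverse he h3, ?_, ?_, ?_⟩
  · have := hsmooth.to_localInverse he h3
    rwa [hΦD] at this
  · have := hsmooth.localInverse_apply_image he h3
    rwa [hΦD] at this
  · have hright := (hsmooth.hasStrictFDerivAt' he h3).eventually_right_inverse
    have hc : ContinuousAt (hsmooth.localInverse he h3) D₀ := by
      have := (hsmooth.to_localInverse he h3).continuousAt
      rwa [hΦD] at this
    have hval : hsmooth.localInverse he h3 D₀ = D₀ := by
      have := hsmooth.localInverse_apply_image he h3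
      rwa [hΦD] at this
    rw [hΦD] at hright
    rw [ContinuousAt, hval] at hc
    filter_upwards [hright, hc.eventually hunit] with M h1 h2
    exact ⟨h2, h1⟩

/-- The half disc of radius `δ` around `e` in the open lower half plane. -/
def lowerHalfDisc (e : ℂ) (δ : ℝ) : Set ℂ := {z | z.im < 0 ∧ ‖z - e‖ < δ}

theorem isOpen_lowerHalfDisc (e : ℂ) (δ : ℝ) : IsOpen (lowerHalfDisc e δ) :=
  (isOpen_lt Complex.continuous_im continuous_const).inter
    (isOpen_lt (continuous_id.sub continuous_const).norm continuous_const)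

theorem convex_lowerHalfDisc (e : ℂ) (δ : ℝ) : Convex ℝ (lowerHalfDisc e δ) := by
  have h : lowerHalfDisc e δ = {z | z.im < 0} ∩ Metric.ball e δ := by
    ext z; simp [lowerHalfDisc, dist_eq_norm]
  rw [h]
  exact (convex_halfSpace_im_lt 0).inter (convex_ball e δ)

theorem lowerHalfDisc_mono (e : ℂ) {δ δ' : ℝ} (h : δ ≤ δ') :
    lowerHalfDisc e δ ⊆ lowerHalfDisc e δ' := fun _ hz => ⟨hz.1, hz.2.trans_le h⟩

/-- Resolvent limits are taken along p - iε with ε → 0+, Taylor expansions inside the half disc.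
This inclusion of filters translates between the two, and shows that p lies in the closure. -/
theorem tendsto_vertical (e : ℂ) {δ p : ℝ} (hp : ‖(p : ℂ) - e‖ < δ) :
    Tendsto (fun ε : ℝ => (p - Complex.I * ε : ℂ)) (𝓝[>] 0) (𝓝[lowerHalfDisc e δ] p) := by
  have hc : Continuous fun ε : ℝ => (p - Complex.I * ε : ℂ) := by fun_prop
  have h0 : Tendsto (fun ε : ℝ => (p - Complex.I * ε : ℂ)) (𝓝[>] 0) (𝓝 p) := by
    simpa using (hc.tendsto 0).mono_left nhdsWithin_le_nhds
  refine tendsto_nhdsWithin_iff.mpr ⟨h0, ?_⟩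
  have h1 := (h0.sub_const e).norm.eventually_lt_const hp
  filter_upwards [h1, self_mem_nhdsWithin] with ε hε hε'
  refine ⟨?_, hε⟩
  have : 0 < ε := hε'
  simpa using this

theorem mem_closure_lowerHalfDisc (e : ℂ) {δ p : ℝ} (hp : ‖(p : ℂ) - e‖ < δ) :
    (p : ℂ) ∈ closure (lowerHalfDisc e δ) :=
  mem_closure_iff_nhdsWithin_neBot.mpr ((tendsto_vertical e hp).neBot)

/-- Smooth diagonalization of a family of matrices close to a diagonal matrix with distinct
entries. -/
theorem exists_diagonalization {lam : Fin m → ℂ} (hlam : Function.Injective lam) {Δ₀ α e : ℝ}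
    (hΔ₀ : 0 < Δ₀) (hα : 0 < α) (N : ℝ → ℂ → Matrix (Fin m) (Fin m) ℂ)
    (hN : ∀ i j, UnifBddDeriv 3 {Δ : ℝ | |Δ| ≤ Δ₀} (lowerHalfDisc e α) fun Δ z => N Δ z i j)
    (hreg : ∃ C, ∀ Δ, |Δ| ≤ Δ₀ → ∀ z ∈ lowerHalfDisc e α, ∀ i j,
      ‖N Δ z i j - N 0 z i j‖ ≤ C * |Δ|)
    (hlim : ∀ i j, Tendsto (fun ε : ℝ => N 0 (e - Complex.I * ε) i j) (𝓝[>] 0)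
      (𝓝 (Matrix.diagonal lam i j))) :
    ∃ δ > 0, δ ≤ α ∧ ∃ c > 0, c ≤ Δ₀ ∧ ∃ (a : ℝ → ℂ → Fin m → ℂ)
      (S S' : ℝ → ℂ → Matrix (Fin m) (Fin m) ℂ),
      (∀ j, UnifBddDeriv 3 {Δ : ℝ | |Δ| < c} (lowerHalfDisc e δ) fun Δ z => a Δ z j) ∧
      (∀ i j, UnifBddDeriv 3 {Δ : ℝ | |Δ| < c} (lowerHalfDisc e δ) fun Δ z => S Δ z i j) ∧
      (∀ i j, UnifBddDeriv 3 {Δ : ℝ | |Δ| < c} (lowerHalfDisc e δ) fun Δ z => S' Δ z i j) ∧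
      ∃ K, ∀ Δ, |Δ| < c → ∀ z ∈ lowerHalfDisc e δ,
        N Δ z * S Δ z = S Δ z * Matrix.diagonal (a Δ z) ∧ S Δ z * S' Δ z = 1 ∧ S' Δ z * S Δ z = 1 ∧
        (∀ j, ‖a Δ z j - lam j‖ ≤ K * (|Δ| + ‖z - e‖)) ∧
        (∀ i j, ‖S Δ z i j - (1 : Matrix (Fin m) (Fin m) ℂ) i j‖ ≤ K * (|Δ| + ‖z - e‖)) ∧
        ∀ i j, ‖S' Δ z i j - (1 : Matrix (Fin m) (Fin m) ℂ) i j‖ ≤ K * (|Δ| + ‖z - e‖) := by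
  have : CompleteSpace (Matrix (Fin m) (Fin m) ℂ) := FiniteDimensional.complete ℂ _
  obtain ⟨Y, hY, hYD, hYev⟩ := exists_contDiffAt_diagonalization lam hlam
  set D₀ : Matrix (Fin m) (Fin m) ℂ := Matrix.diagonal lam with hD₀
  let off : Matrix (Fin m) (Fin m) ℂ →L[ℂ] Matrix (Fin m) (Fin m) ℂ :=
    ContinuousLinearMap.id ℂ _ - diagPart m
  have hoff : ∀ Y, off Y = Y - diagPart m Y := fun Y => rfl
  have hdD : diagPart m D₀ = D₀ := by rw [diagPart_apply]; simp [hD₀]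
  have hoD : off D₀ = 0 := by rw [hoff, hdD, sub_self]
  let A : Matrix (Fin m) (Fin m) ℂ → Fin m → ℂ := fun M j => Y M j j
  let Sf : Matrix (Fin m) (Fin m) ℂ → Matrix (Fin m) (Fin m) ℂ := fun M => 1 + off (Y M)
  let Sf' : Matrix (Fin m) (Fin m) ℂ → Matrix (Fin m) (Fin m) ℂ := fun M =>
    Ring.inverse (1 + off (Y M))
  let entry : Fin m → Fin m → Matrix (Fin m) (Fin m) ℂ →L[ℂ] ℂ := fun i j =>
    (Matrix.entryLinearMap ℂ ℂ i j).toContinuousLinearMap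
  have hSs : ContDiffAt ℂ 3 Sf D₀ := contDiffAt_const.add (off.contDiff.contDiffAt.comp D₀ hY)
  have hSs' : ContDiffAt ℂ 3 Sf' D₀ := by
    refine ContDiffAt.comp (g := Ring.inverse) D₀ ?_ hSs
    rw [hYD, hoD, add_zero]; exact contDiffAt_ringInverse ℂ 1
  have hAs : ∀ j, ContDiffAt ℂ 3 (fun M => A M j) D₀ := fun j =>
    (entry j j).contDiff.contDiffAt.comp D₀ hY
  have hSij : ∀ i j, ContDiffAt ℂ 3 (fun M => Sf M i j) D₀ := fun i j =>
    (entry i j).contDiff.contDiffAt.comp D₀ hSs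
  have hSij' : ∀ i j, ContDiffAt ℂ 3 (fun M => Sf' M i j) D₀ := fun i j =>
    (entry i j).contDiff.contDiffAt.comp D₀ hSs'
  choose K1 hK1 using fun j => exists_bdd_iteratedFDeriv (n := 3) (by norm_num) (hAs j)
  choose K2 hK2 using fun i j => exists_bdd_iteratedFDeriv (n := 3) (by norm_num) (hSij i j)
  choose K3 hK3 using fun i j => exists_bdd_iteratedFDeriv (n := 3) (by norm_num) (hSij' i j)
  obtain ⟨R, hR, hball⟩ := Metric.eventually_nhds_iff_ball.mp hYev
  -- A common radius on which all entries of the eigenvalue and eigenvector maps have bounded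
  -- derivatives and the diagonalization identity holds.
  obtain ⟨r, ⟨⟨hr1, hr2⟩, hr3⟩, hr0, hrR⟩ := (((eventually_all.mpr hK1).and (eventually_all.mpr
    fun i => eventually_all.mpr (hK2 i))).and (eventually_all.mpr
    fun i => eventually_all.mpr (hK3 i)) |>.and (Ioo_mem_nhdsGT hR)).exists
  -- the distance of `N Δ z` from the limit
  obtain ⟨C₁, hC₁⟩ := hreg
  have hclos := mem_closure_lowerHalfDisc (e : ℂ) (δ := α) (p := e) (by simpa using hα)
  -- The bounded derivative supplies a boundary value at e, approached linearly. The limit along the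
  -- vertical line identifies it with the entry of D₀.
  have hN0 : ∀ i j, ∃ C : ℝ, 0 ≤ C ∧ ∀ z ∈ lowerHalfDisc e α, ‖N 0 z i j - D₀ i j‖ ≤ C * ‖z - e‖ := by
    intro i j
    obtain ⟨C, hC⟩ := hN i j
    have hC0 := hC 0 (by simpa using hΔ₀.le)
    obtain ⟨v, -, hv⟩ := boundary_taylor_one (C := |C|) (isOpen_lowerHalfDisc _ _)
      (convex_lowerHalfDisc _ _) hclos hC0.1
      (fun k hk z hz => (hC0.2 k (by omega) z hz).trans (le_abs_self _)) (abs_nonneg _)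
    have h1 := (tendsto_of_norm_sub_le 0 (by simpa using hv)).comp
      (tendsto_vertical (e : ℂ) (δ := α) (p := e) (by simpa using hα))
    have h2 := tendsto_nhds_unique h1 (hlim i j)
    exact ⟨|C|, abs_nonneg _, by rw [← h2]; exact hv⟩
  choose C₂ hC₂0 hC₂ using hN0
  let C₃ : ℝ := |C₁| + ∑ i, ∑ j, C₂ i j
  have hC₃ : ∀ i j, C₂ i j ≤ ∑ i, ∑ j, C₂ i j := fun i j =>
    (Finset.single_le_sum (f := fun j => C₂ i j) (fun j _ => hC₂0 i j) (Finset.mem_univ j)).trans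
      (Finset.single_le_sum (f := fun i => ∑ j, C₂ i j)
        (fun i _ => Finset.sum_nonneg fun j _ => hC₂0 i j) (Finset.mem_univ i))
  have hC₃0 : 0 ≤ ∑ i, ∑ j, C₂ i j :=
    Finset.sum_nonneg fun i _ => Finset.sum_nonneg fun j _ => hC₂0 i j
  have hent : ∀ Δ, |Δ| ≤ Δ₀ → ∀ z ∈ lowerHalfDisc e α, ∀ i j,
      ‖(N Δ z - D₀) i j‖ ≤ C₃ * (|Δ| + ‖z - e‖) := by
    intro Δ hΔ z hz i j
    have h1 := hC₁ Δ hΔ z hz i j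
    have h2 := hC₂ i j z hz
    have h3 : (N Δ z - D₀) i j = (N Δ z i j - N 0 z i j) + (N 0 z i j - D₀ i j) := by
      rw [Matrix.sub_apply]; ring
    rw [h3]
    calc _ ≤ C₁ * |Δ| + C₂ i j * ‖z - e‖ := (norm_add_le _ _).trans (add_le_add h1 h2)
      _ ≤ |C₁| * |Δ| + (∑ i, ∑ j, C₂ i j) * ‖z - e‖ := by
        gcongr
        · exact le_abs_self _
        · exact hC₃ i j
      _ ≤ _ := by
        simp only [C₃]
        nlinarith [mul_nonneg (abs_nonneg C₁) (norm_nonneg (z - e)), mul_nonneg hC₃0 (abs_nonneg Δ)]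
  let B : ℝ := ∑ i, ∑ j, ‖(Matrix.single i j (1 : ℂ) : Matrix (Fin m) (Fin m) ℂ)‖
  have hB0 : 0 ≤ B := Finset.sum_nonneg fun i _ => Finset.sum_nonneg fun j _ => norm_nonneg _
  have hC₃0' : 0 ≤ C₃ := add_nonneg (abs_nonneg _) hC₃0
  have hdist : ∀ Δ, |Δ| ≤ Δ₀ → ∀ z ∈ lowerHalfDisc e α,
      ‖N Δ z - D₀‖ ≤ C₃ * B * (|Δ| + ‖z - e‖) := by
    intro Δ hΔ z hz
    rw [Matrix.matrix_eq_sum_single (N Δ z - D₀)]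
    have : ∀ i j, Matrix.single i j ((N Δ z - D₀) i j) =
        (N Δ z - D₀) i j • (Matrix.single i j (1 : ℂ) : Matrix (Fin m) (Fin m) ℂ) := fun i j => by
      rw [Matrix.smul_single, smul_eq_mul, mul_one]
    simp only [this]
    calc _ ≤ ∑ i, ∑ j, C₃ * (|Δ| + ‖z - e‖) *
          ‖(Matrix.single i j (1 : ℂ) : Matrix (Fin m) (Fin m) ℂ)‖ := by
          refine (norm_sum_le _ _).trans (Finset.sum_le_sum fun i _ => ?_)
          refine (norm_sum_le _ _).trans (Finset.sum_le_sum fun j _ => ?_)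
          rw [norm_smul]
          gcongr
          exact hent Δ hΔ z hz i j
      _ = _ := by simp only [← Finset.mul_sum, B]; ring
  -- With |Δ| < κ and |z - e| < κ, the estimate ‖N - D₀‖ ≤ C₃B(|Δ| + |z - e|) keeps N inside the
  -- ball of radius r. The added 1 covers C₃B = 0.
  let κ : ℝ := r / (2 * (C₃ * B + 1))
  have hκ : 0 < κ := by positivity
  have hmem : ∀ Δ, |Δ| < min κ Δ₀ → ∀ z ∈ lowerHalfDisc (e : ℂ) (min κ α),
      N Δ z ∈ Metric.ball D₀ r := by
    intro Δ hΔ z hz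
    rw [mem_ball_iff_norm]
    refine (hdist Δ (hΔ.trans_le (min_le_right _ _)).le z
      (lowerHalfDisc_mono _ (min_le_right _ _) hz)).trans_lt ?_
    have h1 : |Δ| + ‖z - e‖ < 2 * κ := by
      have := hΔ.trans_le (min_le_left _ _)
      have := hz.2.trans_le (min_le_left _ _)
      linarith
    have h2 : 2 * κ * (C₃ * B + 1) = r := by simp only [κ]; field_simp
    have : 0 ≤ C₃ * B := by positivity
    have : 0 ≤ |Δ| + ‖z - e‖ := by positivity
    nlinarith
  have hNfam : UnifBddDeriv 3 {Δ : ℝ | |Δ| < min κ Δ₀} (lowerHalfDisc (e : ℂ) (min κ α)) N := by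
    have h1 : UnifBddDeriv 3 {Δ : ℝ | |Δ| < min κ Δ₀} (lowerHalfDisc (e : ℂ) (min κ α))
        fun Δ z => ∑ i, ∑ j, N Δ z i j • (Matrix.single i j (1 : ℂ) : Matrix (Fin m) (Fin m) ℂ) := by
      refine UnifBddDeriv.sum (isOpen_lowerHalfDisc _ _) _ fun i _ =>
        UnifBddDeriv.sum (isOpen_lowerHalfDisc _ _) _ fun j _ =>
        UnifBddDeriv.smul (isOpen_lowerHalfDisc _ _) ((hN i j).mono le_rfl ?_
          (lowerHalfDisc_mono _ (min_le_right _ _)))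
        (unifBddDeriv_const (c := fun _ => Matrix.single i j (1 : ℂ)) (fun _ _ => le_rfl))
      exact fun Δ hΔ => (lt_of_lt_of_le (show |Δ| < _ from hΔ) (min_le_right _ _)).le
    refine h1.congr (isOpen_lowerHalfDisc _ _) fun Δ _ z _ => ?_
    conv_lhs => rw [Matrix.matrix_eq_sum_single (N Δ z)]
    simp only [Matrix.smul_single, smul_eq_mul, mul_one]
  have hop := isOpen_lowerHalfDisc (e : ℂ) (min κ α)
  refine ⟨min κ α, lt_min hκ hα, min_le_right _ _, min κ Δ₀, lt_min hκ hΔ₀, min_le_right _ _,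
    fun Δ z => A (N Δ z), fun Δ z => Sf (N Δ z), fun Δ z => Sf' (N Δ z), fun j => ?_,
    fun i j => ?_, fun i j => ?_,
    ((∑ j, |K1 j|) + (∑ i, ∑ j, |K2 i j|) + ∑ i, ∑ j, |K3 i j|) * (C₃ * B), fun Δ hΔ z hz => ?_⟩
  · exact hNfam.comp hop Metric.isOpen_ball (hr1 j).1 (hr1 j).2.1 (by norm_num) hmem
  · exact hNfam.comp hop Metric.isOpen_ball (hr2 i j).1 (hr2 i j).2.1 (by norm_num) hmem
  · exact hNfam.comp hop Metric.isOpen_ball (hr3 i j).1 (hr3 i j).2.1 (by norm_num) hmem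
  · have hM := hmem Δ hΔ z hz
    obtain ⟨hu, hd⟩ := hball _ (Metric.ball_subset_ball hrR.le hM)
    have hu' : IsUnit (Sf (N Δ z)) := hu
    have hd' : Sf (N Δ z) * diagPart m (Y (N Δ z)) * Sf' (N Δ z) = N Δ z := hd
    have hSS' : Sf (N Δ z) * Sf' (N Δ z) = 1 := Ring.mul_inverse_cancel _ hu'
    have hS'S : Sf' (N Δ z) * Sf (N Δ z) = 1 := Ring.inverse_mul_cancel _ hu'
    have hdz := hdist Δ (hΔ.trans_le (min_le_right _ _)).le z
      (lowerHalfDisc_mono _ (min_le_right _ _) hz)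
    have hK1s : ∀ j, |K1 j| ≤ ∑ j, |K1 j| := fun j =>
      Finset.single_le_sum (f := fun j => |K1 j|) (fun j _ => abs_nonneg _) (Finset.mem_univ j)
    have hdbl : ∀ (L : Fin m → Fin m → ℝ) i j, |L i j| ≤ ∑ i, ∑ j, |L i j| := fun L i j =>
      (Finset.single_le_sum (f := fun j => |L i j|) (fun j _ => abs_nonneg _)
        (Finset.mem_univ j)).trans (Finset.single_le_sum (f := fun i => ∑ j, |L i j|)
        (fun i _ => Finset.sum_nonneg fun j _ => abs_nonneg _) (Finset.mem_univ i))
    have n1 : 0 ≤ ∑ j, |K1 j| := Finset.sum_nonneg fun j _ => abs_nonneg _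
    have n2 : 0 ≤ ∑ i, ∑ j, |K2 i j| :=
      Finset.sum_nonneg fun i _ => Finset.sum_nonneg fun j _ => abs_nonneg _
    have n3 : 0 ≤ ∑ i, ∑ j, |K3 i j| :=
      Finset.sum_nonneg fun i _ => Finset.sum_nonneg fun j _ => abs_nonneg _
    have hfin : ∀ (x k : ℝ), |k| ≤ (∑ j, |K1 j|) + (∑ i, ∑ j, |K2 i j|) + ∑ i, ∑ j, |K3 i j| →
        x ≤ k * ‖N Δ z - D₀‖ → x ≤ ((∑ j, |K1 j|) + (∑ i, ∑ j, |K2 i j|) + ∑ i, ∑ j, |K3 i j|) *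
          (C₃ * B) * (|Δ| + ‖z - e‖) := by
      intro x k hk hx
      refine hx.trans ?_
      rw [mul_assoc]
      exact mul_le_mul ((le_abs_self _).trans hk) hdz (norm_nonneg _) (by positivity)
    refine ⟨?_, hSS', hS'S, fun j => ?_, fun i j => ?_, fun i j => ?_⟩
    · conv_lhs => rw [← hd']
      rw [mul_assoc, hS'S, mul_one]
      rfl
    · refine hfin _ (K1 j) (by linarith [hK1s j]) ?_
      have := (hr1 j).2.2 _ hM
      have h0 : A D₀ j = lam j := by
        change Y D₀ j j = lam j
        rw [hYD, hD₀, Matrix.diagonal_apply_eq]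
      rwa [h0] at this
    · refine hfin _ (K2 i j) (by linarith [hdbl K2 i j]) ?_
      have := (hr2 i j).2.2 _ hM
      have h0 : Sf D₀ = 1 := by simp only [Sf, hYD, hoD, add_zero]
      rwa [h0] at this
    · refine hfin _ (K3 i j) (by linarith [hdbl K3 i j]) ?_
      have := (hr3 i j).2.2 _ hM
      have h0 : Sf' D₀ = 1 := by simp only [Sf', hYD, hoD, add_zero, Ring.inverse_one]
      rwa [h0] at this

end Diagonalization

/-! ### Compressed operators, reduced resolvents and spectral projections as limits. -/

section Compression

set_option linter.unusedSectionVars false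

variable {H : Type*} [NormedAddCommGroup H] [InnerProductSpace ℂ H] [CompleteSpace H]
  {A : H →ₗ.[ℂ] H} {V : Submodule ℂ H}

theorem sub_starProjection_mem_domain [V.HasOrthogonalProjection] (hV : V ≤ A.domain) {x : H}
    (hx : x ∈ A.domain) : x - V.starProjection x ∈ A.domain :=
  A.domain.sub_mem hx (hV (V.starProjection_apply_mem x))

theorem inner_compression_right (x : Vᗮ) (y : (compression A V).domain) :
    inner ℂ x (compression A V y) = inner ℂ (x : H) (A ⟨(y : Vᗮ), y.2⟩) := by
  change inner ℂ x (Vᗮ.orthogonalProjectionOnto (A ⟨(y : Vᗮ), y.2⟩)) = _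
  rw [Submodule.inner_orthogonalProjectionOnto_eq_of_mem_left]

theorem dense_domain_compression [FiniteDimensional ℂ V] (hA : IsSelfAdjoint A)
    (hV : V ≤ A.domain) : Dense ((compression A V).domain : Set Vᗮ) := by
  intro y
  rw [Metric.mem_closure_iff]
  intro ε hε
  obtain ⟨x, hx, hxy⟩ := Metric.dense_iff.mp hA.dense_domain (y : H) ε hε
  refine ⟨Vᗮ.orthogonalProjectionOnto x, ?_, ?_⟩
  · change ((Vᗮ.orthogonalProjectionOnto x : Vᗮ) : H) ∈ A.domain
    rw [Submodule.coe_orthogonalProjectionOnto_apply, Submodule.starProjection_orthogonal_val]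
    exact sub_starProjection_mem_domain hV hxy
  · have h1 : y = Vᗮ.orthogonalProjectionOnto (y : H) :=
      (Submodule.orthogonalProjectionOnto_mem_subspace_eq_self y).symm
    rw [dist_eq_norm]
    conv_lhs => rw [h1]
    rw [← map_sub]
    refine (Submodule.norm_orthogonalProjectionOnto_apply_le _ _).trans_lt ?_
    rwa [Metric.mem_ball, dist_comm, dist_eq_norm] at hx

/-- The compression of a self-adjoint operator to the complement of a finite dimensional subspace of
its domain is self-adjoint. -/
theorem isSelfAdjoint_compression [FiniteDimensional ℂ V] (hA : IsSelfAdjoint A)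
    (hV : V ≤ A.domain) : IsSelfAdjoint (compression A V) := by
  have hd := dense_domain_compression hA hV
  have hsymm : (compression A V).IsFormalAdjoint (compression A V) := by
    intro x y
    rw [← inner_conj_symm, inner_compression_right, inner_compression_right, inner_conj_symm]
    exact inner_symm hA ⟨(x : Vᗮ), x.2⟩ ⟨(y : Vᗮ), y.2⟩
  rw [LinearPMap.isSelfAdjoint_def]
  have hle := hsymm.le_adjoint hd
  refine (LinearPMap.eq_of_le_of_domain_eq hle (le_antisymm hle.1 fun y hy => ?_)).symm
  set w := (compression A V).adjoint ⟨y, hy⟩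
  have hw : ∀ x : (compression A V).domain,
      inner ℂ w (x : Vᗮ) = inner ℂ (y : H) (A ⟨(x : Vᗮ), x.2⟩) := fun x => by
    rw [← inner_compression_right]
    exact LinearPMap.adjoint_isFormalAdjoint hd ⟨y, hy⟩ x
  -- The operator AP is bounded because V is finite dimensional and lies in the domain. If y is in
  -- the domain of the adjoint of the compression, with image w, splitting x into (1 - P)x and Px
  -- gives ⟨y, Ax⟩ = ⟨w + B*y, x⟩ for x in dom A. Hence y is in the domain of A* = A.
  let B : H →L[ℂ] H := (LinearMap.toContinuousLinearMap
    (A.toFun ∘ₗ Submodule.inclusion hV)) ∘L V.orthogonalProjectionOnto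
  have hB : ∀ x, B x = A ⟨V.starProjection x, hV (V.starProjection_apply_mem x)⟩ := fun x => rfl
  obtain ⟨hyA, -⟩ := mem_domain_of_inner hA (y : H) (w + ContinuousLinearMap.adjoint B y) fun x => by
    have h1 : (x : H) - V.starProjection x ∈ Vᗮ := V.sub_starProjection_mem_orthogonal _
    have h2 := hw ⟨⟨(x : H) - V.starProjection x, h1⟩, sub_starProjection_mem_domain hV x.2⟩
    have h3 : A ⟨(x : H) - V.starProjection x, sub_starProjection_mem_domain hV x.2⟩ =
        A x - A ⟨V.starProjection x, hV (V.starProjection_apply_mem x)⟩ := by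
      rw [← LinearPMap.map_sub]; rfl
    rw [Submodule.coe_inner] at h2
    simp only at h2
    rw [h3, inner_sub_right, inner_sub_right] at h2
    have h4 : inner ℂ (w : H) (V.starProjection (x : H)) = 0 :=
      Submodule.inner_left_of_mem_orthogonal (V.starProjection_apply_mem _) w.2
    rw [h4, sub_zero] at h2
    rw [inner_add_left, h2, ContinuousLinearMap.adjoint_inner_left, hB, sub_add_cancel]
  exact hyA

theorem reducedResolvent_apply_sub [FiniteDimensional ℂ V] (hA : IsSelfAdjoint A)
    (hV : V ≤ A.domain) {z : ℂ} (hz : z.im ≠ 0) {w : H} (hw : w ∈ A.domain) (hwV : w ∈ Vᗮ) :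
    reducedResolvent A V z (A ⟨w, hw⟩ - z • w) = w := by
  have hR := isResolvent_resolvent (isSelfAdjoint_compression hA hV) hz
  have h := hR.2 ⟨⟨w, hwV⟩, hw⟩
  have h1 : compression A V ⟨⟨w, hwV⟩, hw⟩ - z • (⟨w, hwV⟩ : Vᗮ) =
      Vᗮ.orthogonalProjectionOnto (A ⟨w, hw⟩ - z • w) := by
    rw [map_sub, map_smul]
    congr 2
    exact (Submodule.orthogonalProjectionOnto_mem_subspace_eq_self (⟨w, hwV⟩ : Vᗮ)).symm
  simp only at h
  rw [h1] at h
  exact congrArg Subtype.val h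

theorem reducedResolvent_apply_of_mem [V.HasOrthogonalProjection] {z : ℂ} {v : H} (hv : v ∈ V) :
    reducedResolvent A V z v = 0 := by
  have : Vᗮ.orthogonalProjectionOnto v = 0 := by
    rw [Submodule.orthogonalProjectionOnto_eq_zero_iff]
    exact Submodule.le_orthogonal_orthogonal V hv
  simp [reducedResolvent, this]

theorem IsResolvent.norm_apply_le {H : Type*} [NormedAddCommGroup H] [InnerProductSpace ℂ H]
    [CompleteSpace H] {A : H →ₗ.[ℂ] H} (hA : IsSelfAdjoint A) {z : ℂ} {R : H →L[ℂ] H}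
    (hR : IsResolvent A z R) (y : H) : |z.im| * ‖R y‖ ≤ ‖y‖ := by
  obtain ⟨h, e⟩ := hR.1 y
  have := im_mul_norm_le hA z ⟨R y, h⟩
  rwa [e] at this

theorem norm_reducedResolvent_apply_le [FiniteDimensional ℂ V] (hA : IsSelfAdjoint A)
    (hV : V ≤ A.domain) {z : ℂ} (hz : z.im ≠ 0) (y : H) :
    |z.im| * ‖reducedResolvent A V z y‖ ≤ ‖y‖ := by
  have hR := isResolvent_resolvent (isSelfAdjoint_compression hA hV) hz
  exact (hR.norm_apply_le (isSelfAdjoint_compression hA hV) _).trans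
    (Submodule.norm_orthogonalProjectionOnto_apply_le _ _)

theorem reducedResolvent_sub_apply [FiniteDimensional ℂ V] (hA : IsSelfAdjoint A)
    (hV : V ≤ A.domain) {z w : ℂ} (hz : z.im ≠ 0) (hw : w.im ≠ 0) (y : H) :
    reducedResolvent A V z y - reducedResolvent A V w y =
      (z - w) • reducedResolvent A V z (reducedResolvent A V w y) := by
  have hs := isSelfAdjoint_compression hA hV
  have h := (isResolvent_resolvent hs hz).sub_apply (isResolvent_resolvent hs hw)
    (Vᗮ.orthogonalProjectionOnto y)
  have h1 := congrArg (Subtype.val) h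
  have h2 : Vᗮ.orthogonalProjectionOnto (reducedResolvent A V w y) =
      resolvent (compression A V) w (Vᗮ.orthogonalProjectionOnto y) :=
    Submodule.orthogonalProjectionOnto_mem_subspace_eq_self
      (resolvent (compression A V) w (Vᗮ.orthogonalProjectionOnto y))
  change _ = (z - w) • ((resolvent (compression A V) z
    (Vᗮ.orthogonalProjectionOnto (reducedResolvent A V w y)) : Vᗮ) : H)
  rw [h2]
  exact h1

/-- By the resolvent identity the difference quotient at w equals ⟨φ, R_z R_w ψ⟩. A second use of
the identity, with the bound |Im z|⁻¹, gives its limit. Full and reduced resolvents are treated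
together. -/
theorem differentiableAt_of_resolvent_identity {R : ℂ → H →L[ℂ] H}
    (hid : ∀ z w : ℂ, z.im ≠ 0 → w.im ≠ 0 → ∀ x, R z x - R w x = (z - w) • R z (R w x))
    (hn : ∀ z : ℂ, z.im ≠ 0 → ∀ y, |z.im| * ‖R z y‖ ≤ ‖y‖) {w : ℂ} (hw : w.im < 0) (φ ψ : H) :
    DifferentiableAt ℂ (fun z => inner ℂ φ (R z ψ)) w := by
  suffices h : HasDerivAt (fun z => inner ℂ φ (R z ψ)) (inner ℂ φ (R w (R w ψ))) w from
    h.differentiableAt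
  rw [hasDerivAt_iff_tendsto_slope]
  have hnear : ∀ᶠ z : ℂ in 𝓝[≠] w, z.im < w.im / 2 :=
    nhdsWithin_le_nhds ((Complex.continuous_im.tendsto w).eventually_lt_const (by linarith))
  have h1 : (fun z => inner ℂ φ (R z (R w ψ))) =ᶠ[𝓝[≠] w] slope (fun z => inner ℂ φ (R z ψ)) w := by
    filter_upwards [hnear, self_mem_nhdsWithin] with z hz hzw
    have hzw' : z - w ≠ 0 := sub_ne_zero.mpr hzw
    rw [slope_def_field, ← inner_sub_right, hid z w (by linarith) hw.ne, inner_smul_right]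
    field_simp
  refine Tendsto.congr' h1 ?_
  have hb : ∀ z : ℂ, z.im < w.im / 2 → ∀ y, ‖R z y‖ ≤ 2 / |w.im| * ‖y‖ := fun z hz y => by
    have h2 := hn z (by linarith) y
    have h3 : |w.im| / 2 ≤ |z.im| := by
      rw [abs_of_neg hw, abs_of_neg (by linarith)]; linarith
    have hwp : 0 < |w.im| := abs_pos.mpr hw.ne
    rw [div_mul_eq_mul_div, le_div_iff₀ hwp]
    nlinarith [norm_nonneg (R z y)]
  rw [tendsto_iff_norm_sub_tendsto_zero]
  refine squeeze_zero' (Eventually.of_forall fun _ => norm_nonneg _)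
    (g := fun z => ‖z - w‖ * (‖φ‖ * (2 / |w.im| * ‖R w (R w ψ)‖))) ?_ ?_
  · filter_upwards [hnear] with z hz
    rw [← inner_sub_right, hid z w (by linarith) hw.ne, inner_smul_right, norm_mul]
    gcongr
    exact (norm_inner_le_norm _ _).trans (by gcongr; exact hb z hz _)
  · have : Tendsto (fun z : ℂ => ‖z - w‖) (𝓝[≠] w) (𝓝 0) := by
      simpa using ((continuous_id.sub continuous_const).norm.tendsto w (f := fun z : ℂ => ‖z - w‖)).mono_left nhdsWithin_le_nhds
    simpa using this.mul_const (‖φ‖ * (2 / |w.im| * ‖R w (R w ψ)‖))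

theorem differentiableAt_inner_resolvent (hA : IsSelfAdjoint A) {w : ℂ} (hw : w.im < 0) (φ ψ : H) :
    DifferentiableAt ℂ (fun z => inner ℂ φ (resolvent A z ψ)) w :=
  differentiableAt_of_resolvent_identity
    (fun _ _ hz hw x => (isResolvent_resolvent hA hz).sub_apply (isResolvent_resolvent hA hw) x)
    (fun _ hz y => (isResolvent_resolvent hA hz).norm_apply_le hA y) hw φ ψ

theorem differentiableAt_inner_reducedResolvent [FiniteDimensional ℂ V] (hA : IsSelfAdjoint A)
    (hV : V ≤ A.domain) {w : ℂ} (hw : w.im < 0) (φ ψ : H) :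
    DifferentiableAt ℂ (fun z => inner ℂ φ (reducedResolvent A V z ψ)) w :=
  differentiableAt_of_resolvent_identity
    (fun _ _ hz hw x => reducedResolvent_sub_apply hA hV hz hw x)
    (fun _ hz y => norm_reducedResolvent_apply_le hA hV hz y) hw φ ψ

/-- The Feshbach formula for the resolvent. -/
theorem resolvent_eq_reducedResolvent [FiniteDimensional ℂ V] (hA : IsSelfAdjoint A)
    (hV : V ≤ A.domain) {z : ℂ} (hz : z.im ≠ 0) {u : H} (hu : u ∈ A.domain) :
    u = V.starProjection u + reducedResolvent A V z (A ⟨u, hu⟩ - z • u) -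
      reducedResolvent A V z (A ⟨V.starProjection u, hV (V.starProjection_apply_mem u)⟩) := by
  have h1 := reducedResolvent_apply_sub hA hV hz (sub_starProjection_mem_domain hV hu)
    (V.sub_starProjection_mem_orthogonal u)
  have h2 : A ⟨u - V.starProjection u, sub_starProjection_mem_domain hV hu⟩ =
      A ⟨u, hu⟩ - A ⟨V.starProjection u, hV (V.starProjection_apply_mem u)⟩ := by
    rw [← LinearPMap.map_sub]; rfl
  have h3 : A ⟨u - V.starProjection u, sub_starProjection_mem_domain hV hu⟩ -
      z • (u - V.starProjection u) = (A ⟨u, hu⟩ - z • u) -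
      A ⟨V.starProjection u, hV (V.starProjection_apply_mem u)⟩ + z • V.starProjection u := by
    rw [h2, smul_sub]; abel
  rw [h3, map_add, map_sub, map_smul, reducedResolvent_apply_of_mem (V.starProjection_apply_mem u),
    smul_zero, add_zero] at h1
  rw [add_sub_assoc, h1]; abel

/-- On D the matrix elements are bounded, so the factor ε kills them. The uniform bound ε‖T_ε‖ ≤ 1
extends this to all vectors by density. For a resolvent, the conclusion says that there is no
eigenvalue at the point approached. -/
theorem tendsto_mul_inner_zero {T : ℝ → H →L[ℂ] H} (hT : ∀ ε > 0, ∀ y, ε * ‖T ε y‖ ≤ ‖y‖)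
    {D : Set H} (hD : Dense D)
    (hb : ∀ φ ∈ D, ∀ ψ ∈ D, ∃ C : ℝ, ∀ ε > 0, ‖inner ℂ φ (T ε ψ)‖ ≤ C) (φ ψ : H) :
    Tendsto (fun ε : ℝ => (ε : ℂ) * inner ℂ φ (T ε ψ)) (𝓝[>] 0) (𝓝 0) := by
  rw [tendsto_zero_iff_norm_tendsto_zero, Metric.tendsto_nhds]
  intro η hη
  have hφ1 : 0 < ‖ψ‖ + 1 := by positivity
  obtain ⟨φ', hφ', hφD⟩ := Metric.dense_iff.mp hD φ (η / 3 / (‖ψ‖ + 1)) (by positivity)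
  -- The approximation of ψ is chosen after φ', since its error is multiplied by ‖φ'‖.
  obtain ⟨ψ', hψ', hψD⟩ := Metric.dense_iff.mp hD ψ (η / 3 / (‖φ'‖ + 1)) (by positivity)
  obtain ⟨C, hC⟩ := hb φ' hφD ψ' hψD
  rw [mem_ball_iff_norm', lt_div_iff₀ (by positivity)] at hφ' hψ'
  have hsmall : ∀ᶠ ε : ℝ in 𝓝[>] 0, ε * (|C| + 1) < η / 3 := by
    have : Tendsto (fun ε : ℝ => ε * (|C| + 1)) (𝓝[>] 0) (𝓝 (0 * (|C| + 1))) :=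
      ((by fun_prop : Continuous fun ε : ℝ => ε * (|C| + 1)).tendsto 0).mono_left nhdsWithin_le_nhds
    rw [zero_mul] at this
    exact this.eventually_lt_const (by positivity)
  filter_upwards [hsmall, self_mem_nhdsWithin] with ε hε hε0
  have hε0' : 0 < ε := hε0
  rw [Real.dist_eq, sub_zero, abs_of_nonneg (norm_nonneg _), norm_mul, Complex.norm_real,
    Real.norm_of_nonneg hε0'.le]
  have e1 : inner ℂ φ (T ε ψ) = inner ℂ (φ - φ') (T ε ψ) + inner ℂ φ' (T ε (ψ - ψ')) +
      inner ℂ φ' (T ε ψ') := by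
    rw [map_sub, inner_sub_left, inner_sub_right]; ring
  have b1 : ε * ‖inner ℂ (φ - φ') (T ε ψ)‖ ≤ ‖φ - φ'‖ * ‖ψ‖ := by
    calc _ ≤ ε * (‖φ - φ'‖ * ‖T ε ψ‖) := by gcongr; exact norm_inner_le_norm _ _
      _ = ‖φ - φ'‖ * (ε * ‖T ε ψ‖) := by ring
      _ ≤ _ := by gcongr; exact hT ε hε0 ψ
  have b2 : ε * ‖inner ℂ φ' (T ε (ψ - ψ'))‖ ≤ ‖φ'‖ * ‖ψ - ψ'‖ := by
    calc _ ≤ ε * (‖φ'‖ * ‖T ε (ψ - ψ')‖) := by gcongr; exact norm_inner_le_norm _ _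
      _ = ‖φ'‖ * (ε * ‖T ε (ψ - ψ')‖) := by ring
      _ ≤ _ := by gcongr; exact hT ε hε0 _
  have b3 : ε * ‖inner ℂ φ' (T ε ψ')‖ ≤ ε * (|C| + 1) := by
    gcongr
    exact (hC ε hε0).trans ((le_abs_self C).trans (by linarith))
  have tri : ‖inner ℂ φ (T ε ψ)‖ ≤ ‖inner ℂ (φ - φ') (T ε ψ)‖ + ‖inner ℂ φ' (T ε (ψ - ψ'))‖ +
      ‖inner ℂ φ' (T ε ψ')‖ := by
    rw [e1]; exact norm_add₃_le
  nlinarith [norm_nonneg (φ - φ'), norm_nonneg (ψ - ψ')]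

/-- The spectral projection of a self-adjoint operator at a real point is the limit of the
rescaled resolvents. -/
theorem tendsto_resolvent_orthProj (hA : IsSelfAdjoint A) (E : ℝ) (φ ψ : H) :
    Tendsto (fun ε : ℝ => (Complex.I * ε) * inner ℂ φ (resolvent A (E - Complex.I * ε) ψ)) (𝓝[>] 0)
      (𝓝 (inner ℂ φ (orthProj (eigenspace A E) ψ))) := by
  let R : ℝ → H →L[ℂ] H := fun ε => resolvent A (E - Complex.I * ε)
  have him : ∀ ε : ℝ, ((E : ℂ) - Complex.I * ε).im = -ε := fun ε => by simp
  have hR : ∀ ε : ℝ, 0 < ε → IsResolvent A (E - Complex.I * ε) (R ε) := fun ε hε =>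
    isResolvent_resolvent hA (by rw [him]; linarith)
  have hRn : ∀ ε : ℝ, 0 < ε → ∀ y, ε * ‖R ε y‖ ≤ ‖y‖ := fun ε hε y => by
    have := (hR ε hε).norm_apply_le hA y
    rwa [him, abs_neg, abs_of_pos hε] at this
  let K := (eigenspace A E).topologicalClosure
  have hP : orthProj (eigenspace A E) = K.starProjection := rfl
  -- On the closed eigenspace K the operator iεR is the identity. Self-adjointness places the
  -- complement of Ran(A - E) inside the eigenspace, so vectors orthogonal to K are limits of
  -- vectors (A - E)x. For these εR(A - E)x = ε(x - iεRx) tends to 0.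
  let W : Submodule ℂ H := LinearMap.range (A.toFun - (E : ℂ) • A.domain.subtype)
  have hWperp : Wᗮ ≤ eigenspace A E := by
    intro y hy
    have h1 : ∀ x : A.domain, inner ℂ ((E : ℂ) • y) (x : H) = inner ℂ y (A x) := fun x => by
      have h2 : inner ℂ y (A x - (E : ℂ) • (x : H)) = 0 :=
        Submodule.inner_left_of_mem_orthogonal (K := W) ⟨x, rfl⟩ hy
      rw [inner_sub_right, inner_smul_right, sub_eq_zero] at h2
      rw [inner_smul_left, h2]; simp
    exact mem_domain_of_inner hA y _ h1
  have hdense : ∀ y ∈ Kᗮ, y ∈ closure (W : Set H) := by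
    intro y hy
    have h1 : y ∈ Wᗮᗮ := by
      refine Submodule.mem_orthogonal' _ _ |>.mpr fun x hx => ?_
      exact Submodule.inner_left_of_mem_orthogonal (Submodule.le_topologicalClosure _ (hWperp hx)) hy
    rw [Submodule.orthogonal_orthogonal_eq_closure] at h1
    exact h1
  have hself : ∀ ε : ℝ, 0 < ε → ∀ x ∈ K, (Complex.I * ε) • R ε x = x := by
    intro ε hε x hx
    have hcl : IsClosed {x | (Complex.I * ε) • R ε x = x} := isClosed_eq (by fun_prop) continuous_id
    have hsub : (eigenspace A E : Set H) ⊆ {x | (Complex.I * ε) • R ε x = x} := by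
      rintro x ⟨hx, ex⟩
      have h1 := (hR ε hε).2 ⟨x, hx⟩
      simp only at h1
      rw [ex, ← sub_smul, map_smul, sub_sub_cancel] at h1
      exact h1
    exact closure_minimal hsub hcl hx
  have hzero : ∀ y ∈ Kᗮ, Tendsto (fun ε : ℝ => (ε : ℂ) * inner ℂ φ (R ε y)) (𝓝[>] 0) (𝓝 0) := by
    intro y hy
    rw [tendsto_zero_iff_norm_tendsto_zero, Metric.tendsto_nhds]
    intro η hη
    obtain ⟨w, ⟨x, rfl⟩, hw⟩ := Metric.mem_closure_iff.mp (hdense y hy) (η / 2 / (‖φ‖ + 1))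
      (by positivity)
    have hx : (A.toFun - (E : ℂ) • A.domain.subtype) x = A x - (E : ℂ) • (x : H) := rfl
    rw [hx, dist_eq_norm, lt_div_iff₀ (by positivity)] at hw
    have hsmall : ∀ᶠ ε : ℝ in 𝓝[>] 0, ε * (‖φ‖ * (2 * ‖(x : H)‖)) < η / 2 := by
      have : Tendsto (fun ε : ℝ => ε * (‖φ‖ * (2 * ‖(x : H)‖))) (𝓝[>] 0)
          (𝓝 (0 * (‖φ‖ * (2 * ‖(x : H)‖)))) :=
        ((by fun_prop : Continuous fun ε : ℝ => ε * (‖φ‖ * (2 * ‖(x : H)‖))).tendsto 0).mono_left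
          nhdsWithin_le_nhds
      rw [zero_mul] at this
      exact this.eventually_lt_const (by positivity)
    filter_upwards [hsmall, self_mem_nhdsWithin] with ε hε hε0
    have hε0' : 0 < ε := hε0
    rw [Real.dist_eq, sub_zero, abs_of_nonneg (norm_nonneg _), norm_mul, Complex.norm_real,
      Real.norm_of_nonneg hε0'.le]
    have h1 : R ε y = R ε (y - (A x - (E : ℂ) • (x : H))) + (x - (Complex.I * ε) • R ε x) := by
      have h2 := (hR ε hε0).apply_map x
      rw [map_sub, map_sub, h2, map_smul, sub_smul]
      abel
    have h3 : ‖(Complex.I * ε : ℂ) • R ε (x : H)‖ ≤ ‖(x : H)‖ := by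
      rw [norm_smul, norm_mul, Complex.norm_I, one_mul, Complex.norm_real,
        Real.norm_of_nonneg hε0'.le]
      exact hRn ε hε0 _
    have h4 : ε * ‖R ε y‖ ≤ ‖y - (A x - (E : ℂ) • (x : H))‖ + ε * (2 * ‖(x : H)‖) := by
      rw [h1]
      have := norm_add_le (R ε (y - (A x - (E : ℂ) • (x : H)))) (x - (Complex.I * ε) • R ε x)
      have h5 := norm_sub_le (x : H) ((Complex.I * ε) • R ε x)
      have h6 := hRn ε hε0 (y - (A x - (E : ℂ) • (x : H)))
      nlinarith
    have h7 := norm_inner_le_norm (𝕜 := ℂ) φ (R ε y)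
    have h8 : ε * ‖inner ℂ φ (R ε y)‖ ≤ ‖φ‖ * (ε * ‖R ε y‖) := by nlinarith
    nlinarith [norm_nonneg φ, norm_nonneg (y - (A x - (E : ℂ) • (x : H)))]
  have hsplit : ∀ ε : ℝ, 0 < ε → (Complex.I * ε) * inner ℂ φ (R ε ψ) =
      inner ℂ φ (K.starProjection ψ) +
        Complex.I * ((ε : ℂ) * inner ℂ φ (R ε (ψ - K.starProjection ψ))) := by
    intro ε hε
    have h1 : R ε ψ = R ε (K.starProjection ψ) + R ε (ψ - K.starProjection ψ) := by
      rw [← map_add]; congr 1; abel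
    conv_rhs => rw [← hself ε hε _ (K.starProjection_apply_mem ψ), inner_smul_right]
    rw [h1, inner_add_right]
    simp only [hself ε hε _ (K.starProjection_apply_mem ψ)]
    ring
  rw [hP]
  have hlim := ((hzero _ (K.sub_starProjection_mem_orthogonal ψ)).const_mul Complex.I).const_add
    (inner ℂ φ (K.starProjection ψ))
  rw [mul_zero, add_zero] at hlim
  refine hlim.congr' ?_
  filter_upwards [self_mem_nhdsWithin] with ε hε using (hsplit ε hε).symm

end Compression

/-! ### The Feshbach equations in a basis of eigenvectors of the level shift operator. -/

section Model

set_option linter.unusedSectionVars false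

variable {H : Type*} [NormedAddCommGroup H] [InnerProductSpace ℂ H] [CompleteSpace H]

/-- The standing assumptions on the family `L₀ + Δ W`. -/
structure ResonanceAssumptions (L₀ W : H →ₗ.[ℂ] H) (Δ₀ α : ℝ) (D : Set H) (stab unst : Finset ℝ)
    (E : ℝ → ℝ → ℝ) (lam : ℝ → ℕ → ℂ) : Prop where
  Δ₀_pos : 0 < Δ₀
  α_pos : 0 < α
  selfAdjoint : ∀ Δ : ℝ, |Δ| ≤ Δ₀ → IsSelfAdjoint (perturbed L₀ W Δ)
  eigenvalues : EigenvalueAssumptions L₀ W Δ₀ stab unst E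
  firstOrder : FirstOrderVanishes L₀ W (stab ∪ unst)
  absorption : LimitingAbsorption L₀ W Δ₀ α D (stab ∪ unst)
  regular : RegularInCoupling L₀ W Δ₀ α (stab ∪ unst)
  goldenRule : FermiGoldenRule L₀ W stab unst lam

variable {L₀ W : H →ₗ.[ℂ] H} {Δ₀ α : ℝ} {D : Set H} {stab unst : Finset ℝ} {E : ℝ → ℝ → ℝ}
  {lam : ℝ → ℕ → ℂ} {e : ℝ}

theorem orthProj_eq_starProjection (V : Submodule ℂ H) [FiniteDimensional ℂ V] :
    orthProj V = V.starProjection := by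
  have key : ∀ (K : Submodule ℂ H) [K.HasOrthogonalProjection], K = V →
      K.starProjection = V.starProjection := by
    intro K _ hK
    subst hK
    rfl
  exact key _ V.closed_of_finiteDimensional.submodule_topologicalClosure_eq

theorem perturbed_mem_domain_iff {Δ : ℝ} (hΔ : Δ ≠ 0) {x : H} :
    x ∈ (perturbed L₀ W Δ).domain ↔ x ∈ L₀.domain ∧ x ∈ W.domain := by
  rw [perturbed, if_neg hΔ]; rfl

theorem perturbed_apply {Δ : ℝ} (hΔ : Δ ≠ 0) {x : H} (hx : x ∈ (perturbed L₀ W Δ).domain) :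
    perturbed L₀ W Δ ⟨x, hx⟩ = L₀ ⟨x, ((perturbed_mem_domain_iff hΔ).mp hx).1⟩ +
      (Δ : ℂ) • W ⟨x, ((perturbed_mem_domain_iff hΔ).mp hx).2⟩ := by
  have key : ∀ B : H →ₗ.[ℂ] H, B = L₀ + (Δ : ℂ) • W → ∀ hB : x ∈ B.domain,
      B ⟨x, hB⟩ = L₀ ⟨x, ((perturbed_mem_domain_iff hΔ).mp hx).1⟩ +
      (Δ : ℂ) • W ⟨x, ((perturbed_mem_domain_iff hΔ).mp hx).2⟩ := by
    rintro B rfl hB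
    rfl
  exact key _ (by rw [perturbed, if_neg hΔ]) hx

theorem ResonanceAssumptions.finiteDimensional
    (h : ResonanceAssumptions L₀ W Δ₀ α D stab unst E lam) (e : ℝ) :
    FiniteDimensional ℂ (eigenspace L₀ e) := h.eigenvalues.finiteDimensional e

theorem ResonanceAssumptions.eigProj_eq
    (h : ResonanceAssumptions L₀ W Δ₀ α D stab unst E lam) (e : ℝ) :
    haveI := h.finiteDimensional e
    eigProj L₀ e = (eigenspace L₀ e).starProjection := by
  have := h.finiteDimensional e
  exact orthProj_eq_starProjection _

theorem ResonanceAssumptions.boundedComp_apply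
    (h : ResonanceAssumptions L₀ W Δ₀ α D stab unst E lam) (he : e ∈ stab ∪ unst) (x : H) :
    ∃ hx : eigProj L₀ e x ∈ W.domain, boundedComp W (eigProj L₀ e) x = W ⟨_, hx⟩ := by
  have := h.finiteDimensional e
  have hV : eigenspace L₀ e ≤ W.domain := fun x hx => (h.firstOrder e he x hx).1
  have hex : ∃ T : H →L[ℂ] H, ∀ x, ∃ hx : eigProj L₀ e x ∈ W.domain, T x = W ⟨eigProj L₀ e x, hx⟩ := by
    rw [h.eigProj_eq e]
    exact ⟨(LinearMap.toContinuousLinearMap (W.toFun ∘ₗ Submodule.inclusion hV)) ∘L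
      (eigenspace L₀ e).orthogonalProjectionOnto, fun x =>
      ⟨hV (Submodule.starProjection_apply_mem _ _), rfl⟩⟩
  rw [boundedComp, dif_pos hex]
  exact hex.choose_spec x

theorem ResonanceAssumptions.eigProj_apply_of_mem
    (h : ResonanceAssumptions L₀ W Δ₀ α D stab unst E lam) {x : H} (hx : x ∈ eigenspace L₀ e) :
    eigProj L₀ e x = x := by
  have := h.finiteDimensional e
  rw [h.eigProj_eq e]
  exact Submodule.starProjection_eq_self_iff.mpr hx

theorem ResonanceAssumptions.eigProj_mem
    (h : ResonanceAssumptions L₀ W Δ₀ α D stab unst E lam) (x : H) :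
    eigProj L₀ e x ∈ eigenspace L₀ e := by
  have := h.finiteDimensional e
  rw [h.eigProj_eq e]
  exact Submodule.starProjection_apply_mem _ _

theorem ResonanceAssumptions.inner_eigProj_right
    (h : ResonanceAssumptions L₀ W Δ₀ α D stab unst E lam) {v : H} (hv : v ∈ eigenspace L₀ e) (x : H) :
    inner ℂ v (eigProj L₀ e x) = inner ℂ v x := by
  have := h.finiteDimensional e
  rw [h.eigProj_eq e, ← Submodule.inner_starProjection_left_eq_right,
    Submodule.starProjection_eq_self_iff.mpr hv]

theorem ResonanceAssumptions.boundedComp_eigProj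
    (h : ResonanceAssumptions L₀ W Δ₀ α D stab unst E lam) (he : e ∈ stab ∪ unst) (x : H) :
    boundedComp W (eigProj L₀ e) (eigProj L₀ e x) = boundedComp W (eigProj L₀ e) x := by
  obtain ⟨h1, e1⟩ := h.boundedComp_apply he x
  obtain ⟨h2, e2⟩ := h.boundedComp_apply he (eigProj L₀ e x)
  rw [e1, e2]
  congr 2
  exact h.eigProj_apply_of_mem (h.eigProj_mem x)

theorem ResonanceAssumptions.boundedComp_mem
    (h : ResonanceAssumptions L₀ W Δ₀ α D stab unst E lam) (he : e ∈ stab ∪ unst) {v : H}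
    (hv : v ∈ eigenspace L₀ e) : boundedComp W (eigProj L₀ e) v ∈ D := by
  obtain ⟨h1, e1⟩ := h.boundedComp_apply he v
  obtain ⟨h2, e2⟩ := h.absorption.range_subset e he v hv
  rw [e1]
  convert e2 using 3
  exact h.eigProj_apply_of_mem hv

/-- This is the form in which the vanishing of the first order is used: it removes the term linear
in Δ from the Feshbach matrix. -/
theorem ResonanceAssumptions.boundedComp_mem_orthogonal
    (h : ResonanceAssumptions L₀ W Δ₀ α D stab unst E lam) (he : e ∈ stab ∪ unst) (x : H) :
    boundedComp W (eigProj L₀ e) x ∈ (eigenspace L₀ e)ᗮ := by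
  have := h.finiteDimensional e
  obtain ⟨h1, e1⟩ := h.boundedComp_apply he x
  obtain ⟨h2, e2⟩ := h.firstOrder e he _ (h.eigProj_mem x)
  rw [e1]
  rw [← Submodule.starProjection_apply_eq_zero_iff, ← h.eigProj_eq e]
  exact e2

theorem ResonanceAssumptions.perturbed_apply_eigenvector
    (h : ResonanceAssumptions L₀ W Δ₀ α D stab unst E lam) (he : e ∈ stab ∪ unst) (Δ : ℝ) {v : H}
    (hv : v ∈ eigenspace L₀ e) : ∃ hv' : v ∈ (perturbed L₀ W Δ).domain,
      perturbed L₀ W Δ ⟨v, hv'⟩ = (e : ℂ) • v + (Δ : ℂ) • boundedComp W (eigProj L₀ e) v := by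
  obtain ⟨h1, e1⟩ := hv
  by_cases hΔ : Δ = 0
  · subst hΔ
    have key : ∀ B : H →ₗ.[ℂ] H, B = L₀ → ∃ hv' : v ∈ B.domain, B ⟨v, hv'⟩ =
        (e : ℂ) • v + ((0 : ℝ) : ℂ) • boundedComp W (eigProj L₀ e) v := by
      rintro B rfl
      exact ⟨h1, by rw [e1]; simp⟩
    exact key _ (by rw [perturbed, if_pos rfl])
  · obtain ⟨h2, e2⟩ := h.boundedComp_apply he v
    have h3 := h.eigProj_apply_of_mem ⟨h1, e1⟩
    have h4 : v ∈ W.domain := by rwa [h3] at h2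
    refine ⟨(perturbed_mem_domain_iff hΔ).mpr ⟨h1, h4⟩, ?_⟩
    rw [perturbed_apply hΔ, e1, e2]
    congr 4
    exact h3.symm

theorem ResonanceAssumptions.eigenspace_le_domain
    (h : ResonanceAssumptions L₀ W Δ₀ α D stab unst E lam) (he : e ∈ stab ∪ unst) (Δ : ℝ) :
    eigenspace L₀ e ≤ (perturbed L₀ W Δ).domain := fun _ hv =>
  (h.perturbed_apply_eigenvector he Δ hv).1

/-- The Feshbach equations: the component of `u` in `Ran P_e^⊥`. -/
theorem ResonanceAssumptions.eq_reducedResolvent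
    (h : ResonanceAssumptions L₀ W Δ₀ α D stab unst E lam) (he : e ∈ stab ∪ unst) {Δ : ℝ}
    (hΔ : |Δ| ≤ Δ₀) {z : ℂ} (hz : z.im ≠ 0) {u : H} (hu : u ∈ (perturbed L₀ W Δ).domain) :
    u = eigProj L₀ e u + reducedResolvent (perturbed L₀ W Δ) (eigenspace L₀ e) z
        (perturbed L₀ W Δ ⟨u, hu⟩ - z • u) -
      (Δ : ℂ) • reducedResolvent (perturbed L₀ W Δ) (eigenspace L₀ e) z
        (boundedComp W (eigProj L₀ e) u) := by
  have := h.finiteDimensional e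
  have h1 := resolvent_eq_reducedResolvent (h.selfAdjoint Δ hΔ) (h.eigenspace_le_domain he Δ) hz hu
  obtain ⟨h2, e2⟩ := h.perturbed_apply_eigenvector he Δ (h.eigProj_mem (e := e) u)
  have h3 := h.eigProj_eq e
  simp only [← h3] at h1
  rw [e2, map_add, map_smul, map_smul, reducedResolvent_apply_of_mem (h.eigProj_mem u), smul_zero,
    zero_add, h.boundedComp_eigProj he] at h1
  exact h1

/-- The component of the Feshbach equations in Ran P_e: by symmetry L is moved onto v, where Lv = ev
+ ΔWv. -/
theorem ResonanceAssumptions.inner_eigenvector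
    (h : ResonanceAssumptions L₀ W Δ₀ α D stab unst E lam) (he : e ∈ stab ∪ unst) {Δ : ℝ}
    (hΔ : |Δ| ≤ Δ₀) (z : ℂ) {u : H} (hu : u ∈ (perturbed L₀ W Δ).domain) {v : H}
    (hv : v ∈ eigenspace L₀ e) :
    (e - z) * inner ℂ v u + Δ * inner ℂ (boundedComp W (eigProj L₀ e) v) u =
      inner ℂ v (perturbed L₀ W Δ ⟨u, hu⟩ - z • u) := by
  obtain ⟨h2, e2⟩ := h.perturbed_apply_eigenvector he Δ hv
  have h3 := inner_symm (h.selfAdjoint Δ hΔ) ⟨v, h2⟩ ⟨u, hu⟩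
  rw [inner_sub_right, inner_smul_right, ← h3, e2, inner_add_left, inner_smul_left, inner_smul_left,
    Complex.conj_ofReal, Complex.conj_ofReal]
  ring

/-- A basis of eigenvectors of the level shift operator, with its dual basis, and the matrix of
`-P_e W R_z^{P_e} W P_e` in this basis. -/
structure LevelBasis (L₀ W : H →ₗ.[ℂ] H) (lam : ℝ → ℕ → ℂ) (e : ℝ) (m : ℕ) where
  vec : Fin m → H
  dual : Fin m → H
  vec_mem : ∀ i, vec i ∈ eigenspace L₀ e
  dual_mem : ∀ i, dual i ∈ eigenspace L₀ e
  inner_dual_vec : ∀ i j, inner ℂ (dual i) (vec j) = if i = j then (1 : ℂ) else 0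
  expand : ∀ x ∈ eigenspace L₀ e, x = ∑ i, inner ℂ (dual i) x • vec i
  levelShift_vec : ∀ i, levelShift L₀ W e (vec i) = lam e i • vec i

/-- Eigenvectors for m_e distinct eigenvalues are independent, hence a basis of Ran P_e. They need
not be orthogonal, so the coordinate functionals are represented by a dual basis through the Riesz
theorem. -/
theorem ResonanceAssumptions.exists_levelBasis
    (h : ResonanceAssumptions L₀ W Δ₀ α D stab unst E lam) (he : e ∈ stab ∪ unst) :
    Nonempty (LevelBasis L₀ W lam e (mult L₀ e)) := by
  have hfd := h.finiteDimensional e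
  have hex : ∀ i : Fin (mult L₀ e), ∃ v ∈ levelEigenspace L₀ W e (lam e i), v ≠ 0 := fun i =>
    Submodule.exists_mem_ne_zero_of_ne_bot (h.goldenRule.isEigenvalue e he i i.2)
  choose v hv hv0 using hex
  have hli : LinearIndependent ℂ v :=
    Module.End.eigenvectors_linearIndependent' (levelShift L₀ W e : H →ₗ[ℂ] H)
      (fun i : Fin (mult L₀ e) => lam e i)
      (fun i j hij => Fin.ext (h.goldenRule.simple e he i i.2 j j.2 hij)) v
      fun i => ⟨(hv i).2, hv0 i⟩
  let w : Fin (mult L₀ e) → eigenspace L₀ e := fun i => ⟨v i, (hv i).1⟩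
  have hliw : LinearIndependent ℂ w := LinearIndependent.of_comp (eigenspace L₀ e).subtype hli
  have hpos : 0 < mult L₀ e := by
    have : Nontrivial (eigenspace L₀ e) :=
      (Submodule.nontrivial_iff_ne_bot).mpr ((h.eigenvalues.isEigenvalue_iff e).mpr he)
    exact Module.finrank_pos
  have : Nonempty (Fin (mult L₀ e)) := ⟨⟨0, hpos⟩⟩
  let b := basisOfLinearIndependentOfCardEqFinrank hliw (by rw [Fintype.card_fin]; rfl)
  have hb : ∀ i, b i = w i := fun i => by simp [b]
  let d : Fin (mult L₀ e) → eigenspace L₀ e := fun i =>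
    (InnerProductSpace.toDual ℂ (eigenspace L₀ e)).symm (LinearMap.toContinuousLinearMap (b.coord i))
  have hd : ∀ i (x : eigenspace L₀ e), inner ℂ (d i : H) (x : H) = b.repr x i := fun i x => by
    rw [← Submodule.coe_inner, InnerProductSpace.toDual_symm_apply]; rfl
  refine ⟨⟨v, fun i => d i, fun i => (hv i).1, fun i => (d i).2, fun i j => ?_, fun x hx => ?_,
    fun i => ?_⟩⟩
  · have h1 := hd i (w j)
    rw [← hb, Module.Basis.repr_self, Finsupp.single_apply] at h1
    simp only [eq_comm (a := i)]
    rw [← h1, hb]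
  · have h1 := congrArg Subtype.val (b.sum_repr ⟨x, hx⟩)
    simp only [hb, Submodule.coe_sum, Submodule.coe_smul] at h1
    conv_lhs => rw [← h1]
    refine Finset.sum_congr rfl fun i _ => ?_
    rw [hd i ⟨x, hx⟩]
  · exact Module.End.mem_eigenspace_iff.mp (hv i).2

/-- In the eigenbasis the Riesz projection is the j-th coordinate times the j-th vector. The proof
checks that its range and kernel are the two complementary subspaces in the definition. This
identifies the limits of the residues. -/
theorem LevelBasis.levelProj_apply (h : ResonanceAssumptions L₀ W Δ₀ α D stab unst E lam)
    (he : e ∈ stab ∪ unst) (b : LevelBasis L₀ W lam e (mult L₀ e)) (j : Fin (mult L₀ e)) (ψ : H) :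
    levelProj L₀ W e (lam e j) ψ = inner ℂ (b.dual j) ψ • b.vec j := by
  have hfd := h.finiteDimensional e
  have hne : ∀ i, i ≠ j → lam e i - lam e j ≠ 0 := fun i hij => sub_ne_zero.mpr fun h0 =>
    hij (Fin.ext (h.goldenRule.simple e he i i.2 j j.2 h0))
  have hΛ : ∀ x ∈ eigenspace L₀ e, levelShift L₀ W e x =
      ∑ i, inner ℂ (b.dual i) x • (lam e i • b.vec i) := fun x hx => by
    conv_lhs => rw [b.expand x hx]
    simp only [map_sum, map_smul, b.levelShift_vec]
  have hcoord : ∀ (c : Fin (mult L₀ e) → ℂ) i, inner ℂ (b.dual i) (∑ k, c k • b.vec k) = c i := by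
    intro c i
    simp only [inner_sum, inner_smul_right, b.inner_dual_vec, mul_ite, mul_one, mul_zero,
      Finset.sum_ite_eq, Finset.mem_univ, if_true]
  have hp : ∀ c : ℂ, c • b.vec j ∈ levelEigenspace L₀ W e (lam e j) := fun c =>
    Submodule.smul_mem _ _ ⟨b.vec_mem j, Module.End.mem_eigenspace_iff.mpr (b.levelShift_vec j)⟩
  have hq : ∀ x, x - inner ℂ (b.dual j) x • b.vec j ∈ levelCoeigenspace L₀ W e (lam e j) := by
    intro x
    have h1 : x - eigProj L₀ e x ∈ (eigenspace L₀ e)ᗮ := by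
      rw [h.eigProj_eq e]; exact Submodule.sub_starProjection_mem_orthogonal _
    have h2 : eigProj L₀ e x - inner ℂ (b.dual j) x • b.vec j ∈
        (eigenspace L₀ e).map ((levelShift L₀ W e : H →ₗ[ℂ] H) - lam e j • LinearMap.id) := by
      -- Off the index j, Λ_e - λ_j is inverted by dividing the coordinates by λ_i - λ_j.
      refine ⟨∑ i, (if i = j then 0 else inner ℂ (b.dual i) x / (lam e i - lam e j)) • b.vec i,
        Submodule.sum_mem _ fun i _ => Submodule.smul_mem _ _ (b.vec_mem i), ?_⟩
      rw [b.expand _ (h.eigProj_mem x)]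
      simp only [h.inner_eigProj_right (b.dual_mem _)]
      rw [← Finset.sum_erase_eq_sub (f := fun i => inner ℂ (b.dual i) x • b.vec i)
        (Finset.mem_univ j), ← Finset.sum_erase (a := j) _ (by simp)]
      simp only [map_sum, map_smul, LinearMap.sub_apply,
        LinearMap.smul_apply, LinearMap.id_apply, ContinuousLinearMap.coe_coe, b.levelShift_vec]
      refine Finset.sum_congr rfl fun i hi => ?_
      have hij := Finset.ne_of_mem_erase hi
      rw [if_neg hij, ← sub_smul, smul_smul, div_mul_cancel₀ _ (hne i hij)]
    have h3 : x - inner ℂ (b.dual j) x • b.vec j =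
        (eigProj L₀ e x - inner ℂ (b.dual j) x • b.vec j) + (x - eigProj L₀ e x) := by abel
    rw [h3]
    exact Submodule.add_mem_sup h2 h1
  have hq0 : ∀ x ∈ levelCoeigenspace L₀ W e (lam e j), inner ℂ (b.dual j) x = 0 := by
    intro x hx
    obtain ⟨y, ⟨w, hw, rfl⟩, y', hy', rfl⟩ := Submodule.mem_sup.mp hx
    rw [inner_add_right, Submodule.inner_right_of_mem_orthogonal (b.dual_mem j) hy', add_zero]
    change inner ℂ (b.dual j) (levelShift L₀ W e w - lam e j • w) = 0
    rw [inner_sub_right, hΛ w hw, inner_smul_right]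
    simp only [smul_smul, hcoord]
    ring
  have hp1 : ∀ x ∈ levelEigenspace L₀ W e (lam e j), x = inner ℂ (b.dual j) x • b.vec j := by
    rintro x ⟨hx1, hx2⟩
    have hx3 : levelShift L₀ W e x = lam e j • x := Module.End.mem_eigenspace_iff.mp hx2
    rw [hΛ x hx1] at hx3
    have h4 : ∀ i, i ≠ j → inner ℂ (b.dual i) x = 0 := fun i hij => by
      have h5 := congrArg (fun y => inner ℂ (b.dual i) y) hx3
      simp only [smul_smul, hcoord, inner_smul_right] at h5
      have h6 : (lam e i - lam e j) * inner ℂ (b.dual i) x = 0 := by linear_combination h5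
      exact (mul_eq_zero.mp h6).resolve_left (hne i hij)
    conv_lhs => rw [b.expand x hx1]
    refine Finset.sum_eq_single j (fun i _ hij => by rw [h4 i hij, zero_smul]) (by simp)
  have hcompl : IsCompl (levelEigenspace L₀ W e (lam e j)) (levelCoeigenspace L₀ W e (lam e j)) := by
    refine ⟨Submodule.disjoint_def.mpr fun x hx hx' => ?_, codisjoint_iff_le_sup.mpr fun x _ => ?_⟩
    · rw [hp1 x hx, hq0 x hx', zero_smul]
    · have : x = inner ℂ (b.dual j) x • b.vec j + (x - inner ℂ (b.dual j) x • b.vec j) := by abel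
      rw [this]
      exact Submodule.add_mem_sup (hp _) (hq x)
  rw [levelProj, dif_pos hcompl]
  have : ψ = inner ℂ (b.dual j) ψ • b.vec j + (ψ - inner ℂ (b.dual j) ψ • b.vec j) := by abel
  conv_lhs => rw [this]
  rw [map_add, Submodule.projection_apply_of_mem_left hcompl (hp _),
    (Submodule.projection_apply_eq_zero_iff hcompl).mpr (hq ψ), add_zero]

/-- The matrix elements of `-P_e W R_z^{P_e} W P_e`. -/
noncomputable def LevelBasis.mat {m : ℕ} (b : LevelBasis L₀ W lam e m) (Δ : ℝ) (z : ℂ) :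
    Matrix (Fin m) (Fin m) ℂ := fun i j =>
  -inner ℂ (boundedComp W (eigProj L₀ e) (b.dual i))
    (reducedResolvent (perturbed L₀ W Δ) (eigenspace L₀ e) z
      (boundedComp W (eigProj L₀ e) (b.vec j)))

/-- Inserting the complementary component of u into the equation on Ran P_e leaves a finite system
with matrix e - z + Δ²M for the coordinates of u. The contribution of P_e u to the coupling term
vanishes because W P_e maps into Ran P_e^⊥. Any u in the domain is allowed, so that the system
applies to eigenvectors of L as well as to R_zψ. -/
theorem LevelBasis.feshbach_equation {m : ℕ} (h : ResonanceAssumptions L₀ W Δ₀ α D stab unst E lam)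
    (he : e ∈ stab ∪ unst) (b : LevelBasis L₀ W lam e m) {Δ : ℝ} (hΔ : |Δ| ≤ Δ₀) {z : ℂ}
    (hz : z.im ≠ 0) {u : H} (hu : u ∈ (perturbed L₀ W Δ).domain) (i : Fin m) :
    (e - z) * inner ℂ (b.dual i) u + Δ ^ 2 * ∑ j, b.mat Δ z i j * inner ℂ (b.dual j) u =
      inner ℂ (b.dual i) (perturbed L₀ W Δ ⟨u, hu⟩ - z • u) -
      Δ * inner ℂ (boundedComp W (eigProj L₀ e) (b.dual i))
        (reducedResolvent (perturbed L₀ W Δ) (eigenspace L₀ e) z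
          (perturbed L₀ W Δ ⟨u, hu⟩ - z • u)) := by
  have h1 := h.inner_eigenvector he hΔ z hu (b.dual_mem i)
  have h2 := h.eq_reducedResolvent he hΔ hz hu
  have h3 : boundedComp W (eigProj L₀ e) u =
      ∑ j, inner ℂ (b.dual j) u • boundedComp W (eigProj L₀ e) (b.vec j) := by
    rw [← h.boundedComp_eigProj he, b.expand _ (h.eigProj_mem u)]
    simp only [map_sum, map_smul, h.inner_eigProj_right (b.dual_mem _)]
  have h4 : inner ℂ (boundedComp W (eigProj L₀ e) (b.dual i)) u =
      inner ℂ (boundedComp W (eigProj L₀ e) (b.dual i))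
        (reducedResolvent (perturbed L₀ W Δ) (eigenspace L₀ e) z
          (perturbed L₀ W Δ ⟨u, hu⟩ - z • u)) + Δ * ∑ j, b.mat Δ z i j * inner ℂ (b.dual j) u := by
    conv_lhs => rw [h2, h3]
    rw [inner_sub_right, inner_add_right,
      Submodule.inner_left_of_mem_orthogonal (h.eigProj_mem u) (h.boundedComp_mem_orthogonal he _),
      zero_add, inner_smul_right, map_sum, inner_sum, sub_eq_add_neg, ← mul_neg,
      ← Finset.sum_neg_distrib]
    congr 2
    refine Finset.sum_congr rfl fun j _ => ?_
    rw [map_smul, inner_smul_right, LevelBasis.mat]; ring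
  rw [← h1, h4]
  ring

/-- The counterpart of the finite system: it recovers ⟨φ, u⟩ from the coordinates and the reduced
resolvent, which is regular up to the real axis near e. -/
theorem LevelBasis.inner_eq {m : ℕ} (h : ResonanceAssumptions L₀ W Δ₀ α D stab unst E lam)
    (he : e ∈ stab ∪ unst) (b : LevelBasis L₀ W lam e m) {Δ : ℝ} (hΔ : |Δ| ≤ Δ₀) {z : ℂ}
    (hz : z.im ≠ 0) {u : H} (hu : u ∈ (perturbed L₀ W Δ).domain) (φ : H) :
    inner ℂ φ u = inner ℂ φ (reducedResolvent (perturbed L₀ W Δ) (eigenspace L₀ e) z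
        (perturbed L₀ W Δ ⟨u, hu⟩ - z • u)) +
      ∑ i, (inner ℂ φ (b.vec i) - Δ * inner ℂ φ (reducedResolvent (perturbed L₀ W Δ)
        (eigenspace L₀ e) z (boundedComp W (eigProj L₀ e) (b.vec i)))) * inner ℂ (b.dual i) u := by
  have h2 := h.eq_reducedResolvent he hΔ hz hu
  have h3 : boundedComp W (eigProj L₀ e) u =
      ∑ j, inner ℂ (b.dual j) u • boundedComp W (eigProj L₀ e) (b.vec j) := by
    rw [← h.boundedComp_eigProj he, b.expand _ (h.eigProj_mem u)]
    simp only [map_sum, map_smul, h.inner_eigProj_right (b.dual_mem _)]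
  have h5 : eigProj L₀ e u = ∑ j, inner ℂ (b.dual j) u • b.vec j := by
    conv_lhs => rw [b.expand _ (h.eigProj_mem u)]
    simp only [h.inner_eigProj_right (b.dual_mem _)]
  conv_lhs => rw [h2, h3, h5]
  rw [inner_sub_right, inner_add_right, inner_smul_right, map_sum, inner_sum, inner_sum]
  simp only [map_smul, inner_smul_right, sub_mul, Finset.sum_sub_distrib, Finset.mul_sum]
  have e1 : ∀ x y z w : ℂ, z = w → x + y - z = y + (x - w) := fun x y z w hzw => by rw [hzw]; ring
  rw [e1 _ _ _ (∑ i, (Δ : ℂ) * inner ℂ φ (reducedResolvent (perturbed L₀ W Δ)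
    (eigenspace L₀ e) z (boundedComp W (eigProj L₀ e) (b.vec i))) * inner ℂ (b.dual i) u)
    (Finset.sum_congr rfl fun i _ => by ring)]
  congr 2
  exact Finset.sum_congr rfl fun i _ => by ring

end Model

/-! ### Uniform bounds supplied by limiting absorption and regularity in the coupling. -/

section Families

set_option linter.unusedSectionVars false

variable {H : Type*} [NormedAddCommGroup H] [InnerProductSpace ℂ H] [CompleteSpace H]

theorem unifBddDeriv_const_self {ι : Type*} {n : ℕ} {s : Set ι} {Ω : Set ℂ} (c : ℂ) :
    UnifBddDeriv n s Ω fun _ _ => c := unifBddDeriv_const (c := fun _ => c) fun _ _ => le_rfl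

/-- D need not be a subspace, but the bounds pass to finite linear combinations. The sesquilinear
forms live on the span, and at high energy L₀φ and Wφ are only known to lie there. -/
theorem unifBddDeriv_inner_span {ι : Type*} {n : ℕ} {s : Set ι} {Ω : Set ℂ} (hΩ : IsOpen Ω)
    {F : ι → ℂ → H →L[ℂ] H} {D : Set H}
    (hD : ∀ φ ∈ D, ∀ ψ ∈ D, UnifBddDeriv n s Ω fun i z => inner ℂ φ (F i z ψ)) {φ ψ : H}
    (hφ : φ ∈ Submodule.span ℂ D) (hψ : ψ ∈ Submodule.span ℂ D) :
    UnifBddDeriv n s Ω fun i z => inner ℂ φ (F i z ψ) := by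
  have h1 : ∀ φ ∈ D, UnifBddDeriv n s Ω fun i z => inner ℂ φ (F i z ψ) := by
    intro φ hφ
    induction hψ using Submodule.span_induction with
    | mem x hx => exact hD φ hφ x hx
    | zero => simpa using unifBddDeriv_const_self 0
    | add x y _ _ hx hy =>
      simp only [map_add, inner_add_right]
      exact hx.add hΩ hy
    | smul c x _ hx =>
      simp only [map_smul, inner_smul_right]
      exact (unifBddDeriv_const_self c).mul hΩ hx
  induction hφ using Submodule.span_induction with
  | mem x hx => exact h1 x hx
  | zero => simpa using unifBddDeriv_const_self 0
  | add x y _ _ hx hy =>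
    simp only [inner_add_left]
    exact hx.add hΩ hy
  | smul c x _ hx =>
    simp only [inner_smul_left]
    exact (unifBddDeriv_const_self _).mul hΩ hx

variable {L₀ W : H →ₗ.[ℂ] H} {Δ₀ α : ℝ} {D : Set H} {stab unst : Finset ℝ} {E : ℝ → ℝ → ℝ}
  {lam : ℝ → ℕ → ℂ} {e : ℝ}

theorem ResonanceAssumptions.unifBddDeriv_strip
    (h : ResonanceAssumptions L₀ W Δ₀ α D stab unst E lam) (he : e ∈ stab ∪ unst) {φ ψ : H}
    (hφ : φ ∈ D) (hψ : ψ ∈ D) :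
    UnifBddDeriv 3 {Δ : ℝ | |Δ| ≤ Δ₀} {z : ℂ | z.im < 0 ∧ |z.re - e| ≤ α} fun Δ z =>
      inner ℂ φ (reducedResolvent (perturbed L₀ W Δ) (eigenspace L₀ e) z ψ) := by
  have := h.finiteDimensional e
  obtain ⟨C, hC⟩ := h.absorption.near φ hφ ψ hψ
  refine ⟨C, fun Δ hΔ => ⟨fun z hz => ?_, fun k hk z hz => hC Δ hΔ e he z hz.1 hz.2 k hk⟩⟩
  exact (differentiableAt_inner_reducedResolvent (h.selfAdjoint Δ hΔ)
    (h.eigenspace_le_domain he Δ) hz.1 φ ψ).differentiableWithinAt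

theorem ResonanceAssumptions.unifBddDeriv_disc
    (h : ResonanceAssumptions L₀ W Δ₀ α D stab unst E lam) (he : e ∈ stab ∪ unst) {φ ψ : H}
    (hφ : φ ∈ Submodule.span ℂ D) (hψ : ψ ∈ Submodule.span ℂ D) :
    UnifBddDeriv 3 {Δ : ℝ | |Δ| ≤ Δ₀} (lowerHalfDisc e α) fun Δ z =>
      inner ℂ φ (reducedResolvent (perturbed L₀ W Δ) (eigenspace L₀ e) z ψ) := by
  refine unifBddDeriv_inner_span (isOpen_lowerHalfDisc _ _) (fun φ hφ ψ hψ => ?_) hφ hψ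
  refine (h.unifBddDeriv_strip he hφ hψ).mono le_rfl subset_rfl fun z hz => ⟨hz.1, ?_⟩
  have := Complex.abs_re_le_norm (z - e)
  rw [Complex.sub_re, Complex.ofReal_re] at this
  exact this.trans hz.2.le

theorem ResonanceAssumptions.unifBddDeriv_away
    (h : ResonanceAssumptions L₀ W Δ₀ α D stab unst E lam) {φ ψ : H}
    (hφ : φ ∈ Submodule.span ℂ D) (hψ : ψ ∈ Submodule.span ℂ D) :
    UnifBddDeriv 1 {Δ : ℝ | |Δ| ≤ Δ₀} {z : ℂ | z.im < 0 ∧ ∀ e ∈ stab ∪ unst, α < |z.re - e|}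
      fun Δ z => inner ℂ φ (resolvent (perturbed L₀ W Δ) z ψ) := by
  have hopen : IsOpen {z : ℂ | z.im < 0 ∧ ∀ e ∈ stab ∪ unst, α < |z.re - e|} := by
    refine (isOpen_lt Complex.continuous_im continuous_const).inter ?_
    change IsOpen {z : ℂ | ∀ e ∈ stab ∪ unst, α < |z.re - e|}
    have : {z : ℂ | ∀ e ∈ stab ∪ unst, α < |z.re - e|} =
        ⋂ e ∈ stab ∪ unst, {z : ℂ | α < |z.re - e|} := by ext; simp
    rw [this]
    exact isOpen_biInter_finset fun e _ =>
      isOpen_lt continuous_const (Complex.continuous_re.sub continuous_const).abs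
  refine unifBddDeriv_inner_span hopen (fun φ hφ ψ hψ => ?_) hφ hψ
  obtain ⟨C, hC⟩ := h.absorption.away φ hφ ψ hψ
  exact ⟨C, fun Δ hΔ => ⟨fun z hz => (differentiableAt_inner_resolvent (h.selfAdjoint Δ hΔ)
    hz.1 φ ψ).differentiableWithinAt, fun k hk z hz => hC Δ hΔ z hz.1 hz.2 k hk⟩⟩

theorem LevelBasis.unifBddDeriv_mat {m : ℕ} (h : ResonanceAssumptions L₀ W Δ₀ α D stab unst E lam)
    (he : e ∈ stab ∪ unst) (b : LevelBasis L₀ W lam e m) (i j : Fin m) :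
    UnifBddDeriv 3 {Δ : ℝ | |Δ| ≤ Δ₀} (lowerHalfDisc e α) fun Δ z => b.mat Δ z i j := by
  have h1 := (unifBddDeriv_const_self (-1)).mul (isOpen_lowerHalfDisc _ _) (h.unifBddDeriv_disc he
    (Submodule.subset_span (h.boundedComp_mem he (b.dual_mem i)))
    (Submodule.subset_span (h.boundedComp_mem he (b.vec_mem j))))
  simpa [LevelBasis.mat] using h1

theorem LevelBasis.mat_eq_feshbachTerm {m : ℕ} (b : LevelBasis L₀ W lam e m) (Δ : ℝ) (z : ℂ)
    (i j : Fin m) : b.mat Δ z i j = -inner ℂ (b.dual i) (feshbachTerm L₀ W e z Δ (b.vec j)) := by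
  rw [feshbachTerm, ContinuousLinearMap.comp_apply, ContinuousLinearMap.adjoint_inner_right]
  rfl

/-- Mean value inequality in Δ on [-Δ₀, Δ₀], with the derivative bound that is uniform in z. -/
theorem LevelBasis.norm_mat_sub_le {m : ℕ} (h : ResonanceAssumptions L₀ W Δ₀ α D stab unst E lam)
    (he : e ∈ stab ∪ unst) (b : LevelBasis L₀ W lam e m) :
    ∃ C, ∀ Δ, |Δ| ≤ Δ₀ → ∀ z ∈ lowerHalfDisc e α, ∀ i j,
      ‖b.mat Δ z i j - b.mat 0 z i j‖ ≤ C * |Δ| := by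
  obtain ⟨C, hC⟩ := h.regular
  let B : ℝ := ∑ i, ‖b.dual i‖
  let B' : ℝ := ∑ i, ‖b.vec i‖
  refine ⟨B * |C| * B', fun Δ hΔ z hz i j => ?_⟩
  have hre : |z.re - e| ≤ α := by
    have := Complex.abs_re_le_norm (z - e)
    rw [Complex.sub_re, Complex.ofReal_re] at this
    exact this.trans hz.2.le
  choose! T hT using hC e he z hz.1 hre
  have h1 : ‖feshbachTerm L₀ W e z Δ - feshbachTerm L₀ W e z 0‖ ≤ C * ‖Δ - 0‖ :=
    (convex_Icc (-Δ₀) Δ₀).norm_image_sub_le_of_norm_hasDerivWithin_le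
      (fun x hx => (hT x hx).1) (fun x hx => (hT x hx).2)
      ⟨by linarith [h.Δ₀_pos], h.Δ₀_pos.le⟩ (abs_le.mp hΔ)
  rw [sub_zero, Real.norm_eq_abs] at h1
  rw [b.mat_eq_feshbachTerm, b.mat_eq_feshbachTerm, neg_sub_neg, ← inner_sub_right, ← sub_apply,
    ← norm_neg, ← inner_neg_right, ← neg_apply, neg_sub]
  have hi : ‖b.dual i‖ ≤ B :=
    Finset.single_le_sum (f := fun i => ‖b.dual i‖) (fun _ _ => norm_nonneg _) (Finset.mem_univ i)
  have hj : ‖b.vec j‖ ≤ B' :=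
    Finset.single_le_sum (f := fun i => ‖b.vec i‖) (fun _ _ => norm_nonneg _) (Finset.mem_univ j)
  calc _ ≤ ‖b.dual i‖ * (‖feshbachTerm L₀ W e z Δ - feshbachTerm L₀ W e z 0‖ * ‖b.vec j‖) :=
        (norm_inner_le_norm _ _).trans (by gcongr; exact ContinuousLinearMap.le_opNorm _ _)
    _ ≤ B * ((|C| * |Δ|) * B') := by
        gcongr
        exact h1.trans (by gcongr; exact le_abs_self C)
    _ = _ := by ring

/-- In the basis of its eigenvectors, the level shift operator is the boundary value of the
matrix `-P_e W R_z^{P_e} W P_e` for `Δ = 0`. -/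
theorem LevelBasis.tendsto_mat {m : ℕ} (h : ResonanceAssumptions L₀ W Δ₀ α D stab unst E lam)
    (he : e ∈ stab ∪ unst) (b : LevelBasis L₀ W lam e m) (i j : Fin m) :
    Tendsto (fun ε : ℝ => b.mat 0 (e - Complex.I * ε) i j) (𝓝[>] 0)
      (𝓝 (Matrix.diagonal (fun i : Fin m => lam e i) i j)) := by
  have hfd := h.finiteDimensional e
  have hα := h.α_pos
  have hclos := mem_closure_lowerHalfDisc (e : ℂ) (δ := α) (p := e) (by simpa using hα)
  have hex : ∀ i j, ∃ n, Tendsto (fun ε : ℝ => b.mat 0 (e - Complex.I * ε) i j) (𝓝[>] 0) (𝓝 n) := by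
    intro i j
    obtain ⟨C, hC⟩ := b.unifBddDeriv_mat h he i j
    have hC0 := hC 0 (by simpa using h.Δ₀_pos.le)
    obtain ⟨v, -, hv⟩ := boundary_taylor_one (C := |C|) (isOpen_lowerHalfDisc _ _)
      (convex_lowerHalfDisc _ _) hclos hC0.1
      (fun k hk z hz => (hC0.2 k (by omega) z hz).trans (le_abs_self _)) (abs_nonneg _)
    have h1 : Tendsto (fun z => b.mat 0 z i j) (𝓝[lowerHalfDisc e α] e) (𝓝 v) :=
      tendsto_of_norm_sub_le (C := |C|) 0 (fun z hz => by simpa only [zero_add, pow_one] using hv z hz)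
    exact ⟨v, h1.comp (tendsto_vertical (e : ℂ) (δ := α) (p := e) (by simpa using hα))⟩
  choose n hn using hex
  -- Writing the operators as finite combinations of these fixed rank one operators turns
  -- convergence of the matrix entries into norm convergence.
  let rk : Fin m → Fin m → H →L[ℂ] H := fun i j => (innerSL ℂ (b.dual j)).smulRight (b.vec i)
  have hrk : ∀ i j x, rk i j x = inner ℂ (b.dual j) x • b.vec i := fun i j x => rfl
  let B := boundedComp W (eigProj L₀ e)
  have hp0 : perturbed L₀ W 0 = L₀ := if_pos rfl
  have hX : ∀ ε : ℝ, 0 < ε → -(ContinuousLinearMap.adjoint B ∘L (1 - eigProj L₀ e) ∘L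
      resolvent L₀ (e - Complex.I * ε) ∘L B) =
      ∑ i, ∑ j, b.mat 0 (e - Complex.I * ε) i j • rk i j := by
    intro ε hε
    have hz : ((e : ℂ) - Complex.I * ε).im ≠ 0 := by simpa using hε.ne'
    set z : ℂ := e - Complex.I * ε
    have hA : IsSelfAdjoint (perturbed L₀ W 0) := h.selfAdjoint 0 (by simpa using h.Δ₀_pos.le)
    -- For Δ = 0 the Feshbach coupling is absent, so the complementary component of the full
    -- resolvent is the reduced resolvent.
    have hBx : ∀ x, (1 - eigProj L₀ e) (resolvent L₀ z (B x)) =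
        reducedResolvent (perturbed L₀ W 0) (eigenspace L₀ e) z (B x) := by
      intro x
      obtain ⟨hu, e1⟩ := (isResolvent_resolvent hA hz).1 (B x)
      have h1 := h.eq_reducedResolvent he (Δ := 0) (by simpa using h.Δ₀_pos.le) hz hu
      rw [e1, Complex.ofReal_zero, zero_smul, sub_zero, hp0, ← sub_eq_iff_eq_add'] at h1
      rw [hp0, ← h1]
      rfl
    ext x
    rw [neg_apply]
    change -(ContinuousLinearMap.adjoint B ((1 - eigProj L₀ e) (resolvent L₀ z (B x)))) = _
    rw [hBx]
    set y := ContinuousLinearMap.adjoint B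
      (reducedResolvent (perturbed L₀ W 0) (eigenspace L₀ e) z (B x)) with hy
    have hyV : y ∈ eigenspace L₀ e := by
      have h1 : eigProj L₀ e y = y := by
        refine ext_inner_left ℂ fun w => ?_
        rw [hy, ContinuousLinearMap.adjoint_inner_right]
        have h2 : B w = B (eigProj L₀ e w) := (h.boundedComp_eigProj he w).symm
        rw [h2, ← ContinuousLinearMap.adjoint_inner_right, h.eigProj_eq e,
          Submodule.inner_starProjection_left_eq_right]
      rw [← h1]; exact h.eigProj_mem _
    have hBxe : B x = ∑ j, inner ℂ (b.dual j) x • B (b.vec j) := by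
      have h2 : B x = B (eigProj L₀ e x) := (h.boundedComp_eigProj he x).symm
      rw [h2, b.expand _ (h.eigProj_mem x)]
      simp only [map_sum, map_smul, h.inner_eigProj_right (b.dual_mem _)]
    rw [b.expand y hyV, ← Finset.sum_neg_distrib]
    simp only [sum_apply, smul_apply, hrk]
    refine Finset.sum_congr rfl fun i _ => ?_
    simp only [smul_smul, ← Finset.sum_smul]
    rw [← neg_smul]
    congr 1
    rw [hy, ContinuousLinearMap.adjoint_inner_right, hBxe, map_sum, inner_sum,
      ← Finset.sum_neg_distrib]
    refine Finset.sum_congr rfl fun j _ => ?_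
    rw [map_smul, inner_smul_right, LevelBasis.mat]
    ring
  have hlim : Tendsto (fun ε : ℝ => -(ContinuousLinearMap.adjoint B ∘L (1 - eigProj L₀ e) ∘L
      resolvent L₀ (e - Complex.I * ε) ∘L B)) (𝓝[>] 0) (𝓝 (∑ i, ∑ j, n i j • rk i j)) := by
    have h1 : Tendsto (fun ε : ℝ => ∑ i, ∑ j, b.mat 0 (e - Complex.I * ε) i j • rk i j) (𝓝[>] 0)
        (𝓝 (∑ i, ∑ j, n i j • rk i j)) :=
      tendsto_finsetSum _ fun i _ => tendsto_finsetSum _ fun j _ => (hn i j).smul_const _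
    refine h1.congr' ?_
    filter_upwards [self_mem_nhdsWithin] with ε hε using (hX ε hε).symm
  -- The limit defining Λ_e is a genuine one. As the basis consists of eigenvectors of Λ_e, the
  -- matrix of limits must be diagonal.
  have hΛ : levelShift L₀ W e = ∑ i, ∑ j, n i j • rk i j := hlim.limUnder_eq
  have h2 := b.levelShift_vec j
  rw [hΛ] at h2
  simp only [sum_apply, smul_apply, hrk, b.inner_dual_vec] at h2
  have h3 := congrArg (fun y => inner ℂ (b.dual i) y) h2
  simp only [inner_sum, inner_smul_right, b.inner_dual_vec] at h3
  simp only [mul_ite, mul_one, mul_zero] at h3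
  have h4 : n i j = Matrix.diagonal (fun i : Fin m => lam e i) i j := by
    rw [Matrix.diagonal_apply]
    by_cases hij : i = j
    · subst hij
      simpa [Finset.sum_ite_eq, b.inner_dual_vec, apply_ite, eq_comm] using h3
    · simpa [Finset.sum_ite_eq, b.inner_dual_vec, apply_ite, hij] using h3
  rw [← h4]; exact hn i j

end Families

/-! ### The resolvent near an eigenvalue as a sum of scalar quotients. -/

section LocalDiagonalization

set_option linter.unusedSectionVars false

variable {H : Type*} [NormedAddCommGroup H] [InnerProductSpace ℂ H] [CompleteSpace H]
  {L₀ W : H →ₗ.[ℂ] H} {Δ₀ α : ℝ} {D : Set H} {stab unst : Finset ℝ} {E : ℝ → ℝ → ℝ}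
  {lam : ℝ → ℕ → ℂ} {e : ℝ} {m : ℕ}

/-- A holomorphic diagonalization of the matrices of `-P_e W R_z^{P_e} W P_e` near `z = e`,
uniform in the coupling constant. -/
structure LevelDiagonalization (b : LevelBasis L₀ W lam e m) (Δ₀ α δ c K : ℝ) where
  a : ℝ → ℂ → Fin m → ℂ
  S : ℝ → ℂ → Matrix (Fin m) (Fin m) ℂ
  S' : ℝ → ℂ → Matrix (Fin m) (Fin m) ℂ
  δ_pos : 0 < δ
  δ_le : δ ≤ α
  c_pos : 0 < c
  c_le : c ≤ Δ₀
  bdd_a : ∀ j, UnifBddDeriv 3 {Δ : ℝ | |Δ| < c} (lowerHalfDisc e δ) fun Δ z => a Δ z j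
  bdd_S : ∀ i j, UnifBddDeriv 3 {Δ : ℝ | |Δ| < c} (lowerHalfDisc e δ) fun Δ z => S Δ z i j
  bdd_S' : ∀ i j, UnifBddDeriv 3 {Δ : ℝ | |Δ| < c} (lowerHalfDisc e δ) fun Δ z => S' Δ z i j
  mat_mul : ∀ Δ, |Δ| < c → ∀ z ∈ lowerHalfDisc e δ,
    b.mat Δ z * S Δ z = S Δ z * Matrix.diagonal (a Δ z)
  mul_inv : ∀ Δ, |Δ| < c → ∀ z ∈ lowerHalfDisc e δ, S Δ z * S' Δ z = 1
  inv_mul : ∀ Δ, |Δ| < c → ∀ z ∈ lowerHalfDisc e δ, S' Δ z * S Δ z = 1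
  a_sub : ∀ Δ, |Δ| < c → ∀ z ∈ lowerHalfDisc e δ, ∀ j, ‖a Δ z j - lam e j‖ ≤ K * (|Δ| + ‖z - e‖)
  S_sub : ∀ Δ, |Δ| < c → ∀ z ∈ lowerHalfDisc e δ, ∀ i j,
    ‖S Δ z i j - (1 : Matrix (Fin m) (Fin m) ℂ) i j‖ ≤ K * (|Δ| + ‖z - e‖)
  S'_sub : ∀ Δ, |Δ| < c → ∀ z ∈ lowerHalfDisc e δ, ∀ i j,
    ‖S' Δ z i j - (1 : Matrix (Fin m) (Fin m) ℂ) i j‖ ≤ K * (|Δ| + ‖z - e‖)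

theorem ResonanceAssumptions.exists_levelDiagonalization
    (h : ResonanceAssumptions L₀ W Δ₀ α D stab unst E lam) (he : e ∈ stab ∪ unst)
    (b : LevelBasis L₀ W lam e (mult L₀ e)) :
    ∃ δ c K, Nonempty (LevelDiagonalization b Δ₀ α δ c K) := by
  obtain ⟨δ, hδ, hδα, c, hc, hcΔ, a, S, S', ha, hS, hS', K, hK⟩ :=
    exists_diagonalization (lam := fun i : Fin (mult L₀ e) => lam e i)
      (fun i j hij => Fin.ext (h.goldenRule.simple e he i i.2 j j.2 hij)) h.Δ₀_pos h.α_pos b.mat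
      (b.unifBddDeriv_mat h he) (b.norm_mat_sub_le h he) (b.tendsto_mat h he)
  exact ⟨δ, c, K, ⟨⟨a, S, S', hδ, hδα, hc, hcΔ, ha, hS, hS', fun Δ hΔ z hz => (hK Δ hΔ z hz).1,
    fun Δ hΔ z hz => (hK Δ hΔ z hz).2.1, fun Δ hΔ z hz => (hK Δ hΔ z hz).2.2.1,
    fun Δ hΔ z hz => (hK Δ hΔ z hz).2.2.2.1, fun Δ hΔ z hz => (hK Δ hΔ z hz).2.2.2.2.1,
    fun Δ hΔ z hz => (hK Δ hΔ z hz).2.2.2.2.2⟩⟩⟩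

/-- If the column y is within Kκ of the j-th unit vector and x within Mκ of x', their pairing is
within O(κ) of x'_j. Here y is a column of S or a row of S', and κ = |Δ| + |z - e|. -/
theorem norm_sum_sub_le {x x' : Fin m → ℂ} {y : Fin m → ℂ} {j : Fin m} {B K M κ : ℝ}
    (hB : ∀ i, ‖x i‖ ≤ B) (hx : ∀ i, ‖x i - x' i‖ ≤ M * κ)
    (hy : ∀ i, ‖y i - (1 : Matrix (Fin m) (Fin m) ℂ) i j‖ ≤ K * κ) :
    ‖∑ i, x i * y i - x' j‖ ≤ (m * (B * K) + M) * κ := by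
  have h1 : ∑ i, x i * y i - x' j =
      ∑ i, x i * (y i - (1 : Matrix (Fin m) (Fin m) ℂ) i j) + (x j - x' j) := by
    simp only [mul_sub, Finset.sum_sub_distrib, Matrix.one_apply, mul_ite, mul_one, mul_zero,
      Finset.sum_ite_eq', Finset.mem_univ, if_true]
    ring
  have h2 : ‖∑ i, x i * (y i - (1 : Matrix (Fin m) (Fin m) ℂ) i j)‖ ≤ m * (B * (K * κ)) := by
    refine (norm_sum_le _ _).trans ((Finset.sum_le_card_nsmul _ _ (B * (K * κ))
      fun i _ => ?_).trans_eq (by simp))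
    rw [norm_mul]
    exact mul_le_mul (hB i) (hy i) (norm_nonneg _) ((norm_nonneg _).trans (hB i))
  rw [h1]
  refine (norm_add_le _ _).trans ((add_le_add h2 (hx j)).trans_eq (by ring))

namespace LevelDiagonalization

variable {b : LevelBasis L₀ W lam e m} {δ c K : ℝ}

/-- The same diagonalization on a smaller set. -/
def restrict (d : LevelDiagonalization b Δ₀ α δ c K) {δ' c' : ℝ} (hδ' : 0 < δ') (hδ : δ' ≤ δ)
    (hc' : 0 < c') (hc : c' ≤ c) : LevelDiagonalization b Δ₀ α δ' c' K where
  a := d.a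
  S := d.S
  S' := d.S'
  δ_pos := hδ'
  δ_le := hδ.trans d.δ_le
  c_pos := hc'
  c_le := hc.trans d.c_le
  bdd_a j := (d.bdd_a j).mono le_rfl (fun _ h => lt_of_lt_of_le h hc) (lowerHalfDisc_mono _ hδ)
  bdd_S i j := (d.bdd_S i j).mono le_rfl (fun _ h => lt_of_lt_of_le h hc) (lowerHalfDisc_mono _ hδ)
  bdd_S' i j := (d.bdd_S' i j).mono le_rfl (fun _ h => lt_of_lt_of_le h hc) (lowerHalfDisc_mono _ hδ)
  mat_mul Δ hΔ z hz := d.mat_mul Δ (hΔ.trans_le hc) z (lowerHalfDisc_mono _ hδ hz)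
  mul_inv Δ hΔ z hz := d.mul_inv Δ (hΔ.trans_le hc) z (lowerHalfDisc_mono _ hδ hz)
  inv_mul Δ hΔ z hz := d.inv_mul Δ (hΔ.trans_le hc) z (lowerHalfDisc_mono _ hδ hz)
  a_sub Δ hΔ z hz := d.a_sub Δ (hΔ.trans_le hc) z (lowerHalfDisc_mono _ hδ hz)
  S_sub Δ hΔ z hz := d.S_sub Δ (hΔ.trans_le hc) z (lowerHalfDisc_mono _ hδ hz)
  S'_sub Δ hΔ z hz := d.S'_sub Δ (hΔ.trans_le hc) z (lowerHalfDisc_mono _ hδ hz)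

variable (d : LevelDiagonalization b Δ₀ α δ c K)

/-- The left factor of the numerator of the `j`-th singular part of `⟨φ, R_z ψ⟩`. -/
noncomputable def left (φ : H) (Δ : ℝ) (z : ℂ) (j : Fin m) : ℂ :=
  ∑ i, (inner ℂ φ (b.vec i) - Δ * inner ℂ φ (reducedResolvent (perturbed L₀ W Δ)
    (eigenspace L₀ e) z (boundedComp W (eigProj L₀ e) (b.vec i)))) * d.S Δ z i j

/-- The right factor of the numerator of the `j`-th singular part of `⟨φ, R_z ψ⟩`. -/
noncomputable def right (ψ : H) (Δ : ℝ) (z : ℂ) (j : Fin m) : ℂ :=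
  ∑ k, d.S' Δ z j k * (inner ℂ (b.dual k) ψ - Δ * inner ℂ (boundedComp W (eigProj L₀ e) (b.dual k))
    (reducedResolvent (perturbed L₀ W Δ) (eigenspace L₀ e) z ψ))

/-- The denominator of the `j`-th singular part of `⟨φ, R_z ψ⟩`. -/
def denom (Δ : ℝ) (z : ℂ) (j : Fin m) : ℂ := e - z + (Δ ^ 2 : ℝ) * d.a Δ z j

theorem inv_mul_mat {Δ : ℝ} (hΔ : |Δ| < c) {z : ℂ} (hz : z ∈ lowerHalfDisc e δ) :
    d.S' Δ z * b.mat Δ z = Matrix.diagonal (d.a Δ z) * d.S' Δ z := by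
  calc d.S' Δ z * b.mat Δ z = d.S' Δ z * (b.mat Δ z * d.S Δ z) * d.S' Δ z := by
        rw [Matrix.mul_assoc, Matrix.mul_assoc, d.mul_inv Δ hΔ z hz, Matrix.mul_one]
    _ = (d.S' Δ z * d.S Δ z) * Matrix.diagonal (d.a Δ z) * d.S' Δ z := by
        rw [d.mat_mul Δ hΔ z hz]; simp only [Matrix.mul_assoc]
    _ = _ := by rw [d.inv_mul Δ hΔ z hz, Matrix.one_mul]

/-- Multiplying the Feshbach system by S' decouples it, since S'M = diag(a)S'. Each new coordinate
satisfies a scalar equation. -/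
theorem denom_mul (h : ResonanceAssumptions L₀ W Δ₀ α D stab unst E lam)
    (he : e ∈ stab ∪ unst) {Δ : ℝ} (hΔ : |Δ| < c) {z : ℂ} (hz : z ∈ lowerHalfDisc e δ) {u : H}
    (hu : u ∈ (perturbed L₀ W Δ).domain) (j : Fin m) :
    d.denom Δ z j * ∑ k, d.S' Δ z j k * inner ℂ (b.dual k) u =
      d.right (perturbed L₀ W Δ ⟨u, hu⟩ - z • u) Δ z j := by
  have h1 := b.feshbach_equation h he (hΔ.le.trans d.c_le) hz.1.ne hu
  have h2 : ∑ k, d.S' Δ z j k * ∑ l, b.mat Δ z k l * inner ℂ (b.dual l) u =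
      d.a Δ z j * ∑ k, d.S' Δ z j k * inner ℂ (b.dual k) u := by
    have h3 := congrFun (congrArg (fun M => M.mulVec fun k => inner ℂ (b.dual k) u)
      (d.inv_mul_mat hΔ hz)) j
    simp only [← Matrix.mulVec_mulVec, Matrix.mulVec_diagonal] at h3
    exact h3
  rw [right]
  simp only [← h1, mul_add, Finset.sum_add_distrib]
  have h4 : ∑ k, d.S' Δ z j k * (Δ ^ 2 * ∑ l, b.mat Δ z k l * inner ℂ (b.dual l) u) =
      Δ ^ 2 * ∑ k, d.S' Δ z j k * ∑ l, b.mat Δ z k l * inner ℂ (b.dual l) u := by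
    rw [Finset.mul_sum]
    exact Finset.sum_congr rfl fun k _ => by ring
  have h5 : ∑ k, d.S' Δ z j k * ((e - z) * inner ℂ (b.dual k) u) =
      (e - z) * ∑ k, d.S' Δ z j k * inner ℂ (b.dual k) u := by
    rw [Finset.mul_sum]
    exact Finset.sum_congr rfl fun k _ => by ring
  rw [h4, h5, h2, denom]
  push_cast
  ring

theorem inner_dual_eq {Δ : ℝ} (hΔ : |Δ| < c) {z : ℂ} (hz : z ∈ lowerHalfDisc e δ) (u : H)
    (i : Fin m) : inner ℂ (b.dual i) u =
      ∑ j, d.S Δ z i j * ∑ k, d.S' Δ z j k * inner ℂ (b.dual k) u := by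
  have h3 := congrFun (congrArg (fun M => M.mulVec fun k => inner ℂ (b.dual k) u)
    (d.mul_inv Δ hΔ z hz)) i
  simp only [← Matrix.mulVec_mulVec, Matrix.one_mulVec] at h3
  exact h3.symm

/-- Solving the scalar equations and returning through S isolates all singular behaviour near e in
the quotients with denominators e - z + Δ²a_j(z). -/
theorem inner_resolvent (h : ResonanceAssumptions L₀ W Δ₀ α D stab unst E lam)
    (he : e ∈ stab ∪ unst) {Δ : ℝ} (hΔ : |Δ| < c) {z : ℂ} (hz : z ∈ lowerHalfDisc e δ)
    (hne : ∀ j, d.denom Δ z j ≠ 0) (φ ψ : H) :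
    inner ℂ φ (resolvent (perturbed L₀ W Δ) z ψ) =
      inner ℂ φ (reducedResolvent (perturbed L₀ W Δ) (eigenspace L₀ e) z ψ) +
        ∑ j, d.left φ Δ z j * d.right ψ Δ z j / d.denom Δ z j := by
  obtain ⟨hu, e1⟩ := (isResolvent_resolvent (h.selfAdjoint Δ (hΔ.le.trans d.c_le)) hz.1.ne).1 ψ
  have h1 := b.inner_eq h he (hΔ.le.trans d.c_le) hz.1.ne hu φ
  have h2 : ∀ j, ∑ k, d.S' Δ z j k * inner ℂ (b.dual k) (resolvent (perturbed L₀ W Δ) z ψ) =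
      d.right ψ Δ z j / d.denom Δ z j := fun j => by
    rw [eq_div_iff (hne j), mul_comm, d.denom_mul h he hΔ hz hu j, e1]
  rw [h1, e1]
  congr 1
  have h3 : ∀ i, inner ℂ (b.dual i) (resolvent (perturbed L₀ W Δ) z ψ) =
      ∑ j, d.S Δ z i j * (d.right ψ Δ z j / d.denom Δ z j) := fun i => by
    rw [d.inner_dual_eq hΔ hz]
    exact Finset.sum_congr rfl fun j _ => by rw [h2]
  simp only [left, Finset.sum_mul, Finset.sum_div]
  rw [Finset.sum_comm]
  refine Finset.sum_congr rfl fun i _ => ?_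
  rw [h3, Finset.mul_sum]
  exact Finset.sum_congr rfl fun j _ => by ring

theorem unifBddDeriv_coupling {s : Set ℝ} (hs : ∀ Δ ∈ s, |Δ| < c) (Ω : Set ℂ) :
    UnifBddDeriv 3 s Ω fun Δ _ => (Δ : ℂ) :=
  unifBddDeriv_const (C := c) fun Δ hΔ => by
    rw [Complex.norm_real]; exact (hs Δ hΔ).le

theorem unifBddDeriv_left (h : ResonanceAssumptions L₀ W Δ₀ α D stab unst E lam)
    (he : e ∈ stab ∪ unst) {φ : H} (hφ : φ ∈ Submodule.span ℂ D) (j : Fin m) :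
    UnifBddDeriv 3 {Δ : ℝ | |Δ| < c} (lowerHalfDisc e δ) fun Δ z => d.left φ Δ z j := by
  have ho := isOpen_lowerHalfDisc (e : ℂ) δ
  refine UnifBddDeriv.sum ho _ fun i _ => UnifBddDeriv.mul ho ?_ (d.bdd_S i j)
  have h1 := (h.unifBddDeriv_disc he hφ (Submodule.subset_span
    (h.boundedComp_mem he (b.vec_mem i)))).mono (m := 3) le_rfl
    (s' := {Δ : ℝ | |Δ| < c}) (fun Δ hΔ => le_trans (le_of_lt hΔ) d.c_le)
    (lowerHalfDisc_mono (e : ℂ) d.δ_le)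
  have h2 := (unifBddDeriv_const_self (ι := ℝ) (inner ℂ φ (b.vec i))).add ho
    ((unifBddDeriv_const_self (-1)).mul ho
      ((unifBddDeriv_coupling (s := {Δ : ℝ | |Δ| < c}) (fun _ h => h) _).mul ho h1))
  exact h2.congr ho fun Δ _ z _ => by ring

theorem unifBddDeriv_right (h : ResonanceAssumptions L₀ W Δ₀ α D stab unst E lam)
    (he : e ∈ stab ∪ unst) {ψ : H} (hψ : ψ ∈ Submodule.span ℂ D) (j : Fin m) :
    UnifBddDeriv 3 {Δ : ℝ | |Δ| < c} (lowerHalfDisc e δ) fun Δ z => d.right ψ Δ z j := by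
  have ho := isOpen_lowerHalfDisc (e : ℂ) δ
  refine UnifBddDeriv.sum ho _ fun i _ => UnifBddDeriv.mul ho (d.bdd_S' j i) ?_
  have h1 := (h.unifBddDeriv_disc he (Submodule.subset_span
    (h.boundedComp_mem he (b.dual_mem i))) hψ).mono (m := 3) le_rfl
    (s' := {Δ : ℝ | |Δ| < c}) (fun Δ hΔ => le_trans (le_of_lt hΔ) d.c_le)
    (lowerHalfDisc_mono (e : ℂ) d.δ_le)
  have h2 := (unifBddDeriv_const_self (ι := ℝ) (inner ℂ (b.dual i) ψ)).add ho
    ((unifBddDeriv_const_self (-1)).mul ho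
      ((unifBddDeriv_coupling (s := {Δ : ℝ | |Δ| < c}) (fun _ h => h) _).mul ho h1))
  exact h2.congr ho fun Δ _ z _ => by ring

theorem norm_left_sub_le (h : ResonanceAssumptions L₀ W Δ₀ α D stab unst E lam)
    (he : e ∈ stab ∪ unst) {φ : H} (hφ : φ ∈ Submodule.span ℂ D) :
    ∃ C, 0 ≤ C ∧ ∀ Δ, |Δ| < c → ∀ z ∈ lowerHalfDisc e δ, ∀ j,
      ‖d.left φ Δ z j - inner ℂ φ (b.vec j)‖ ≤ C * (|Δ| + ‖z - e‖) := by
  have h1 : ∀ i, ∃ C, 0 ≤ C ∧ ∀ Δ, |Δ| < c → ∀ z ∈ lowerHalfDisc e δ,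
      ‖inner ℂ φ (reducedResolvent (perturbed L₀ W Δ)
        (eigenspace L₀ e) z (boundedComp W (eigProj L₀ e) (b.vec i)))‖ ≤ C := fun i => by
    obtain ⟨C, hC⟩ := h.unifBddDeriv_disc he hφ (Submodule.subset_span
      (h.boundedComp_mem he (b.vec_mem i)))
    refine ⟨|C|, abs_nonneg _, fun Δ hΔ z hz => ?_⟩
    have := (hC Δ (hΔ.le.trans d.c_le)).2 0 (by omega) z (lowerHalfDisc_mono (e : ℂ) d.δ_le hz)
    rw [iteratedDeriv_zero] at this
    exact this.trans (le_abs_self C)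
  choose C hC0 hC using h1
  have hCs : ∀ i, C i ≤ ∑ i, C i := fun i =>
    Finset.single_le_sum (fun i _ => hC0 i) (Finset.mem_univ i)
  have hVs : ∀ i, ‖inner ℂ φ (b.vec i)‖ ≤ ∑ i, ‖inner ℂ φ (b.vec i)‖ := fun i =>
    Finset.single_le_sum (f := fun i => ‖inner ℂ φ (b.vec i)‖) (fun i _ => norm_nonneg _)
      (Finset.mem_univ i)
  refine ⟨|m * ((∑ i, ‖inner ℂ φ (b.vec i)‖ + c * ∑ i, C i) * K) + ∑ i, C i|, abs_nonneg _,
    fun Δ hΔ z hz j => ?_⟩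
  have hs0 : 0 ≤ ∑ i, C i := Finset.sum_nonneg fun i _ => hC0 i
  refine (norm_sum_sub_le (x' := fun i => inner ℂ φ (b.vec i)) (M := ∑ i, C i)
    (B := ∑ i, ‖inner ℂ φ (b.vec i)‖ + c * ∑ i, C i)
    (fun i => ?_) (fun i => ?_) (fun i => d.S_sub Δ hΔ z hz i j)).trans ?_
  · refine (norm_sub_le _ _).trans (add_le_add (hVs i) ?_)
    rw [norm_mul, Complex.norm_real]
    exact mul_le_mul hΔ.le ((hC i Δ hΔ z hz).trans (hCs i)) (norm_nonneg _) d.c_pos.le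
  · rw [sub_sub_cancel_left, norm_neg, norm_mul, Complex.norm_real, Real.norm_eq_abs, mul_comm]
    exact mul_le_mul ((hC i Δ hΔ z hz).trans (hCs i)) (by linarith [norm_nonneg (z - e)])
      (abs_nonneg _) hs0
  · exact mul_le_mul_of_nonneg_right (le_abs_self _) (by positivity)

theorem norm_right_sub_le (h : ResonanceAssumptions L₀ W Δ₀ α D stab unst E lam)
    (he : e ∈ stab ∪ unst) {ψ : H} (hψ : ψ ∈ Submodule.span ℂ D) :
    ∃ C, 0 ≤ C ∧ ∀ Δ, |Δ| < c → ∀ z ∈ lowerHalfDisc e δ, ∀ j,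
      ‖d.right ψ Δ z j - inner ℂ (b.dual j) ψ‖ ≤ C * (|Δ| + ‖z - e‖) := by
  have h1 : ∀ i, ∃ C, 0 ≤ C ∧ ∀ Δ, |Δ| < c → ∀ z ∈ lowerHalfDisc e δ,
      ‖inner ℂ (boundedComp W (eigProj L₀ e) (b.dual i)) (reducedResolvent (perturbed L₀ W Δ)
        (eigenspace L₀ e) z ψ)‖ ≤ C := fun i => by
    obtain ⟨C, hC⟩ := h.unifBddDeriv_disc he (Submodule.subset_span
      (h.boundedComp_mem he (b.dual_mem i))) hψ
    refine ⟨|C|, abs_nonneg _, fun Δ hΔ z hz => ?_⟩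
    have := (hC Δ (hΔ.le.trans d.c_le)).2 0 (by omega) z (lowerHalfDisc_mono (e : ℂ) d.δ_le hz)
    rw [iteratedDeriv_zero] at this
    exact this.trans (le_abs_self C)
  choose C hC0 hC using h1
  have hCs : ∀ i, C i ≤ ∑ i, C i := fun i =>
    Finset.single_le_sum (fun i _ => hC0 i) (Finset.mem_univ i)
  have hVs : ∀ i, ‖inner ℂ (b.dual i) ψ‖ ≤ ∑ i, ‖inner ℂ (b.dual i) ψ‖ := fun i =>
    Finset.single_le_sum (f := fun i => ‖inner ℂ (b.dual i) ψ‖) (fun i _ => norm_nonneg _)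
      (Finset.mem_univ i)
  refine ⟨|m * ((∑ i, ‖inner ℂ (b.dual i) ψ‖ + c * ∑ i, C i) * K) + ∑ i, C i|, abs_nonneg _,
    fun Δ hΔ z hz j => ?_⟩
  have hs0 : 0 ≤ ∑ i, C i := Finset.sum_nonneg fun i _ => hC0 i
  rw [right]
  simp only [mul_comm (d.S' Δ z j _)]
  refine (norm_sum_sub_le (x' := fun i => inner ℂ (b.dual i) ψ) (M := ∑ i, C i) (K := K)
    (κ := |Δ| + ‖z - e‖) (B := ∑ i, ‖inner ℂ (b.dual i) ψ‖ + c * ∑ i, C i)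
    (fun i => ?_) (fun i => ?_) (fun i => ?_)).trans ?_
  · refine (norm_sub_le _ _).trans (add_le_add (hVs i) ?_)
    rw [norm_mul, Complex.norm_real]
    exact mul_le_mul hΔ.le ((hC i Δ hΔ z hz).trans (hCs i)) (norm_nonneg _) d.c_pos.le
  · rw [sub_sub_cancel_left, norm_neg, norm_mul, Complex.norm_real, Real.norm_eq_abs, mul_comm]
    exact mul_le_mul ((hC i Δ hΔ z hz).trans (hCs i)) (by linarith [norm_nonneg (z - e)])
      (abs_nonneg _) hs0
  · have := d.S'_sub Δ hΔ z hz j i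
    have h9 : (1 : Matrix (Fin m) (Fin m) ℂ) j i = (1 : Matrix (Fin m) (Fin m) ℂ) i j := by
      simp [Matrix.one_apply, eq_comm]
    rwa [h9] at this
  · exact mul_le_mul_of_nonneg_right (le_abs_self _) (by positivity)

/-- At Δ = 0, z → e the left and right factors tend to ⟨φ, v_j⟩ and ⟨d_j, ψ⟩, for the basis vector
v_j and its dual d_j. The limit of the product is thus the matrix element of the spectral projection
of Λ_e. -/
theorem norm_left_mul_right_sub_le (h : ResonanceAssumptions L₀ W Δ₀ α D stab unst E lam)
    (he : e ∈ stab ∪ unst) {φ ψ : H} (hφ : φ ∈ Submodule.span ℂ D)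
    (hψ : ψ ∈ Submodule.span ℂ D) :
    ∃ C, ∀ Δ, |Δ| < c → ∀ z ∈ lowerHalfDisc e δ, ∀ j,
      ‖d.left φ Δ z j * d.right ψ Δ z j - inner ℂ φ (b.vec j) * inner ℂ (b.dual j) ψ‖ ≤
        C * (|Δ| + ‖z - e‖) := by
  obtain ⟨C, hC0, hC⟩ := d.norm_left_sub_le h he hφ
  obtain ⟨C', hC0', hC'⟩ := d.norm_right_sub_le h he hψ
  have hVs : ∀ i, ‖inner ℂ φ (b.vec i)‖ ≤ ∑ i, ‖inner ℂ φ (b.vec i)‖ := fun i =>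
    Finset.single_le_sum (f := fun i => ‖inner ℂ φ (b.vec i)‖) (fun i _ => norm_nonneg _)
      (Finset.mem_univ i)
  have hVs' : ∀ i, ‖inner ℂ (b.dual i) ψ‖ ≤ ∑ i, ‖inner ℂ (b.dual i) ψ‖ := fun i =>
    Finset.single_le_sum (f := fun i => ‖inner ℂ (b.dual i) ψ‖) (fun i _ => norm_nonneg _)
      (Finset.mem_univ i)
  refine ⟨C * (∑ i, ‖inner ℂ (b.dual i) ψ‖ + C' * (c + δ)) + (∑ i, ‖inner ℂ φ (b.vec i)‖) * C',
    fun Δ hΔ z hz j => ?_⟩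
  have h1 : d.left φ Δ z j * d.right ψ Δ z j - inner ℂ φ (b.vec j) * inner ℂ (b.dual j) ψ =
      (d.left φ Δ z j - inner ℂ φ (b.vec j)) *
        (inner ℂ (b.dual j) ψ + (d.right ψ Δ z j - inner ℂ (b.dual j) ψ)) +
      inner ℂ φ (b.vec j) * (d.right ψ Δ z j - inner ℂ (b.dual j) ψ) := by ring
  have hκ : |Δ| + ‖z - e‖ ≤ c + δ := add_le_add hΔ.le hz.2.le
  have h2 : ‖inner ℂ (b.dual j) ψ + (d.right ψ Δ z j - inner ℂ (b.dual j) ψ)‖ ≤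
      ∑ i, ‖inner ℂ (b.dual i) ψ‖ + C' * (c + δ) :=
    (norm_add_le _ _).trans (add_le_add (hVs' j) ((hC' Δ hΔ z hz j).trans (by gcongr)))
  rw [h1]
  refine (norm_add_le _ _).trans ?_
  rw [norm_mul, norm_mul]
  calc _ ≤ C * (|Δ| + ‖z - e‖) * (∑ i, ‖inner ℂ (b.dual i) ψ‖ + C' * (c + δ)) +
        (∑ i, ‖inner ℂ φ (b.vec i)‖) * (C' * (|Δ| + ‖z - e‖)) :=
        add_le_add (mul_le_mul (hC Δ hΔ z hz j) h2 (norm_nonneg _) (by positivity))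
          (mul_le_mul (hVs j) (hC' Δ hΔ z hz j) (norm_nonneg _)
            (Finset.sum_nonneg fun _ _ => norm_nonneg _))
    _ = _ := by ring

end LevelDiagonalization

/-- Limits of sesquilinear forms are sesquilinear. -/
theorem exists_sesq_limit {V : Type*} [AddCommGroup V] [Module ℂ V] {l : Filter ℂ} [l.NeBot]
    (F : V → V → ℂ → ℂ) (hlim : ∀ v w, ∃ c, Tendsto (F v w) l (𝓝 c))
    (h1 : ∀ v v' w z, F (v + v') w z = F v w z + F v' w z)
    (h2 : ∀ a v w z, F (a • v) w z = starRingEnd ℂ a * F v w z)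
    (h3 : ∀ v w w' z, F v (w + w') z = F v w z + F v w' z)
    (h4 : ∀ a v w z, F v (a • w) z = a * F v w z) :
    ∃ Q : V →ₗ⋆[ℂ] V →ₗ[ℂ] ℂ, ∀ v w, Tendsto (F v w) l (𝓝 (Q v w)) := by
  choose q hq using hlim
  refine ⟨LinearMap.mk₂'ₛₗ (starRingEnd ℂ) (RingHom.id ℂ) q (fun v v' w => ?_) (fun a v w => ?_)
    (fun v w w' => ?_) (fun a v w => ?_), fun v w => hq v w⟩
  · refine tendsto_nhds_unique (hq _ _) (((hq v w).add (hq v' w)).congr fun z => (h1 _ _ _ _).symm)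
  · refine tendsto_nhds_unique (hq _ _) (((hq v w).const_mul _).congr fun z => (h2 _ _ _ _).symm)
  · refine tendsto_nhds_unique (hq _ _) (((hq v w).add (hq v w')).congr fun z => (h3 _ _ _ _).symm)
  · refine tendsto_nhds_unique (hq _ _) (((hq v w).const_mul _).congr fun z => (h4 _ _ _ _).symm)

end LocalDiagonalization

/-! ### Real poles, eigenvalues and residues. -/

section Poles

set_option linter.unusedSectionVars false

theorem tendsto_zero_of_norm_le_mul {l : Filter ℝ} {f g : ℝ → ℂ} {C : ℝ}
    (hf : ∀ᶠ ε in l, ‖f ε‖ ≤ C) (hg : Tendsto g l (𝓝 0)) :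
    Tendsto (fun ε => f ε * g ε) l (𝓝 0) := by
  rw [tendsto_zero_iff_norm_tendsto_zero] at hg ⊢
  have h1 := hg.const_mul C
  rw [mul_zero] at h1
  refine squeeze_zero' (Eventually.of_forall fun _ => norm_nonneg _) ?_ h1
  filter_upwards [hf] with ε hε
  rw [norm_mul]
  exact mul_le_mul_of_nonneg_right hε (norm_nonneg _)

theorem tendsto_sum_zero {l : Filter ℝ} {n : ℕ} {f : Fin n → ℝ → ℂ}
    (hf : ∀ j, Tendsto (f j) l (𝓝 0)) : Tendsto (fun ε => ∑ j, f j ε) l (𝓝 0) := by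
  simpa using tendsto_finsetSum Finset.univ fun j _ => hf j

theorem UnifBddDeriv.exists_nonneg_bound {ι : Type*} {n : ℕ} {s : Set ι} {Ω : Set ℂ}
    {f : ι → ℂ → ℂ} (hf : UnifBddDeriv n s Ω f) : ∃ C, 0 ≤ C ∧ ∀ i ∈ s,
      DifferentiableOn ℂ (f i) Ω ∧ ∀ k ≤ n, ∀ z ∈ Ω, ‖iteratedDeriv k (f i) z‖ ≤ C := by
  obtain ⟨C, hC⟩ := hf
  exact ⟨|C|, abs_nonneg _, fun i hi => ⟨(hC i hi).1, fun k hk z hz =>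
    ((hC i hi).2 k hk z hz).trans (le_abs_self _)⟩⟩

theorem tendsto_I_mul_nhdsGT : Tendsto (fun ε : ℝ => Complex.I * ε) (𝓝[>] 0) (𝓝 0) := by
  have : Continuous fun ε : ℝ => Complex.I * ε := by fun_prop
  have h1 := (this.tendsto 0).mono_left (nhdsWithin_le_nhds (s := Set.Ioi (0 : ℝ)))
  simpa using h1

theorem eventually_vertical_mem {e : ℂ} {δ : ℝ} {p : ℝ} (hp : ‖(p : ℂ) - e‖ < δ) :
    ∀ᶠ ε : ℝ in 𝓝[>] 0, (p - Complex.I * ε : ℂ) ∈ lowerHalfDisc e δ :=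
  (tendsto_vertical e hp).eventually self_mem_nhdsWithin

variable {H : Type*} [NormedAddCommGroup H] [InnerProductSpace ℂ H] [CompleteSpace H]
  {L₀ W : H →ₗ.[ℂ] H} {Δ₀ α : ℝ} {D : Set H} {stab unst : Finset ℝ} {E : ℝ → ℝ → ℝ}
  {lam : ℝ → ℕ → ℂ} {e : ℝ} {m : ℕ}

namespace LevelDiagonalization

variable {b : LevelBasis L₀ W lam e m} {δ c K : ℝ} (d : LevelDiagonalization b Δ₀ α δ c K)

theorem exists_tendsto_of_unifBddDeriv {f : ℝ → ℂ → ℂ}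
    (hf : UnifBddDeriv 3 {Δ : ℝ | |Δ| < c} (lowerHalfDisc e δ) f) {p : ℝ}
    (hp : ‖(p : ℂ) - e‖ < δ) {Δ : ℝ} (hΔ : |Δ| < c) :
    ∃ A, Tendsto (f Δ) (𝓝[lowerHalfDisc e δ] p) (𝓝 A) := by
  obtain ⟨C, hC0, hC⟩ := hf.exists_nonneg_bound
  obtain ⟨A, -, hA⟩ := boundary_taylor_one (isOpen_lowerHalfDisc _ _) (convex_lowerHalfDisc _ _)
    (mem_closure_lowerHalfDisc (e : ℂ) hp) (hC Δ hΔ).1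
    (fun k hk z hz => (hC Δ hΔ).2 k (by omega) z hz) hC0
  exact ⟨A, tendsto_of_norm_sub_le (C := C) 0 fun z hz => by
    simpa only [zero_add, pow_one] using hA z hz⟩

/-- In the imaginary part of the denominator, -Im z is nonnegative, so it only adds to Δ² Im a_j. -/
theorem mul_le_norm_denom {γ : ℝ} {Δ : ℝ} {z : ℂ} (hz : z.im ≤ 0) {j : Fin m}
    (hj : γ ≤ (d.a Δ z j).im) : Δ ^ 2 * γ ≤ ‖d.denom Δ z j‖ := by
  have h1 : (d.denom Δ z j).im = -z.im + Δ ^ 2 * (d.a Δ z j).im := by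
    rw [denom, Complex.add_im, Complex.sub_im, Complex.im_ofReal_mul, Complex.ofReal_im, zero_sub]
  have h2 := Complex.abs_im_le_norm (d.denom Δ z j)
  have h3 := le_abs_self (d.denom Δ z j).im
  nlinarith [mul_le_mul_of_nonneg_left hj (sq_nonneg Δ)]

theorem right_smul (k : ℂ) (ψ : H) (Δ : ℝ) (z : ℂ) (j : Fin m) :
    d.right (k • ψ) Δ z j = ∑ l, d.S' Δ z j l * (k * inner ℂ (b.dual l) ψ -
      Δ * (k * inner ℂ (boundedComp W (eigProj L₀ e) (b.dual l))
        (reducedResolvent (perturbed L₀ W Δ) (eigenspace L₀ e) z ψ))) := by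
  simp only [right, map_smul, inner_smul_right]

theorem inner_eigenvector_sub {A : H →ₗ.[ℂ] H} {x : ℝ} {χ : H} (hχ : χ ∈ eigenspace A x) (ε : ℝ) :
    ∃ hu : χ ∈ A.domain, A ⟨χ, hu⟩ - ((x : ℂ) - Complex.I * ε) • χ = (Complex.I * ε) • χ := by
  obtain ⟨hu, e1⟩ := hχ
  exact ⟨hu, by rw [e1, ← sub_smul, sub_sub_cancel]⟩

/-- Limiting absorption excludes eigenvalues of the compressed operator in the strip. Hence the
rescaled reduced resolvent contributes nothing to a residue. -/
theorem tendsto_mul_inner_reducedResolvent (h : ResonanceAssumptions L₀ W Δ₀ α D stab unst E lam)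
    (he : e ∈ stab ∪ unst) {Δ : ℝ} (hΔ : |Δ| ≤ Δ₀) {x : ℝ} (hx : |x - e| < α) (φ ψ : H) :
    Tendsto (fun ε : ℝ => (Complex.I * ε) * inner ℂ φ (reducedResolvent (perturbed L₀ W Δ)
      (eigenspace L₀ e) (x - Complex.I * ε) ψ)) (𝓝[>] 0) (𝓝 0) := by
  have := h.finiteDimensional e
  have h1 := tendsto_mul_inner_zero (D := D) (T := fun ε : ℝ => reducedResolvent (perturbed L₀ W Δ)
      (eigenspace L₀ e) (x - Complex.I * ε)) (fun ε hε y => ?_) h.absorption.dense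
      (fun φ hφ ψ hψ => ?_) φ ψ
  · have h2 := h1.const_mul Complex.I
    rw [mul_zero] at h2
    exact h2.congr fun ε => by ring
  · have hz : ((x : ℂ) - Complex.I * ε).im ≠ 0 := by simpa using hε.ne'
    have h3 := norm_reducedResolvent_apply_le (h.selfAdjoint Δ hΔ) (h.eigenspace_le_domain he Δ) hz y
    simpa [abs_of_pos hε] using h3
  · obtain ⟨C, hC⟩ := h.unifBddDeriv_strip he hφ hψ
    refine ⟨C, fun ε hε => ?_⟩
    have h3 := (hC Δ hΔ).2 0 (by omega) (x - Complex.I * ε) ⟨by simpa using hε, by simpa using hx.le⟩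
    simpa only [iteratedDeriv_zero] using h3

/-- The poles on the real axis are the eigenvalues. -/
theorem denom_eigenvalue (h : ResonanceAssumptions L₀ W Δ₀ α D stab unst E lam)
    (he : e ∈ stab ∪ unst) {γ : ℝ} (hγ : 0 < γ) {j₀ : Fin m} {Δ : ℝ} (hΔ0 : Δ ≠ 0) (hΔ : |Δ| < c)
    (hj : ∀ j ≠ j₀, ∀ z ∈ lowerHalfDisc e δ, γ ≤ (d.a Δ z j).im) {x : ℝ} (hx : |x - e| < δ)
    (hev : IsEigenvalue (perturbed L₀ W Δ) x) {A : ℂ}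
    (hA : Tendsto (fun z => d.a Δ z j₀) (𝓝[lowerHalfDisc e δ] x) (𝓝 A)) :
    (e : ℂ) - x + (Δ ^ 2 : ℝ) * A = 0 := by
  -- If the limit of the denominator with index j₀ were nonzero, all denominators would stay away
  -- from 0 along x - iε. An eigenvector χ satisfies (L - z)χ = iεχ there, so the right sides of the
  -- scalar equations tend to 0. Then the coordinates of χ vanish, and the reconstruction formula
  -- forces χ = 0.
  by_contra hG
  obtain ⟨χ, hχ, hχ0⟩ := Submodule.exists_mem_ne_zero_of_ne_bot hev
  have hp : ‖(x : ℂ) - e‖ < δ := by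
    rw [← Complex.ofReal_sub, Complex.norm_real]; exact hx
  have hmem := eventually_vertical_mem hp
  have hΔ' : |Δ| ≤ Δ₀ := hΔ.le.trans d.c_le
  have hT := fun φ ψ => tendsto_mul_inner_reducedResolvent h he hΔ' (hx.trans_le d.δ_le) φ ψ
  have hbd : ∀ {f : ℝ → ℂ → ℂ}, UnifBddDeriv 3 {Δ : ℝ | |Δ| < c} (lowerHalfDisc e δ) f →
      ∃ C, ∀ᶠ ε : ℝ in 𝓝[>] 0, ‖f Δ (x - Complex.I * ε)‖ ≤ C := fun hf => by
    obtain ⟨C, -, hC⟩ := hf.exists_nonneg_bound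
    refine ⟨C, ?_⟩
    filter_upwards [hmem] with ε hε
    have := (hC Δ hΔ).2 0 (by omega) _ hε
    rwa [iteratedDeriv_zero] at this
  have hright : ∀ j, Tendsto (fun ε : ℝ => d.right ((Complex.I * ε) • χ) Δ (x - Complex.I * ε) j)
      (𝓝[>] 0) (𝓝 0) := fun j => by
    simp only [right_smul]
    refine tendsto_sum_zero fun l => ?_
    obtain ⟨C, hC⟩ := hbd (d.bdd_S' j l)
    refine tendsto_zero_of_norm_le_mul hC ?_
    have h1 := (tendsto_I_mul_nhdsGT.mul_const (inner ℂ (b.dual l) χ)).sub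
      ((hT (boundedComp W (eigProj L₀ e) (b.dual l)) χ).const_mul (Δ : ℂ))
    simpa only [zero_mul, mul_zero, sub_zero] using h1
  have hlow : ∀ j, ∃ ρ > 0, ∀ᶠ ε : ℝ in 𝓝[>] 0, ρ ≤ ‖d.denom Δ (x - Complex.I * ε) j‖ := fun j => by
    by_cases hjj : j = j₀
    · subst hjj
      have h1 : Tendsto (fun ε : ℝ => d.denom Δ (x - Complex.I * ε) j) (𝓝[>] 0)
          (𝓝 ((e : ℂ) - (x - 0) + (Δ ^ 2 : ℝ) * A)) :=
        (tendsto_const_nhds.sub (tendsto_const_nhds.sub tendsto_I_mul_nhdsGT)).add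
          ((hA.comp (tendsto_vertical (e : ℂ) hp)).const_mul _)
      rw [sub_zero] at h1
      have h2 : ‖(e : ℂ) - x + (Δ ^ 2 : ℝ) * A‖ / 2 < ‖(e : ℂ) - x + (Δ ^ 2 : ℝ) * A‖ :=
        half_lt_self (norm_pos_iff.mpr hG)
      exact ⟨_, half_pos (norm_pos_iff.mpr hG),
        (h1.norm.eventually_const_lt h2).mono fun _ h => h.le⟩
    · refine ⟨Δ ^ 2 * γ, by positivity, ?_⟩
      filter_upwards [hmem] with ε hε
      exact d.mul_le_norm_denom hε.1.le (hj j hjj _ hε)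
  have hcoord : ∀ j, Tendsto (fun ε : ℝ => ∑ k, d.S' Δ (x - Complex.I * ε) j k *
      inner ℂ (b.dual k) χ) (𝓝[>] 0) (𝓝 0) := fun j => by
    obtain ⟨ρ, hρ, hlow'⟩ := hlow j
    refine (tendsto_zero_of_norm_le_mul (f := fun ε : ℝ => (d.denom Δ (x - Complex.I * ε) j)⁻¹)
      (C := ρ⁻¹) ?_ (hright j)).congr' ?_
    · filter_upwards [hlow'] with ε hε
      rw [norm_inv]
      exact inv_anti₀ hρ hε
    · filter_upwards [hmem, hlow'] with ε hε hε'
      obtain ⟨hu, e1⟩ := inner_eigenvector_sub hχ ε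
      have h1 := d.denom_mul h he hΔ hε hu j
      rw [e1] at h1
      have h2 : d.denom Δ (x - Complex.I * ε) j ≠ 0 := norm_pos_iff.mp (hρ.trans_le hε')
      rw [← h1, inv_mul_cancel_left₀ h2]
  have hx0 : ∀ i, inner ℂ (b.dual i) χ = 0 := fun i => by
    have h1 : Tendsto (fun ε : ℝ => ∑ j, d.S Δ (x - Complex.I * ε) i j *
        ∑ k, d.S' Δ (x - Complex.I * ε) j k * inner ℂ (b.dual k) χ) (𝓝[>] 0) (𝓝 0) := by
      refine tendsto_sum_zero fun j => ?_
      obtain ⟨C, hC⟩ := hbd (d.bdd_S i j)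
      exact tendsto_zero_of_norm_le_mul hC (hcoord j)
    refine tendsto_nhds_unique tendsto_const_nhds (h1.congr' ?_)
    filter_upwards [hmem] with ε hε
    exact (d.inner_dual_eq hΔ hε χ i).symm
  refine hχ0 (ext_inner_left ℂ fun φ => ?_)
  rw [inner_zero_right]
  refine tendsto_nhds_unique tendsto_const_nhds ((hT φ χ).congr' ?_)
  filter_upwards [hmem] with ε hε
  obtain ⟨hu, e1⟩ := inner_eigenvector_sub hχ ε
  have h1 := b.inner_eq h he hΔ' hε.1.ne hu φ
  rw [e1] at h1
  simp only [hx0, mul_zero, Finset.sum_const_zero, add_zero, map_smul, inner_smul_right] at h1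
  exact h1.symm

/-- The residue of `⟨φ, R_z ψ⟩` at a pole on the real axis. -/
theorem inner_eigProj_eq (h : ResonanceAssumptions L₀ W Δ₀ α D stab unst E lam)
    (he : e ∈ stab ∪ unst) {γ : ℝ} (hγ : 0 < γ) {j₀ : Fin m} {Δ : ℝ} (hΔ0 : Δ ≠ 0) (hΔ : |Δ| < c)
    (hj : ∀ j ≠ j₀, ∀ z ∈ lowerHalfDisc e δ, γ ≤ (d.a Δ z j).im) {x : ℝ} (hx : |x - e| < δ)
    {φ ψ : H} (hφ : φ ∈ Submodule.span ℂ D) (hψ : ψ ∈ Submodule.span ℂ D) {g₁ q₀ : ℂ} {C : ℝ}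
    (hg₁ : g₁ ≠ 0)
    (hg : ∀ z ∈ lowerHalfDisc e δ, ‖d.denom Δ z j₀ - g₁ * (z - x)‖ ≤ C * ‖z - x‖ ^ 2)
    (hq : Tendsto (fun z => d.left φ Δ z j₀ * d.right ψ Δ z j₀) (𝓝[lowerHalfDisc e δ] x) (𝓝 q₀)) :
    inner ℂ φ (eigProj (perturbed L₀ W Δ) x ψ) = -q₀ / g₁ := by
  have hp : ‖(x : ℂ) - e‖ < δ := by
    rw [← Complex.ofReal_sub, Complex.norm_real]; exact hx
  have hmem := eventually_vertical_mem hp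
  have hΔ' : |Δ| ≤ Δ₀ := hΔ.le.trans d.c_le
  -- The limit of iε⟨φ, R_zψ⟩ is computed twice: here as the spectral projection, below from the
  -- quotients.
  have hlim := tendsto_resolvent_orthProj (h.selfAdjoint Δ hΔ') x φ ψ
  have hratio : Tendsto (fun ε : ℝ => d.denom Δ (x - Complex.I * ε) j₀ / (Complex.I * ε)) (𝓝[>] 0)
      (𝓝 (-g₁)) := by
    rw [tendsto_iff_norm_sub_tendsto_zero]
    have h1 : Tendsto (fun ε : ℝ => C * ε) (𝓝[>] 0) (𝓝 (C * 0)) :=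
      ((continuous_const.mul continuous_id).tendsto 0).mono_left nhdsWithin_le_nhds
    rw [mul_zero] at h1
    refine squeeze_zero' (Eventually.of_forall fun _ => norm_nonneg _) ?_ h1
    filter_upwards [hmem, self_mem_nhdsWithin] with ε hε hε0
    have hε0' : (0 : ℝ) < ε := hε0
    have h2 := hg _ hε
    have h3 : (x - Complex.I * ε - x : ℂ) = -(Complex.I * ε) := by ring
    have h4 : (Complex.I * ε : ℂ) ≠ 0 := by simpa using hε0'.ne'
    have h5 : ‖(Complex.I * ε : ℂ)‖ = ε := by simp [abs_of_pos hε0']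
    rw [h3, norm_neg, h5] at h2
    have h6 : d.denom Δ (x - Complex.I * ε) j₀ / (Complex.I * ε) - -g₁ =
        (d.denom Δ (x - Complex.I * ε) j₀ - g₁ * -(Complex.I * ε)) / (Complex.I * ε) := by
      rw [eq_div_iff h4, sub_mul, div_mul_cancel₀ _ h4]; ring
    rw [h6, norm_div, h5, div_le_iff₀ hε0']
    linarith
  have hne0 : ∀ᶠ ε : ℝ in 𝓝[>] 0, d.denom Δ (x - Complex.I * ε) j₀ ≠ 0 := by
    filter_upwards [hratio.eventually_ne (neg_ne_zero.mpr hg₁)] with ε hε h0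
    exact hε (by rw [h0, zero_div])
  -- For j ≠ j₀ the quotient is bounded and the factor iε sends it to 0. For j₀ the denominator is
  -- -iε g₁ to first order, which leaves -q₀/g₁.
  have hterm : ∀ j, Tendsto (fun ε : ℝ => Complex.I * ε * (d.left φ Δ (x - Complex.I * ε) j *
      d.right ψ Δ (x - Complex.I * ε) j / d.denom Δ (x - Complex.I * ε) j)) (𝓝[>] 0)
      (𝓝 (if j = j₀ then -q₀ / g₁ else 0)) := fun j => by
    split_ifs with hjj
    · subst hjj
      have h1 := (hq.comp (tendsto_vertical (e : ℂ) hp)).mul (hratio.inv₀ (neg_ne_zero.mpr hg₁))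
      have h2 : q₀ * (-g₁)⁻¹ = -q₀ / g₁ := by rw [inv_neg]; ring
      rw [h2] at h1
      refine h1.congr fun ε => ?_
      simp only [Function.comp_apply, inv_div]
      ring
    · obtain ⟨C, hC0, hC⟩ := ((d.unifBddDeriv_left h he hφ j).mul (isOpen_lowerHalfDisc _ _)
        (d.unifBddDeriv_right h he hψ j)).exists_nonneg_bound
      refine (tendsto_zero_of_norm_le_mul (C := C / (Δ ^ 2 * γ)) ?_ tendsto_I_mul_nhdsGT).congr
        fun ε => mul_comm _ _
      filter_upwards [hmem] with ε hε
      have h1 := (hC Δ hΔ).2 0 (by omega) _ hε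
      rw [iteratedDeriv_zero] at h1
      rw [norm_div]
      exact div_le_div₀ hC0 h1 (by positivity) (d.mul_le_norm_denom hε.1.le (hj j hjj _ hε))
  have hsum := (tendsto_mul_inner_reducedResolvent h he hΔ' (hx.trans_le d.δ_le) φ ψ).add
    (tendsto_finsetSum Finset.univ fun j _ => hterm j)
  rw [Finset.sum_ite_eq' Finset.univ j₀, if_pos (Finset.mem_univ _), zero_add] at hsum
  refine tendsto_nhds_unique hlim (hsum.congr' ?_)
  filter_upwards [hmem, hne0] with ε hε hε0
  rw [d.inner_resolvent h he hΔ hε (fun j => ?_) φ ψ, mul_add, Finset.mul_sum]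
  by_cases hjj : j = j₀
  · rw [hjj]; exact hε0
  · refine norm_pos_iff.mp (lt_of_lt_of_le ?_ (d.mul_le_norm_denom hε.1.le (hj j hjj _ hε)))
    positivity

end LevelDiagonalization

end Poles

/-! ### Error bounds for the single quotients, uniform in the coupling. -/

section LocalResonances

set_option linter.unusedSectionVars false

variable {H : Type*} [NormedAddCommGroup H] [InnerProductSpace ℂ H] [CompleteSpace H]
  {L₀ W : H →ₗ.[ℂ] H} {Δ₀ α : ℝ} {D : Set H} {stab unst : Finset ℝ} {E : ℝ → ℝ → ℝ}
  {lam : ℝ → ℕ → ℂ} {e : ℝ} {m : ℕ}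

namespace LevelDiagonalization

variable {b : LevelBasis L₀ W lam e m} {δ c K : ℝ} (d : LevelDiagonalization b Δ₀ α δ c K)

/-- The complex pole comparison with s = Δ² and all data frozen at z = e. The constant is fixed
before Δ because it involves only γ and the uniform bounds on a_j and the numerators. -/
theorem norm_deriv_sub_decay_le (h : ResonanceAssumptions L₀ W Δ₀ α D stab unst E lam)
    (he : e ∈ stab ∪ unst) {γ : ℝ} (hγ : 0 < γ) {j : Fin m}
    (hj : ∀ Δ, |Δ| < c → ∀ z ∈ lowerHalfDisc e δ, γ ≤ (d.a Δ z j).im) {φ ψ : H}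
    (hφ : φ ∈ Submodule.span ℂ D) (hψ : ψ ∈ Submodule.span ℂ D) :
    ∃ C, 0 ≤ C ∧ ∀ Δ, Δ ≠ 0 → |Δ| < c → ∀ A q₀ : ℂ,
      Tendsto (fun z => d.a Δ z j) (𝓝[lowerHalfDisc e δ] e) (𝓝 A) →
      Tendsto (fun z => d.left φ Δ z j * d.right ψ Δ z j) (𝓝[lowerHalfDisc e δ] e) (𝓝 q₀) →
      ∀ z ∈ lowerHalfDisc e δ, d.denom Δ z j ≠ 0 ∧
        ‖deriv (fun w => d.left φ Δ w j * d.right ψ Δ w j / d.denom Δ w j) z -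
          q₀ / (e + Δ ^ 2 * A - z) ^ 2‖ ≤ C * (1 + Δ ^ 2 / (‖z - e‖ + Δ ^ 2) ^ 2) := by
  have ho := isOpen_lowerHalfDisc (e : ℂ) δ
  have hp : ‖((e : ℝ) : ℂ) - e‖ < δ := by simpa using d.δ_pos
  have hcl := mem_closure_lowerHalfDisc (e : ℂ) hp
  have := mem_closure_iff_nhdsWithin_neBot.mp hcl
  obtain ⟨C₁, hC₁0, hC₁⟩ := (d.bdd_a j).exists_nonneg_bound
  obtain ⟨C₂, hC₂0, hC₂⟩ := ((d.unifBddDeriv_left h he hφ j).mul ho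
    (d.unifBddDeriv_right h he hψ j)).exists_nonneg_bound
  set C := max C₁ C₂
  have hC : 0 ≤ C := hC₁0.trans (le_max_left _ _)
  refine ⟨2 * C * (1 + (C + 1) / γ) ^ 2 + (2 * C ^ 2 * (1 + (C + 1) / γ) ^ 2 +
        2 * C ^ 2 * (1 + (C + 1) / γ) ^ 3), by positivity, fun Δ hΔ0 hΔ A q₀ hA hq z hz => ?_⟩
  have hda := (hC₁ Δ hΔ).1
  have hdq := (hC₂ Δ hΔ).1
  have hba : ∀ k ≤ 3, ∀ z ∈ lowerHalfDisc (e : ℂ) δ, ‖iteratedDeriv k (fun z => d.a Δ z j) z‖ ≤ C :=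
    fun k hk z hz => ((hC₁ Δ hΔ).2 k hk z hz).trans (le_max_left _ _)
  have hbq : ∀ k ≤ 3, ∀ z ∈ lowerHalfDisc (e : ℂ) δ,
      ‖iteratedDeriv k (fun z => d.left φ Δ z j * d.right ψ Δ z j) z‖ ≤ C :=
    fun k hk z hz => ((hC₂ Δ hΔ).2 k hk z hz).trans (le_max_right _ _)
  obtain ⟨A', hA'C, hA'⟩ := boundary_taylor_one ho (convex_lowerHalfDisc _ _) hcl hda
    (fun k hk => hba k (by omega)) hC
  have hAA : A' = A := tendsto_nhds_unique (tendsto_of_norm_sub_le (C := C) 0 fun z hz => by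
    simpa only [zero_add, pow_one] using hA' z hz) hA
  subst hAA
  obtain ⟨q', q₁, hq'C, -, hq1, hq2, hq3⟩ := boundary_taylor_two ho (convex_lowerHalfDisc _ _) hcl
    hdq (fun k hk => hbq k (by omega)) hC
  have hqq : q' = q₀ := tendsto_nhds_unique (tendsto_of_norm_sub_le (C := C) 0 fun z hz => by
    simpa only [zero_add, pow_one] using hq1 z hz) hq
  subst hqq
  have hAim : γ ≤ A'.im :=
    ge_of_tendsto ((Complex.continuous_im.tendsto _).comp hA)
      (eventually_nhdsWithin_of_forall fun z hz => hj Δ hΔ z hz)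
  have key := norm_deriv_sub_pole_le (e := (e : ℂ)) (z := z) (C := C) (γ := γ) (s := Δ ^ 2)
    (a := fun w => d.a Δ w j) (q := fun w => d.left φ Δ w j * d.right ψ Δ w j)
    (q' := deriv (fun w => d.left φ Δ w j * d.right ψ Δ w j) z)
    (a' := deriv (fun w => d.a Δ w j) z) (q₀ := q') (q₁ := q₁) (a₀ := A') hC hγ (by positivity)
    (by simpa using hz.1.le) (hj Δ hΔ z hz) (by simpa using hba 0 (by omega) z hz) hAim hA'C
    (by simpa using hbq 0 (by omega) z hz) hq'C (by simpa using hbq 1 (by omega) z hz)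
    (by simpa using hba 1 (by omega) z hz) (hq2 z hz) (hq3 z hz) (hA' z hz)
    (hdq.differentiableAt (ho.mem_nhds hz)).hasDerivAt
    (hda.differentiableAt (ho.mem_nhds hz)).hasDerivAt
  refine ⟨key.1, ?_⟩
  have k2 := key.2
  simp only [Complex.ofReal_pow] at k2
  simp only [denom, Complex.ofReal_pow]
  refine k2.trans ?_
  set X : ℝ := Δ ^ 2 / (‖z - e‖ + Δ ^ 2) ^ 2
  have hX : 0 ≤ X := by positivity
  have p1 : 0 ≤ 2 * C * (1 + (C + 1) / γ) ^ 2 := by positivity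
  have p2 : 0 ≤ 2 * C ^ 2 * (1 + (C + 1) / γ) ^ 2 + 2 * C ^ 2 * (1 + (C + 1) / γ) ^ 3 := by positivity
  nlinarith [mul_nonneg p1 hX]

/-- Here the expansion point is the eigenvalue x of L, not e: since the denominator vanishes there,
it equals -(z - x) + Δ²(a(z) - a(x)). The smallness c²M ≤ 1/2 makes it comparable to z - x, and δ ≤
1/2 gives |z - x| ≤ 1, so higher powers can be absorbed. -/
theorem norm_deriv_sub_eigenvalue_le (h : ResonanceAssumptions L₀ W Δ₀ α D stab unst E lam)
    (he : e ∈ stab ∪ unst) {γ : ℝ} (hγ : 0 < γ) {j₀ : Fin m}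
    (hj : ∀ Δ, |Δ| < c → ∀ j ≠ j₀, ∀ z ∈ lowerHalfDisc e δ, γ ≤ (d.a Δ z j).im)
    (hδ : δ ≤ 1 / 2) {M : ℝ} (hM0 : 0 ≤ M) (hM : ∀ Δ, |Δ| < c → ∀ k ≤ 3, ∀ z ∈ lowerHalfDisc e δ,
      ‖iteratedDeriv k (fun z => d.a Δ z j₀) z‖ ≤ M) (hc : c ^ 2 * M ≤ 1 / 2) {φ ψ : H}
    (hφ : φ ∈ Submodule.span ℂ D) (hψ : ψ ∈ Submodule.span ℂ D) :
    ∃ C, 0 ≤ C ∧ ∀ Δ, Δ ≠ 0 → |Δ| < c → ∀ x : ℝ, |x - e| < δ → IsEigenvalue (perturbed L₀ W Δ) x →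
      ∀ z ∈ lowerHalfDisc e δ, d.denom Δ z j₀ ≠ 0 ∧
        ‖deriv (fun w => d.left φ Δ w j₀ * d.right ψ Δ w j₀ / d.denom Δ w j₀) z -
          inner ℂ φ (eigProj (perturbed L₀ W Δ) x ψ) / (x - z) ^ 2‖ ≤ C := by
  have ho := isOpen_lowerHalfDisc (e : ℂ) δ
  obtain ⟨C₂, hC₂0, hC₂⟩ := ((d.unifBddDeriv_left h he hφ j₀).mul ho
    (d.unifBddDeriv_right h he hψ j₀)).exists_nonneg_bound
  set C := max C₂ 2
  have hC2 : 2 ≤ C := le_max_right _ _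
  have hC : 0 ≤ C := by linarith
  refine ⟨4 * (10 * C ^ 2 + 8 * C ^ 3), by positivity, fun Δ hΔ0 hΔ x hx hev z hz => ?_⟩
  have hp : ‖(x : ℂ) - e‖ < δ := by
    rw [← Complex.ofReal_sub, Complex.norm_real]; exact hx
  have hcl := mem_closure_lowerHalfDisc (e : ℂ) hp
  have hda : DifferentiableOn ℂ (fun z => d.a Δ z j₀) (lowerHalfDisc e δ) := by
    obtain ⟨C₁, -, hC₁⟩ := (d.bdd_a j₀).exists_nonneg_bound
    exact (hC₁ Δ hΔ).1
  have hdq := (hC₂ Δ hΔ).1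
  have hbq : ∀ k ≤ 3, ∀ z ∈ lowerHalfDisc (e : ℂ) δ,
      ‖iteratedDeriv k (fun z => d.left φ Δ z j₀ * d.right ψ Δ z j₀) z‖ ≤ C :=
    fun k hk z hz => ((hC₂ Δ hΔ).2 k hk z hz).trans (le_max_left _ _)
  obtain ⟨A, A₁, A₂, hAC, hA₁C, hA₂C, hA1, hA3, hA2⟩ := boundary_taylor_three ho
    (convex_lowerHalfDisc _ _) hcl hda (hM Δ hΔ) hM0
  have hAt : Tendsto (fun z => d.a Δ z j₀) (𝓝[lowerHalfDisc e δ] x) (𝓝 A) :=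
    tendsto_of_norm_sub_le (C := M) 0 fun z hz => by
      simpa only [zero_add, pow_one] using hA1 z hz
  obtain ⟨q₀, q₁, hq₀C, hq₁C, hq1, hq2, hq3⟩ := boundary_taylor_two ho (convex_lowerHalfDisc _ _) hcl
    hdq (fun k hk => hbq k (by omega)) hC
  have hqt : Tendsto (fun z => d.left φ Δ z j₀ * d.right ψ Δ z j₀) (𝓝[lowerHalfDisc e δ] x) (𝓝 q₀) :=
    tendsto_of_norm_sub_le (C := C) 0 fun z hz => by
      simpa only [zero_add, pow_one] using hq1 z hz
  have hE := d.denom_eigenvalue h he hγ hΔ0 hΔ (hj Δ hΔ) hx hev hAt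
  have hsM : Δ ^ 2 * M ≤ 1 / 2 := by
    have : Δ ^ 2 ≤ c ^ 2 := by
      rw [← sq_abs]; exact pow_le_pow_left₀ (abs_nonneg _) hΔ.le 2
    exact (mul_le_mul_of_nonneg_right this hM0).trans hc
  set s : ℂ := ((Δ ^ 2 : ℝ) : ℂ) with hs
  have hsn : ‖s‖ = Δ ^ 2 := by rw [hs, Complex.norm_real, Real.norm_of_nonneg (sq_nonneg _)]
  have hsle : ∀ {w : ℂ} {t : ℝ}, 0 ≤ t → ‖w‖ ≤ M * t → ‖s * w‖ ≤ 1 / 2 * t := fun {w t} ht hw => by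
    rw [norm_mul, hsn]
    calc Δ ^ 2 * ‖w‖ ≤ Δ ^ 2 * (M * t) := by gcongr
      _ = (Δ ^ 2 * M) * t := by ring
      _ ≤ _ := by gcongr
  -- The relation e - x + Δ²A = 0 removes the constant term. In this and the next bound what remains
  -- is Δ² times a Taylor error of a, hence at most half the corresponding power of |w - x|.
  have hg1 : ∀ w ∈ lowerHalfDisc (e : ℂ) δ, ‖d.denom Δ w j₀ + (w - x)‖ ≤ 1 / 2 * ‖w - x‖ := fun w hw => by
    have : d.denom Δ w j₀ + (w - x) = s * (d.a Δ w j₀ - A) := by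
      rw [denom]; linear_combination hE
    rw [this]
    exact hsle (norm_nonneg _) (hA1 w hw)
  have hg3 : ∀ w ∈ lowerHalfDisc (e : ℂ) δ, ‖d.denom Δ w j₀ - (-1 + s * A₁) * (w - x) -
      s * A₂ * (w - x) ^ 2‖ ≤ 1 / 2 * ‖w - x‖ ^ 3 := fun w hw => by
    have : d.denom Δ w j₀ - (-1 + s * A₁) * (w - x) - s * A₂ * (w - x) ^ 2 =
        s * (d.a Δ w j₀ - A - A₁ * (w - x) - A₂ * (w - x) ^ 2) := by
      rw [denom]; linear_combination hE
    rw [this]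
    exact hsle (by positivity) (hA3 w hw)
  have hsA₁ : ‖s * A₁‖ ≤ 1 / 2 := by simpa using hsle (w := A₁) zero_le_one (by simpa using hA₁C)
  have hsA₂ : ‖s * A₂‖ ≤ 1 / 2 := by simpa using hsle (w := A₂) zero_le_one (by simpa using hA₂C)
  have hg₁n : 1 / 2 ≤ ‖-1 + s * A₁‖ := by
    have := norm_sub_le (-1 + s * A₁) (s * A₁)
    rw [add_sub_cancel_right, norm_neg, norm_one] at this
    linarith
  have hy1 : ∀ w ∈ lowerHalfDisc (e : ℂ) δ, ‖w - x‖ ≤ 1 := fun w hw => by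
    have h1 := norm_sub_le_norm_sub_add_norm_sub w e x
    have h2 := hw.2
    rw [norm_sub_rev (x : ℂ)] at hp
    linarith
  have hres := d.inner_eigProj_eq h he hγ hΔ0 hΔ (hj Δ hΔ) hx hφ hψ (C := 1)
    (norm_pos_iff.mp (by linarith)) (fun w hw => by
      have h1 := norm_add_le (d.denom Δ w j₀ - (-1 + s * A₁) * (w - x) - s * A₂ * (w - x) ^ 2)
        (s * A₂ * (w - x) ^ 2)
      rw [sub_add_cancel, norm_mul _ ((w - (x : ℂ)) ^ 2), norm_pow] at h1
      have h2 := hg3 w hw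
      have h3 : ‖w - x‖ ^ 3 ≤ ‖w - x‖ ^ 2 :=
        pow_le_pow_of_le_one (norm_nonneg _) (hy1 w hw) (by norm_num)
      have h4 := mul_le_mul_of_nonneg_right hsA₂ (sq_nonneg ‖w - x‖)
      linarith) hqt
  have hz0 : z ≠ x := fun h0 => by
    have := hz.1
    rw [h0, Complex.ofReal_im] at this
    exact lt_irrefl _ this
  have hgz : ‖z - x‖ / 2 ≤ ‖d.denom Δ z j₀‖ := by
    have h1 := norm_sub_le (d.denom Δ z j₀ + (z - x)) (d.denom Δ z j₀)
    rw [add_sub_cancel_left] at h1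
    linarith [hg1 z hz]
  have hderiv : HasDerivAt (fun w => d.denom Δ w j₀) (-1 + s * deriv (fun w => d.a Δ w j₀) z) z := by
    have h1 := (hda.differentiableAt (ho.mem_nhds hz)).hasDerivAt
    exact ((hasDerivAt_id z).const_sub (e : ℂ)).add (h1.const_mul s)
  refine ⟨norm_pos_iff.mp (lt_of_lt_of_le (half_pos (norm_pos_iff.mpr (sub_ne_zero.mpr hz0))) hgz), ?_⟩
  rw [hres]
  refine norm_deriv_sub_real_pole_le (g := fun w => d.denom Δ w j₀) (E := (x : ℂ))
    (q' := deriv (fun w => d.left φ Δ w j₀ * d.right ψ Δ w j₀) z)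
    (g' := -1 + s * deriv (fun w => d.a Δ w j₀) z) (g₂ := s * A₂)
    (q := fun w => d.left φ Δ w j₀ * d.right ψ Δ w j₀) hC hz0 (hy1 z hz) hg₁n (by linarith) hgz
    ?_ ?_ hq₀C hq₁C (hq2 z hz) (hq3 z hz) ?_ ?_
    (hdq.differentiableAt (ho.mem_nhds hz)).hasDerivAt hderiv
  · have h1 := norm_sub_le (d.denom Δ z j₀ + (z - x)) (z - x)
    rw [add_sub_cancel_right] at h1
    nlinarith [hg1 z hz, norm_nonneg (z - x)]
  · have h0 := hM Δ hΔ 1 (by omega) z hz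
    rw [iteratedDeriv_one] at h0
    have h1 := norm_add_le (-1) (s * deriv (fun w => d.a Δ w j₀) z)
    have h2 := hsle (w := deriv (fun w => d.a Δ w j₀) z) zero_le_one (by simpa using h0)
    rw [norm_neg, norm_one] at h1
    linarith
  · refine (hg3 z hz).trans ?_
    gcongr
    linarith
  · have h1 : -1 + s * deriv (fun w => d.a Δ w j₀) z - (-1 + s * A₁) - 2 * (s * A₂) * (z - x) =
        s * (deriv (fun w => d.a Δ w j₀) z - A₁ - 2 * A₂ * (z - x)) := by ring
    rw [h1]
    refine (hsle (by positivity) (hA2 z hz)).trans ?_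
    gcongr
    linarith

end LevelDiagonalization

end LocalResonances

/-! ### All resonances emerging from one eigenvalue. -/

section LocalTheorem

set_option linter.unusedSectionVars false

variable {H : Type*} [NormedAddCommGroup H] [InnerProductSpace ℂ H] [CompleteSpace H]
  {L₀ W : H →ₗ.[ℂ] H} {Δ₀ α : ℝ} {D : Set H} {stab unst : Finset ℝ} {E : ℝ → ℝ → ℝ}
  {lam : ℝ → ℕ → ℂ} {e : ℝ} {m : ℕ}

theorem exists_pos_forall_le {ι : Type*} (s : Finset ι) (f : ι → ℝ) (hf : ∀ i ∈ s, 0 < f i) :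
    ∃ γ > 0, ∀ i ∈ s, γ ≤ f i := by
  classical
  induction s using Finset.induction_on with
  | empty => exact ⟨1, one_pos, by simp⟩
  | insert a s _ ih =>
    obtain ⟨γ, hγ, h⟩ := ih fun i hi => hf i (Finset.mem_insert_of_mem hi)
    refine ⟨min γ (f a), lt_min hγ (hf a (Finset.mem_insert_self _ _)), fun i hi => ?_⟩
    rcases Finset.mem_insert.mp hi with rfl | hi
    · exact min_le_right _ _
    · exact (min_le_left _ _).trans (h i hi)

theorem exists_forall_le {ι : Type*} (s : Finset ι) (f : ι → ℝ) :
    ∃ M, 0 ≤ M ∧ ∀ i ∈ s, f i ≤ M :=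
  ⟨∑ i ∈ s, |f i|, Finset.sum_nonneg fun _ _ => abs_nonneg _, fun _ hi => (le_abs_self _).trans
    (Finset.single_le_sum (f := fun i => |f i|) (fun _ _ => abs_nonneg _) hi)⟩

/-- The indices `j` of the decaying terms `(e, j)`. -/
noncomputable def decayRange (L₀ : H →ₗ.[ℂ] H) (stab : Finset ℝ) (e : ℝ) : Finset ℕ :=
  if e ∈ stab then Finset.Ico 1 (mult L₀ e) else Finset.range (mult L₀ e)

theorem ResonanceAssumptions.mult_pos (h : ResonanceAssumptions L₀ W Δ₀ α D stab unst E lam)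
    (he : e ∈ stab ∪ unst) : 0 < mult L₀ e := by
  have hfd := h.finiteDimensional e
  have : Nontrivial (eigenspace L₀ e) :=
    (Submodule.nontrivial_iff_ne_bot).mpr ((h.eigenvalues.isEigenvalue_iff e).mpr he)
  exact Module.finrank_pos

theorem ResonanceAssumptions.mem_decayRange (h : ResonanceAssumptions L₀ W Δ₀ α D stab unst E lam)
    (he : e ∈ stab ∪ unst) {j : ℕ} :
    j ∈ decayRange L₀ stab e ↔ IsDecayIndex L₀ stab unst e j := by
  have hd := h.eigenvalues.disjoint
  rw [decayRange, IsDecayIndex]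
  by_cases hs : e ∈ stab
  · have hu := Finset.disjoint_left.mp hd hs
    simp [hs, hu, and_comm]
  · have hu : e ∈ unst := (Finset.mem_union.mp he).resolve_left hs
    simp [hs, hu]

theorem ResonanceAssumptions.im_pos (h : ResonanceAssumptions L₀ W Δ₀ α D stab unst E lam)
    {j : ℕ} (hj : IsDecayIndex L₀ stab unst e j) : 0 < (lam e j).im := by
  rcases hj.2 with hu | ⟨hs, h1⟩
  · exact h.goldenRule.unstable e hu j hj.1
  · exact h.goldenRule.stable e hs j h1 hj.1

theorem sum_fin_eq_sum_decayRange (h : ResonanceAssumptions L₀ W Δ₀ α D stab unst E lam)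
    (he : e ∈ stab ∪ unst) (p : ℕ → ℂ) (p₀ : ℂ) :
    ∑ j : Fin (mult L₀ e), (if (j : ℕ) ∈ decayRange L₀ stab e then p j else p₀) =
      ∑ j ∈ decayRange L₀ stab e, p j + if e ∈ stab then p₀ else 0 := by
  rw [Fin.sum_univ_eq_sum_range (fun j => if j ∈ decayRange L₀ stab e then p j else p₀)]
  by_cases hs : e ∈ stab
  · rw [Finset.range_eq_Ico, Finset.sum_eq_sum_Ico_succ_bot (h.mult_pos he), add_comm, if_pos hs]
    simp only [decayRange, if_pos hs]
    congr 1
    · exact Finset.sum_congr rfl fun j hj => if_pos hj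
    · simp
  · simp only [decayRange, if_neg hs, add_zero]
    exact Finset.sum_congr rfl fun j hj => if_pos hj

/-- The singular part of `d/dz ⟨φ, R_z ψ⟩` at the eigenvalue `e`, where `q j` are the residues at the
resonances and `q₀` is the residue at the eigenvalue. -/
noncomputable def singularPart (L₀ : H →ₗ.[ℂ] H) (stab : Finset ℝ) (E : ℝ → ℝ → ℝ) (a : ℕ → ℝ → ℂ)
    (e : ℝ) (Δ : ℝ) (q : ℕ → ℂ) (q₀ : ℂ) (z : ℂ) : ℂ :=
  ∑ j ∈ decayRange L₀ stab e, q j / (e + Δ ^ 2 * a j Δ - z) ^ 2 +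
    if e ∈ stab then q₀ / (E e Δ - z) ^ 2 else 0

/-- The resonances which emerge from the eigenvalue `e`. -/
theorem ResonanceAssumptions.exists_local_resonances
    (h : ResonanceAssumptions L₀ W Δ₀ α D stab unst E lam) (he : e ∈ stab ∪ unst) :
    ∃ δ > 0, δ ≤ α ∧ ∃ c > 0, c ≤ Δ₀ ∧ ∃ (a : ℕ → ℝ → ℂ) (Q : ℕ → ℝ → SesqForm D),
      (∃ C, ∀ j, IsDecayIndex L₀ stab unst e j → ∀ Δ : ℝ, |Δ| < c →
        ‖a j Δ - lam e j‖ ≤ C * |Δ| ∧ 0 < (a j Δ).im) ∧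
      (∀ (φ : H) (hφ : φ ∈ D) (ψ : H) (hψ : ψ ∈ D), ∃ C, ∀ j, IsDecayIndex L₀ stab unst e j →
        ∀ Δ : ℝ, |Δ| < c →
          ‖Q j Δ ⟨φ, Submodule.subset_span hφ⟩ ⟨ψ, Submodule.subset_span hψ⟩ -
            inner ℂ φ (levelProj L₀ W e (lam e j) ψ)‖ ≤ C * |Δ|) ∧
      ∀ (φ : H) (hφ : φ ∈ D) (ψ : H) (hψ : ψ ∈ D), ∃ C, 0 ≤ C ∧ ∀ Δ : ℝ, Δ ≠ 0 → |Δ| < c →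
        ∀ z ∈ lowerHalfDisc e δ,
          ‖deriv (fun w => inner ℂ φ (resolvent (perturbed L₀ W Δ) w ψ)) z -
            singularPart L₀ stab E a e Δ
              (fun j => Q j Δ ⟨φ, Submodule.subset_span hφ⟩ ⟨ψ, Submodule.subset_span hψ⟩)
              (inner ℂ φ (eigProj (perturbed L₀ W Δ) (E e Δ) ψ)) z‖ ≤
            C * (1 + Δ ^ 2 / (‖z - e‖ + Δ ^ 2) ^ 2) := by
  obtain ⟨b⟩ := h.exists_levelBasis he
  obtain ⟨δ₀, c₀, K, ⟨d₀⟩⟩ := h.exists_levelDiagonalization he b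
  obtain ⟨γ, hγ, hγl⟩ := exists_pos_forall_le (decayRange L₀ stab e) (fun j => (lam e j).im / 2)
    fun j hj => half_pos (h.im_pos ((h.mem_decayRange he).mp hj))
  have hM : ∀ j, ∃ M, 0 ≤ M ∧ ∀ Δ, |Δ| < c₀ → ∀ k ≤ 3, ∀ z ∈ lowerHalfDisc (e : ℂ) δ₀,
      ‖iteratedDeriv k (fun z => d₀.a Δ z j) z‖ ≤ M := fun j => by
    obtain ⟨M, hM0, hM⟩ := (d₀.bdd_a j).exists_nonneg_bound
    exact ⟨M, hM0, fun Δ hΔ => (hM Δ hΔ).2⟩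
  choose M hM0 hM using hM
  obtain ⟨M', hM'0, hM'⟩ := exists_forall_le Finset.univ M
  set K' : ℝ := |K| + 1 with hK'
  have hK'0 : 0 < K' := by positivity
  -- The 1/2 is for the real pole comparison. The last bound, shared with c, gives K(|Δ| + |z - e|)
  -- ≤ γ. As Im λ_j ≥ 2γ, this leaves Im a_j ≥ γ on the whole half disc.
  set δ : ℝ := min (min δ₀ (1 / 2)) (γ / (2 * K')) with hδdef
  have hδ0 : 0 < δ := lt_min (lt_min d₀.δ_pos (by norm_num)) (by positivity)
  have hδ1 : δ ≤ δ₀ := (min_le_left _ _).trans (min_le_left _ _)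
  have hδ2 : δ ≤ 1 / 2 := (min_le_left _ _).trans (min_le_right _ _)
  have hδ3 : δ ≤ γ / (2 * K') := min_le_right _ _
  have hEtend : ∃ c₁ > 0, ∀ Δ : ℝ, Δ ≠ 0 → |Δ| < c₁ → e ∈ stab → |E e Δ - e| < δ := by
    by_cases hs : e ∈ stab
    · have h1 := (h.eigenvalues.tendsto e hs).eventually (Metric.ball_mem_nhds e hδ0)
      rw [eventually_nhdsWithin_iff, Metric.eventually_nhds_iff_ball] at h1
      obtain ⟨c₁, hc₁, h2⟩ := h1
      refine ⟨c₁, hc₁, fun Δ hΔ0 hΔ _ => ?_⟩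
      have h3 := h2 Δ (by simpa using hΔ) hΔ0
      rwa [Real.dist_eq] at h3
    · exact ⟨1, one_pos, fun _ _ _ hs' => absurd hs' hs⟩
  obtain ⟨c₁, hc₁, hEδ⟩ := hEtend
  -- The bound by c₁ keeps E_e in the disc. The last two entries give c²M_j ≤ cM' ≤ 1/2.
  set c : ℝ := min (min c₀ c₁) (min (γ / (2 * K')) (min 1 (1 / (2 * (M' + 1))))) with hcdef
  have hc0 : 0 < c := lt_min (lt_min d₀.c_pos hc₁) (lt_min (by positivity)
    (lt_min one_pos (by positivity)))
  have hcc0 : c ≤ c₀ := (min_le_left _ _).trans (min_le_left _ _)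
  have hcc1 : c ≤ c₁ := (min_le_left _ _).trans (min_le_right _ _)
  have hc3 : c ≤ γ / (2 * K') := (min_le_right _ _).trans (min_le_left _ _)
  have hc4 : c ≤ 1 := (min_le_right _ _).trans ((min_le_right _ _).trans (min_le_left _ _))
  have hc5 : c ≤ 1 / (2 * (M' + 1)) :=
    (min_le_right _ _).trans ((min_le_right _ _).trans (min_le_right _ _))
  have hc6 : ∀ j, c ^ 2 * M j ≤ 1 / 2 := fun j => by
    have h1 : M j ≤ M' := hM' j (Finset.mem_univ j)
    rw [le_div_iff₀ (by positivity)] at hc5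
    nlinarith [hM0 j, mul_nonneg hc0.le (hM0 j), mul_le_mul_of_nonneg_left h1 hc0.le]
  let d := d₀.restrict hδ0 hδ1 hc0 hcc0
  have hMd : ∀ j Δ, |Δ| < c → ∀ k ≤ 3, ∀ z ∈ lowerHalfDisc (e : ℂ) δ,
      ‖iteratedDeriv k (fun z => d.a Δ z j) z‖ ≤ M j := fun j Δ hΔ k hk z hz =>
    hM j Δ (hΔ.trans_le hcc0) k hk z (lowerHalfDisc_mono _ hδ1 hz)
  have him : ∀ j : Fin (mult L₀ e), (j : ℕ) ∈ decayRange L₀ stab e → ∀ Δ, |Δ| < c →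
      ∀ z ∈ lowerHalfDisc (e : ℂ) δ, γ ≤ (d.a Δ z j).im := fun j hj Δ hΔ z hz => by
    have h1 := d.a_sub Δ hΔ z hz j
    have h2 := hγl j hj
    have h3 := (Complex.abs_im_le_norm (d.a Δ z j - lam e j)).trans h1
    rw [Complex.sub_im] at h3
    have h4 := neg_abs_le ((d.a Δ z j).im - (lam e j).im)
    have h5 : |Δ| + ‖z - e‖ ≤ γ / (2 * K') + γ / (2 * K') :=
      add_le_add (hΔ.le.trans hc3) (hz.2.le.trans hδ3)
    have h6 : K * (|Δ| + ‖z - e‖) ≤ K' * (γ / (2 * K') + γ / (2 * K')) :=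
      mul_le_mul ((le_abs_self K).trans (by rw [hK']; linarith)) h5 (by positivity) hK'0.le
    have h7 : K' * (γ / (2 * K') + γ / (2 * K')) = γ := by field_simp; norm_num
    linarith
  have hp : ‖((e : ℝ) : ℂ) - e‖ < δ := by simpa using hδ0
  have hcl := mem_closure_lowerHalfDisc (e : ℂ) hp
  have hbot := mem_closure_iff_nhdsWithin_neBot.mp hcl
  -- The exponents are the boundary values of the functions a_j at z = e, and the forms below are
  -- those of the numerators. Outside the relevant range both take the default value 0.
  have hexa : ∀ (j : ℕ) (Δ : ℝ), ∃ A, ∀ hj : j < mult L₀ e, |Δ| < c →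
      Tendsto (fun z => d.a Δ z ⟨j, hj⟩) (𝓝[lowerHalfDisc e δ] e) (𝓝 A) := fun j Δ => by
    by_cases hj : j < mult L₀ e ∧ |Δ| < c
    · obtain ⟨A, hA⟩ := LevelDiagonalization.exists_tendsto_of_unifBddDeriv
        (d.bdd_a ⟨j, hj.1⟩) hp hj.2
      exact ⟨A, fun _ _ => hA⟩
    · exact ⟨0, fun h1 h2 => absurd ⟨h1, h2⟩ hj⟩
  choose a ha using hexa
  have hexQ : ∀ (j : ℕ) (Δ : ℝ), ∃ Q : SesqForm D, ∀ hj : j < mult L₀ e, |Δ| < c →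
      ∀ φ ψ : Submodule.span ℂ D, Tendsto (fun z => d.left (φ : H) Δ z ⟨j, hj⟩ * d.right (ψ : H) Δ z ⟨j, hj⟩)
        (𝓝[lowerHalfDisc e δ] e) (𝓝 (Q φ ψ)) := fun j Δ => by
    by_cases hj : j < mult L₀ e ∧ |Δ| < c
    · obtain ⟨Q, hQ⟩ := exists_sesq_limit (V := Submodule.span ℂ D) (l := 𝓝[lowerHalfDisc e δ] e)
        (fun φ ψ z => d.left (φ : H) Δ z ⟨j, hj.1⟩ * d.right (ψ : H) Δ z ⟨j, hj.1⟩)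
        (fun φ ψ => LevelDiagonalization.exists_tendsto_of_unifBddDeriv
          ((d.unifBddDeriv_left h he φ.2 ⟨j, hj.1⟩).mul (isOpen_lowerHalfDisc _ _)
            (d.unifBddDeriv_right h he ψ.2 ⟨j, hj.1⟩)) hp hj.2)
        (fun φ φ' ψ z => by
          simp only [LevelDiagonalization.left, Submodule.coe_add, inner_add_left]
          rw [← add_mul, ← Finset.sum_add_distrib]
          congr 1
          exact Finset.sum_congr rfl fun i _ => by ring)
        (fun k φ ψ z => by
          simp only [LevelDiagonalization.left, Submodule.coe_smul, inner_smul_left]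
          rw [← mul_assoc, Finset.mul_sum]
          congr 1
          exact Finset.sum_congr rfl fun i _ => by ring)
        (fun φ ψ ψ' z => by
          simp only [LevelDiagonalization.right, Submodule.coe_add, inner_add_right, map_add]
          rw [← mul_add, ← Finset.sum_add_distrib]
          congr 1
          exact Finset.sum_congr rfl fun i _ => by ring)
        (fun k φ ψ z => by
          simp only [LevelDiagonalization.right, Submodule.coe_smul, inner_smul_right, map_smul]
          rw [mul_left_comm k, Finset.mul_sum, Finset.mul_sum, Finset.mul_sum]
          exact Finset.sum_congr rfl fun i _ => by ring)
      exact ⟨Q, fun _ _ => hQ⟩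
    · exact ⟨0, fun h1 h2 => absurd ⟨h1, h2⟩ hj⟩
  choose Q hQ using hexQ
  have hlimnorm : ∀ C Δ : ℝ, Tendsto (fun z : ℂ => C * (|Δ| + ‖z - e‖)) (𝓝[lowerHalfDisc e δ] e)
      (𝓝 (C * |Δ|)) := fun C Δ => by
    have h1 : Continuous fun z : ℂ => C * (|Δ| + ‖z - e‖) := by fun_prop
    simpa using (h1.tendsto (e : ℂ)).mono_left (nhdsWithin_le_nhds (s := lowerHalfDisc (e : ℂ) δ))
  refine ⟨δ, hδ0, d.δ_le, c, hc0, d.c_le, a, Q, ⟨K, fun j hj Δ hΔ => ⟨?_, ?_⟩⟩,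
    fun φ hφ ψ hψ => ?_, fun φ hφ ψ hψ => ?_⟩
  · exact le_of_tendsto_of_tendsto ((ha j Δ hj.1 hΔ).sub_const _).norm (hlimnorm K Δ)
      (eventually_nhdsWithin_of_forall fun z hz => d.a_sub Δ hΔ z hz ⟨j, hj.1⟩)
  · refine hγ.trans_le (ge_of_tendsto ((Complex.continuous_im.tendsto _).comp (ha j Δ hj.1 hΔ))
      (eventually_nhdsWithin_of_forall fun z hz =>
        him ⟨j, hj.1⟩ ((h.mem_decayRange he).mpr hj) Δ hΔ z hz))
  · obtain ⟨C, hC⟩ := d.norm_left_mul_right_sub_le h he (Submodule.subset_span hφ)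
      (Submodule.subset_span hψ)
    refine ⟨C, fun j hj Δ hΔ => ?_⟩
    have h1 := b.levelProj_apply h he ⟨j, hj.1⟩ ψ
    simp only at h1
    rw [h1, inner_smul_right, mul_comm]
    exact le_of_tendsto_of_tendsto ((hQ j Δ hj.1 hΔ _ _).sub_const _).norm (hlimnorm C Δ)
      (eventually_nhdsWithin_of_forall fun z hz => hC Δ hΔ z hz ⟨j, hj.1⟩)
  have hφs := Submodule.subset_span (R := ℂ) hφ
  have hψs := Submodule.subset_span (R := ℂ) hψ
  obtain ⟨C₀, hC₀0, hC₀⟩ := (h.unifBddDeriv_disc he hφs hψs).exists_nonneg_bound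
  have hterm : ∀ j : Fin (mult L₀ e), ∃ C, 0 ≤ C ∧ ∀ Δ, Δ ≠ 0 → |Δ| < c →
      ∀ z ∈ lowerHalfDisc (e : ℂ) δ, d.denom Δ z j ≠ 0 ∧
        ‖deriv (fun w => d.left φ Δ w j * d.right ψ Δ w j / d.denom Δ w j) z -
          (if (j : ℕ) ∈ decayRange L₀ stab e then
            Q j Δ ⟨φ, hφs⟩ ⟨ψ, hψs⟩ / (e + Δ ^ 2 * a j Δ - z) ^ 2
          else inner ℂ φ (eigProj (perturbed L₀ W Δ) (E e Δ) ψ) / (E e Δ - z) ^ 2)‖ ≤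
          C * (1 + Δ ^ 2 / (‖z - e‖ + Δ ^ 2) ^ 2) := fun j => by
    by_cases hj : (j : ℕ) ∈ decayRange L₀ stab e
    · obtain ⟨C, hC0, hC⟩ := d.norm_deriv_sub_decay_le h he hγ (him j hj) hφs hψs
      refine ⟨C, hC0, fun Δ hΔ0 hΔ z hz => ?_⟩
      rw [if_pos hj]
      exact hC Δ hΔ0 hΔ _ _ (ha j Δ j.2 hΔ) (hQ j Δ j.2 hΔ ⟨φ, hφs⟩ ⟨ψ, hψs⟩) z hz
    · have hs : e ∈ stab := by
        by_contra hs
        rw [decayRange, if_neg hs] at hj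
        exact hj (Finset.mem_range.mpr j.2)
      have hj0 : (j : ℕ) = 0 := by
        rw [decayRange, if_pos hs, Finset.mem_Ico] at hj
        have := j.2
        omega
      have hne : ∀ i ≠ j, (i : ℕ) ∈ decayRange L₀ stab e := fun i hij => by
        rw [decayRange, if_pos hs, Finset.mem_Ico]
        have : (i : ℕ) ≠ j := fun h0 => hij (Fin.ext h0)
        exact ⟨by omega, i.2⟩
      obtain ⟨C, hC0, hC⟩ := d.norm_deriv_sub_eigenvalue_le h he hγ
        (fun Δ hΔ i hij => him i (hne i hij) Δ hΔ) hδ2 (hM0 j) (hMd j) (hc6 j) hφs hψs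
      refine ⟨C, hC0, fun Δ hΔ0 hΔ z hz => ?_⟩
      rw [if_neg hj]
      have hev : IsEigenvalue (perturbed L₀ W Δ) (E e Δ) := fun h0 => by
        have h1 := h.eigenvalues.simple Δ hΔ0 (hΔ.le.trans d.c_le) e hs
        rw [h0, finrank_bot] at h1
        exact zero_ne_one h1
      obtain ⟨h1, h2⟩ := hC Δ hΔ0 hΔ (E e Δ) (hEδ Δ hΔ0 (hΔ.trans_le hcc1) hs) hev z hz
      refine ⟨h1, h2.trans ?_⟩
      have : 0 ≤ Δ ^ 2 / (‖z - e‖ + Δ ^ 2) ^ 2 := by positivity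
      nlinarith [mul_nonneg hC0 this]
  choose C hC0 hC using hterm
  refine ⟨C₀ + ∑ j, C j, add_nonneg hC₀0 (Finset.sum_nonneg fun j _ => hC0 j),
    fun Δ hΔ0 hΔ z hz => ?_⟩
  have ho := isOpen_lowerHalfDisc (e : ℂ) δ
  set X : ℝ := Δ ^ 2 / (‖z - e‖ + Δ ^ 2) ^ 2 with hX
  have hX0 : 0 ≤ X := by positivity
  have hzα := lowerHalfDisc_mono (e : ℂ) d.δ_le hz
  have hT := hC₀ Δ (hΔ.le.trans d.c_le)
  have hTd := hT.1.differentiableAt ((isOpen_lowerHalfDisc (e : ℂ) α).mem_nhds hzα)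
  have hdt : ∀ j, DifferentiableAt ℂ
      (fun w => d.left φ Δ w j * d.right ψ Δ w j / d.denom Δ w j) z := fun j => by
    obtain ⟨B, hB⟩ := (d.unifBddDeriv_left h he hφs j).mul ho (d.unifBddDeriv_right h he hψs j)
    obtain ⟨B', hB'⟩ := d.bdd_a j
    refine ((hB Δ hΔ).1.differentiableAt (ho.mem_nhds hz)).div ?_ (hC j Δ hΔ0 hΔ z hz).1
    exact (differentiableAt_id.const_sub _).add
      (((hB' Δ hΔ).1.differentiableAt (ho.mem_nhds hz)).const_mul _)
  have hder : deriv (fun w => inner ℂ φ (resolvent (perturbed L₀ W Δ) w ψ)) z =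
      deriv (fun w => inner ℂ φ (reducedResolvent (perturbed L₀ W Δ) (eigenspace L₀ e) w ψ)) z +
      ∑ j, deriv (fun w => d.left φ Δ w j * d.right ψ Δ w j / d.denom Δ w j) z := by
    have h1 : (fun w => inner ℂ φ (resolvent (perturbed L₀ W Δ) w ψ)) =ᶠ[𝓝 z] fun w =>
        inner ℂ φ (reducedResolvent (perturbed L₀ W Δ) (eigenspace L₀ e) w ψ) +
        ∑ j, d.left φ Δ w j * d.right ψ Δ w j / d.denom Δ w j := by
      filter_upwards [ho.mem_nhds hz] with w hw
      exact d.inner_resolvent h he hΔ hw (fun j => (hC j Δ hΔ0 hΔ w hw).1) φ ψ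
    rw [h1.deriv_eq]
    exact (hTd.hasDerivAt.add (HasDerivAt.fun_sum fun j _ => (hdt j).hasDerivAt)).deriv
  rw [singularPart, ← sum_fin_eq_sum_decayRange h he
    (fun j => Q j Δ ⟨φ, hφs⟩ ⟨ψ, hψs⟩ / (e + Δ ^ 2 * a j Δ - z) ^ 2), hder, add_sub_assoc,
    ← Finset.sum_sub_distrib]
  have hT1 := hT.2 1 (by omega) z hzα
  rw [iteratedDeriv_one] at hT1
  refine (norm_add_le _ _).trans ?_
  rw [add_mul, Finset.sum_mul]
  refine add_le_add (hT1.trans ?_) ((norm_sum_le _ _).trans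
    (Finset.sum_le_sum fun j _ => (hC j Δ hΔ0 hΔ z hz).2))
  nlinarith [mul_nonneg hC₀0 hX0]

end LocalTheorem

/-! ### Lorentzians. -/

section Lorentzian

theorem integrable_lorentzian {s : ℝ} (hs : 0 < s) (e : ℝ) :
    Integrable fun x : ℝ => s / ((x - e) ^ 2 + s ^ 2) := by
  have h1 := ((integrable_inv_one_add_sq.comp_div hs.ne').const_mul s⁻¹).comp_sub_right e
  refine h1.congr (Eventually.of_forall fun x => ?_)
  have : (x - e) ^ 2 + s ^ 2 ≠ 0 := by positivity
  have h2 : 1 + ((x - e) / s) ^ 2 ≠ 0 := by positivity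
  simp only
  field_simp
  ring

/-- By scaling, the mass does not depend on the width s. With s = Δ² this is the source of the
uniformity in the coupling. -/
theorem integral_lorentzian {s : ℝ} (hs : 0 < s) (e : ℝ) :
    ∫ x : ℝ, s / ((x - e) ^ 2 + s ^ 2) = Real.pi := by
  have h1 : ∀ x : ℝ, s / ((x - e) ^ 2 + s ^ 2) = s⁻¹ * (1 + ((x - e) / s) ^ 2)⁻¹ := fun x => by
    have : (x - e) ^ 2 + s ^ 2 ≠ 0 := by positivity
    have h2 : 1 + ((x - e) / s) ^ 2 ≠ 0 := by positivity
    field_simp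
    ring
  simp only [h1]
  rw [integral_sub_right_eq_self (fun x => s⁻¹ * (1 + (x / s) ^ 2)⁻¹) e, integral_const_mul,
    Measure.integral_comp_div (fun x : ℝ => (1 + x ^ 2)⁻¹) s, integral_univ_inv_one_add_sq,
    abs_of_pos hs, smul_eq_mul, inv_mul_cancel_left₀ hs.ne']

end Lorentzian

/-! ### The strips around the eigenvalues, away from the resonances. -/

section OffResonance

set_option linter.unusedSectionVars false

variable {H : Type*} [NormedAddCommGroup H] [InnerProductSpace ℂ H] [CompleteSpace H]
  {L₀ W : H →ₗ.[ℂ] H} {Δ₀ α : ℝ} {D : Set H} {stab unst : Finset ℝ} {E : ℝ → ℝ → ℝ}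
  {lam : ℝ → ℕ → ℂ} {e : ℝ} {m : ℕ}

/-- A Neumann estimate in the ℓ¹ norm without inverting a matrix: the row estimates are added, and
the perturbation is absorbed into half of the leading term. -/
theorem sum_norm_le_of_perturbation {N : Fin m → Fin m → ℂ} {x r : Fin m → ℂ} {w s : ℂ} {B ρ : ℝ}
    (hρ : 0 < ρ) (hw : ρ ≤ ‖w‖) (hN : ∀ i j, ‖N i j‖ ≤ B) (hs : m * (‖s‖ * B) ≤ ρ / 2)
    (heq : ∀ i, w * x i + s * ∑ j, N i j * x j = r i) :
    ∑ i, ‖x i‖ ≤ 2 / ρ * ∑ i, ‖r i‖ := by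
  set S := ∑ i, ‖x i‖ with hS
  have hS0 : 0 ≤ S := Finset.sum_nonneg fun _ _ => norm_nonneg _
  have h1 : ∀ i, ρ * ‖x i‖ ≤ ‖r i‖ + ‖s‖ * B * S := fun i => by
    have h2 : w * x i = r i - s * ∑ j, N i j * x j := by rw [← heq]; ring
    have h3 : ‖∑ j, N i j * x j‖ ≤ B * S := by
      refine (norm_sum_le _ _).trans ?_
      rw [hS, Finset.mul_sum]
      exact Finset.sum_le_sum fun j _ => by
        rw [norm_mul]; exact mul_le_mul_of_nonneg_right (hN i j) (norm_nonneg _)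
    calc ρ * ‖x i‖ ≤ ‖w * x i‖ := by rw [norm_mul]; gcongr
      _ ≤ ‖r i‖ + ‖s‖ * ‖∑ j, N i j * x j‖ := by
          rw [h2, ← norm_mul]; exact norm_sub_le _ _
      _ ≤ ‖r i‖ + ‖s‖ * (B * S) := by gcongr
      _ = _ := by ring
  have h4 : ρ * S ≤ ∑ i, ‖r i‖ + m * (‖s‖ * B * S) := by
    calc ρ * S = ∑ i, ρ * ‖x i‖ := Finset.mul_sum _ _ _
      _ ≤ ∑ i, (‖r i‖ + ‖s‖ * B * S) := Finset.sum_le_sum fun i _ => h1 i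
      _ = _ := by rw [Finset.sum_add_distrib, Finset.sum_const, Finset.card_univ, Fintype.card_fin,
        nsmul_eq_mul]
  have h5 : m * (‖s‖ * B * S) ≤ ρ / 2 * S := by
    calc m * (‖s‖ * B * S) = m * (‖s‖ * B) * S := by ring
      _ ≤ _ := by gcongr
  rw [div_mul_eq_mul_div, le_div_iff₀ hρ]
  linarith

/-- Near the eigenvalue `e`, but away from the resonances, the resolvent is bounded. -/
theorem ResonanceAssumptions.exists_bound_off_resonance
    (h : ResonanceAssumptions L₀ W Δ₀ α D stab unst E lam) (he : e ∈ stab ∪ unst) {δ : ℝ}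
    (hδ : 0 < δ) :
    ∃ c > 0, ∀ φ ∈ D, ∀ ψ ∈ D, ∃ C, 0 ≤ C ∧ ∀ Δ : ℝ, |Δ| < c → |Δ| ≤ Δ₀ → ∀ z : ℂ, z.im < 0 →
      |z.re - e| ≤ α → δ ≤ ‖z - e‖ →
      ‖deriv (fun w => inner ℂ φ (resolvent (perturbed L₀ W Δ) w ψ)) z‖ ≤ C := by
  obtain ⟨b⟩ := h.exists_levelBasis he
  have hfd := h.finiteDimensional e
  set m := mult L₀ e
  let B := boundedComp W (eigProj L₀ e)
  let T : ℝ → ℂ → H →L[ℂ] H := fun Δ z => reducedResolvent (perturbed L₀ W Δ) (eigenspace L₀ e) z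
  have hbd : ∀ φ ∈ D, ∀ ψ ∈ D, ∃ C, 0 ≤ C ∧ ∀ Δ : ℝ, |Δ| ≤ Δ₀ → ∀ z : ℂ, z.im < 0 →
      |z.re - e| ≤ α → ‖inner ℂ φ (T Δ z ψ)‖ ≤ C ∧
        ‖deriv (fun z => inner ℂ φ (T Δ z ψ)) z‖ ≤ C := fun φ hφ ψ hψ => by
    obtain ⟨C, hC0, hC⟩ := (h.unifBddDeriv_strip he hφ hψ).exists_nonneg_bound
    refine ⟨C, hC0, fun Δ hΔ z hz hz' => ⟨?_, ?_⟩⟩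
    · simpa only [iteratedDeriv_zero] using (hC Δ hΔ).2 0 (by omega) z ⟨hz, hz'⟩
    · simpa only [iteratedDeriv_one] using (hC Δ hΔ).2 1 (by omega) z ⟨hz, hz'⟩
  have hd : ∀ Δ : ℝ, |Δ| ≤ Δ₀ → ∀ z : ℂ, z.im < 0 → ∀ φ ψ,
      DifferentiableAt ℂ (fun z => inner ℂ φ (T Δ z ψ)) z := fun Δ hΔ z hz φ ψ =>
    differentiableAt_inner_reducedResolvent (h.selfAdjoint Δ hΔ) (h.eigenspace_le_domain he Δ) hz φ ψ
  have hmatd : ∀ Δ z i j, HasDerivAt (fun z => inner ℂ (B (b.dual i)) (T Δ z (B (b.vec j))))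
      (deriv (fun z => inner ℂ (B (b.dual i)) (T Δ z (B (b.vec j)))) z) z →
      HasDerivAt (fun z => b.mat Δ z i j)
        (-deriv (fun z => inner ℂ (B (b.dual i)) (T Δ z (B (b.vec j)))) z) z := fun Δ z i j h1 => h1.neg
  have hBv := fun j => h.boundedComp_mem he (b.vec_mem j)
  have hBd := fun j => h.boundedComp_mem he (b.dual_mem j)
  choose N hN0 hN using fun i j => hbd _ (hBd i) _ (hBv j)
  set N' : ℝ := ∑ i, ∑ j, N i j
  have hN'0 : 0 ≤ N' := Finset.sum_nonneg fun i _ => Finset.sum_nonneg fun j _ => hN0 i j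
  have hNN' : ∀ i j, N i j ≤ N' := fun i j =>
    (Finset.single_le_sum (f := fun j => N i j) (fun j _ => hN0 i j) (Finset.mem_univ j)).trans
      (Finset.single_le_sum (f := fun i => ∑ j, N i j)
        (fun i _ => Finset.sum_nonneg fun j _ => hN0 i j) (Finset.mem_univ i))
  refine ⟨min 1 (δ / 2 / (m * N' + 1)), lt_min one_pos (by positivity), fun φ hφ ψ hψ => ?_⟩
  obtain ⟨F, hF0, hF⟩ := hbd φ hφ ψ hψ
  choose l hl0 hl using fun j => hbd φ hφ _ (hBv j)
  choose r hr0 hr using fun i => hbd _ (hBd i) ψ hψ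
  -- X bounds the coordinates of R_zψ in Ran P_e, and Y below bounds their derivatives in z.
  set X : ℝ := 2 / δ * ∑ i, (‖inner ℂ (b.dual i) ψ‖ + r i)
  set Y : ℝ := 2 / δ * ∑ i, (r i + X + N' * X)
  have hX0 : 0 ≤ X := mul_nonneg (by positivity)
    (Finset.sum_nonneg fun i _ => add_nonneg (norm_nonneg _) (hr0 i))
  have hY0 : 0 ≤ Y := mul_nonneg (by positivity)
    (Finset.sum_nonneg fun i _ => by have := hr0 i; positivity)
  refine ⟨F + ∑ i, (l i * X + (‖inner ℂ φ (b.vec i)‖ + l i) * Y), add_nonneg hF0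
    (Finset.sum_nonneg fun i _ => by have := hl0 i; positivity), fun Δ hΔc hΔ z hz hz' hzδ => ?_⟩
  have hΔ1 : |Δ| ≤ 1 := hΔc.le.trans (min_le_left _ _)
  have hΔsq : Δ ^ 2 ≤ |Δ| := by rw [← sq_abs]; nlinarith [abs_nonneg Δ]
  have hs : ‖(Δ : ℂ) ^ 2‖ = Δ ^ 2 := by rw [norm_pow, Complex.norm_real, Real.norm_eq_abs, sq_abs]
  have hsmall : m * (‖(Δ : ℂ) ^ 2‖ * N') ≤ δ / 2 := by
    have h1 : |Δ| < δ / 2 / (m * N' + 1) := hΔc.trans_le (min_le_right _ _)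
    rw [lt_div_iff₀ (by positivity)] at h1
    rw [hs]
    have h2 : 0 ≤ m * N' := by positivity
    calc m * (Δ ^ 2 * N') = Δ ^ 2 * (m * N') := by ring
      _ ≤ |Δ| * (m * N') := by gcongr
      _ ≤ δ / 2 := by nlinarith [abs_nonneg Δ]
  have hw : δ ≤ ‖(e : ℂ) - z‖ := by rwa [norm_sub_rev]
  have hmat : ∀ i j, ‖b.mat Δ z i j‖ ≤ N' := fun i j => by
    rw [LevelBasis.mat, norm_neg]
    exact (hN i j Δ hΔ z hz hz').1.trans (hNN' i j)
  have hmat' : ∀ i j, ‖-deriv (fun z => inner ℂ (B (b.dual i)) (T Δ z (B (b.vec j)))) z‖ ≤ N' :=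
    fun i j => by rw [norm_neg]; exact (hN i j Δ hΔ z hz hz').2.trans (hNN' i j)
  let x : Fin m → ℂ → ℂ := fun i z => inner ℂ (b.dual i) (resolvent (perturbed L₀ W Δ) z ψ)
  have hx : ∀ i, HasDerivAt (x i) (deriv (x i) z) z := fun i =>
    (differentiableAt_inner_resolvent (h.selfAdjoint Δ hΔ) hz _ _).hasDerivAt
  have heq : ∀ w : ℂ, w.im < 0 → ∀ i, ((e : ℂ) - w) * x i w + Δ ^ 2 * ∑ j, b.mat Δ w i j * x j w =
      inner ℂ (b.dual i) ψ - Δ * inner ℂ (B (b.dual i)) (T Δ w ψ) := fun w hw i => by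
    obtain ⟨hu, e1⟩ := (isResolvent_resolvent (h.selfAdjoint Δ hΔ) hw.ne).1 ψ
    have h1 := b.feshbach_equation h he hΔ hw.ne hu i
    rw [e1] at h1
    exact h1
  have hfeq : ∀ w : ℂ, w.im < 0 → inner ℂ φ (resolvent (perturbed L₀ W Δ) w ψ) =
      inner ℂ φ (T Δ w ψ) +
        ∑ i, (inner ℂ φ (b.vec i) - Δ * inner ℂ φ (T Δ w (B (b.vec i)))) * x i w := fun w hw => by
    obtain ⟨hu, e1⟩ := (isResolvent_resolvent (h.selfAdjoint Δ hΔ) hw.ne).1 ψ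
    have h1 := b.inner_eq h he hΔ hw.ne hu φ
    rw [e1] at h1
    exact h1
  have hnhds : ∀ᶠ w in 𝓝 z, w.im < 0 :=
    (isOpen_lt Complex.continuous_im continuous_const).mem_nhds hz
  have hXb : ∑ i, ‖x i z‖ ≤ X := by
    refine (sum_norm_le_of_perturbation hδ hw hmat hsmall (heq z hz)).trans ?_
    refine mul_le_mul_of_nonneg_left (Finset.sum_le_sum fun i _ => ?_) (by positivity)
    refine (norm_sub_le _ _).trans ?_
    rw [norm_mul, Complex.norm_real, Real.norm_eq_abs]
    gcongr
    calc _ ≤ 1 * ‖inner ℂ (B (b.dual i)) (T Δ z ψ)‖ := by gcongr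
      _ ≤ r i := by rw [one_mul]; exact (hr i Δ hΔ z hz hz').1
  have hxX : ∀ i, ‖x i z‖ ≤ X := fun i =>
    (Finset.single_le_sum (f := fun i => ‖x i z‖) (fun i _ => norm_nonneg _)
      (Finset.mem_univ i)).trans hXb
  -- Differentiating the Feshbach system gives a system with the same matrix for the derivatives, so
  -- the same estimate applies. The derivatives of the coefficients move to the right side.
  have heq' : ∀ i, ((e : ℂ) - z) * deriv (x i) z + Δ ^ 2 * ∑ j, b.mat Δ z i j * deriv (x j) z =
      -(Δ * deriv (fun w => inner ℂ (B (b.dual i)) (T Δ w ψ)) z) + x i z - Δ ^ 2 * ∑ j,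
        (-deriv (fun z => inner ℂ (B (b.dual i)) (T Δ z (B (b.vec j)))) z) * x j z := fun i => by
    have h1 : HasDerivAt (fun w => ((e : ℂ) - w) * x i w + Δ ^ 2 * ∑ j, b.mat Δ w i j * x j w)
        (-1 * x i z + ((e : ℂ) - z) * deriv (x i) z + Δ ^ 2 * ∑ j,
          (-deriv (fun z => inner ℂ (B (b.dual i)) (T Δ z (B (b.vec j)))) z * x j z +
            b.mat Δ z i j * deriv (x j) z)) z :=
      (((hasDerivAt_id z).const_sub (e : ℂ)).mul (hx i)).add
        ((HasDerivAt.fun_sum fun j _ =>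
          (hmatd Δ z i j (hd Δ hΔ z hz _ _).hasDerivAt).mul (hx j)).const_mul _)
    have h2 : HasDerivAt (fun w => inner ℂ (b.dual i) ψ - Δ * inner ℂ (B (b.dual i)) (T Δ w ψ))
        (-(Δ * deriv (fun w => inner ℂ (B (b.dual i)) (T Δ w ψ)) z)) z :=
      ((hd Δ hΔ z hz _ _).hasDerivAt.const_mul _).const_sub _
    have h3 := h1.unique (h2.congr_of_eventuallyEq (hnhds.mono fun w hw => heq w hw i))
    rw [Finset.sum_add_distrib] at h3
    linear_combination h3
  have hYb : ∑ i, ‖deriv (x i) z‖ ≤ Y := by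
    refine (sum_norm_le_of_perturbation hδ hw hmat hsmall heq').trans ?_
    refine mul_le_mul_of_nonneg_left (Finset.sum_le_sum fun i _ => ?_) (by positivity)
    refine (norm_sub_le _ _).trans (add_le_add ((norm_add_le _ _).trans (add_le_add ?_ (hxX i))) ?_)
    · rw [norm_neg, norm_mul, Complex.norm_real, Real.norm_eq_abs]
      calc _ ≤ 1 * ‖deriv (fun w => inner ℂ (B (b.dual i)) (T Δ w ψ)) z‖ := by gcongr
        _ ≤ r i := by rw [one_mul]; exact (hr i Δ hΔ z hz hz').2
    · rw [norm_mul, hs]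
      have h1 : ‖∑ j, -deriv (fun z => inner ℂ (B (b.dual i)) (T Δ z (B (b.vec j)))) z * x j z‖ ≤
          N' * X := by
        refine (norm_sum_le _ _).trans (le_trans ?_ (mul_le_mul_of_nonneg_left hXb hN'0))
        rw [Finset.mul_sum]
        exact Finset.sum_le_sum fun j _ => by
          rw [norm_mul]; exact mul_le_mul_of_nonneg_right (hmat' i j) (norm_nonneg _)
      calc _ ≤ 1 * (N' * X) := by gcongr; linarith
        _ = _ := one_mul _
  have hyY : ∀ i, ‖deriv (x i) z‖ ≤ Y := fun i =>
    (Finset.single_le_sum (f := fun i => ‖deriv (x i) z‖) (fun i _ => norm_nonneg _)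
      (Finset.mem_univ i)).trans hYb
  have hfd' : HasDerivAt (fun w => inner ℂ φ (resolvent (perturbed L₀ W Δ) w ψ))
      (deriv (fun w => inner ℂ φ (T Δ w ψ)) z + ∑ i,
        (-(Δ * deriv (fun w => inner ℂ φ (T Δ w (B (b.vec i)))) z) * x i z +
          (inner ℂ φ (b.vec i) - Δ * inner ℂ φ (T Δ z (B (b.vec i)))) * deriv (x i) z)) z := by
    refine HasDerivAt.congr_of_eventuallyEq ?_ (hnhds.mono fun w hw => hfeq w hw)
    exact (hd Δ hΔ z hz _ _).hasDerivAt.add (HasDerivAt.fun_sum fun i _ =>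
      (((hd Δ hΔ z hz _ _).hasDerivAt.const_mul _).const_sub _).mul (hx i))
  rw [hfd'.deriv]
  refine (norm_add_le _ _).trans (add_le_add (hF Δ hΔ z hz hz').2 ((norm_sum_le _ _).trans
    (Finset.sum_le_sum fun i _ => (norm_add_le _ _).trans (add_le_add ?_ ?_))))
  · rw [norm_mul, norm_neg, norm_mul, Complex.norm_real, Real.norm_eq_abs]
    refine mul_le_mul ?_ (hxX i) (norm_nonneg _) (hl0 i)
    calc _ ≤ 1 * ‖deriv (fun w => inner ℂ φ (T Δ w (B (b.vec i)))) z‖ := by gcongr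
      _ ≤ l i := by rw [one_mul]; exact (hl i Δ hΔ z hz hz').2
  · rw [norm_mul]
    refine mul_le_mul ?_ (hyY i) (norm_nonneg _) (by have := hl0 i; positivity)
    refine (norm_sub_le _ _).trans ?_
    rw [norm_mul, Complex.norm_real, Real.norm_eq_abs]
    gcongr
    calc _ ≤ 1 * ‖inner ℂ φ (T Δ z (B (b.vec i)))‖ := by gcongr
      _ ≤ l i := by rw [one_mul]; exact (hl i Δ hΔ z hz hz').1

end OffResonance

/-! ### Decay of the resolvent at high energies. -/

section HighEnergy

set_option linter.unusedSectionVars false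

variable {H : Type*} [NormedAddCommGroup H] [InnerProductSpace ℂ H] [CompleteSpace H]
  {L₀ W : H →ₗ.[ℂ] H} {Δ₀ α : ℝ} {D : Set H} {stab unst : Finset ℝ} {E : ℝ → ℝ → ℝ}
  {lam : ℝ → ℕ → ℂ} {e : ℝ} {m : ℕ}

/-- The relation zR_z = AR_z - 1 is used twice, A going once onto φ and once onto ψ. After
differentiation every term is O(|z|⁻²), which is integrable in Re z. -/
theorem inner_resolvent_expansion {A : H →ₗ.[ℂ] H} (hA : IsSelfAdjoint A) {z : ℂ} (hz : z.im < 0)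
    {φ ψ : H} (hφ : φ ∈ A.domain) (hψ : ψ ∈ A.domain) :
    inner ℂ φ (resolvent A z ψ) = -inner ℂ φ ψ / z - inner ℂ φ (A ⟨ψ, hψ⟩) / z ^ 2 +
      inner ℂ (A ⟨φ, hφ⟩) (resolvent A z (A ⟨ψ, hψ⟩)) / z ^ 2 := by
  have hz0 : z ≠ 0 := fun h0 => by rw [h0] at hz; exact lt_irrefl _ hz
  have hR := isResolvent_resolvent hA hz.ne
  have h1 : ∀ y, z * inner ℂ φ (resolvent A z y) =
      inner ℂ (A ⟨φ, hφ⟩) (resolvent A z y) - inner ℂ φ y := fun y => by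
    obtain ⟨hu, e1⟩ := hR.1 y
    have h2 := inner_symm hA ⟨φ, hφ⟩ ⟨resolvent A z y, hu⟩
    have h3 : inner ℂ φ y = inner ℂ φ (A ⟨resolvent A z y, hu⟩ - z • resolvent A z y) := by rw [e1]
    rw [h3, inner_sub_right, inner_smul_right, ← h2]
    ring
  have h4 := congrArg (fun x => inner ℂ φ x) (hR.apply_map ⟨ψ, hψ⟩)
  simp only [inner_add_right, inner_smul_right] at h4
  have h5 := h1 (A ⟨ψ, hψ⟩)
  rw [h4] at h5
  field_simp
  linear_combination h5

theorem norm_deriv_inner_resolvent_le {A : H →ₗ.[ℂ] H} (hA : IsSelfAdjoint A) {z : ℂ}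
    (hz : z.im < 0) {φ ψ : H} (hφ : φ ∈ A.domain) (hψ : ψ ∈ A.domain) {C : ℝ}
    (hz1 : 1 ≤ ‖z‖) (h0 : ‖inner ℂ φ ψ‖ ≤ C) (h1 : ‖inner ℂ φ (A ⟨ψ, hψ⟩)‖ ≤ C)
    (h2 : ‖inner ℂ (A ⟨φ, hφ⟩) (resolvent A z (A ⟨ψ, hψ⟩))‖ ≤ C)
    (h3 : ‖deriv (fun w => inner ℂ (A ⟨φ, hφ⟩) (resolvent A w (A ⟨ψ, hψ⟩))) z‖ ≤ C) :
    ‖deriv (fun w => inner ℂ φ (resolvent A w ψ)) z‖ ≤ 6 * C / ‖z‖ ^ 2 := by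
  have hz0 : z ≠ 0 := norm_pos_iff.mp (by linarith)
  set k : ℂ → ℂ := fun w => inner ℂ (A ⟨φ, hφ⟩) (resolvent A w (A ⟨ψ, hψ⟩))
  have hk : HasDerivAt k (deriv k z) z := (differentiableAt_inner_resolvent hA hz _ _).hasDerivAt
  have hnhds : ∀ᶠ w in 𝓝 z, w.im < 0 :=
    (isOpen_lt Complex.continuous_im continuous_const).mem_nhds hz
  have hp : HasDerivAt (fun w : ℂ => w ^ 2) (2 * z) z := by simpa using hasDerivAt_pow 2 z
  have hsq : z ^ 2 ≠ 0 := pow_ne_zero 2 hz0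
  have hd : HasDerivAt (fun w => inner ℂ φ (resolvent A w ψ))
      ((inner ℂ φ ψ + (2 * inner ℂ φ (A ⟨ψ, hψ⟩) - 2 * k z) / z + deriv k z) / z ^ 2) z := by
    refine HasDerivAt.congr_of_eventuallyEq (f := fun w => -inner ℂ φ ψ / w -
      inner ℂ φ (A ⟨ψ, hψ⟩) / w ^ 2 + k w / w ^ 2) ?_
      (hnhds.mono fun w hw => inner_resolvent_expansion hA hw hφ hψ)
    refine ((((hasDerivAt_const z (-inner ℂ φ ψ)).div (hasDerivAt_id z) hz0).sub
      ((hasDerivAt_const z (inner ℂ φ (A ⟨ψ, hψ⟩))).div hp hsq)).add (hk.div hp hsq)).congr_deriv ?_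
    simp only [id]
    field_simp
    ring
  have hC : 0 ≤ C := (norm_nonneg _).trans h0
  rw [hd.deriv, norm_div, norm_pow]
  gcongr
  have h4 : ‖(2 * inner ℂ φ (A ⟨ψ, hψ⟩) - 2 * k z) / z‖ ≤ 4 * C := by
    rw [norm_div]
    refine (div_le_self (norm_nonneg _) hz1).trans ((norm_sub_le _ _).trans ?_)
    rw [norm_mul, norm_mul, RCLike.norm_ofNat]
    linarith
  refine (norm_add₃_le).trans ?_
  linarith

/-- The couplings for which the expansion of the resolvent at high energies is controlled. -/
def HighEnergyCoupling (L₀ W : H →ₗ.[ℂ] H) (Δ₀ : ℝ) (D : Set H) (φ ψ : H) (Δ : ℝ) : Prop :=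
  Δ ≠ 0 ∧ |Δ| ≤ Δ₀ ∧ ∃ (hφ : φ ∈ (perturbed L₀ W Δ).domain) (hψ : ψ ∈ (perturbed L₀ W Δ).domain),
    perturbed L₀ W Δ ⟨φ, hφ⟩ ∈ D ∧ perturbed L₀ W Δ ⟨ψ, hψ⟩ ∈ D

/-- The difference of the two images is (Δ - Δ')Wφ, so Wφ and then L₀φ lie in the span of D. All
L(Δ)φ are thus combinations of two fixed vectors. -/
theorem mem_span_of_two_couplings {Δ Δ' : ℝ} (hΔ : Δ ≠ 0) (hΔ' : Δ' ≠ 0) (hne : Δ ≠ Δ') {φ : H}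
    (hφ : φ ∈ (perturbed L₀ W Δ).domain) (hφ' : φ ∈ (perturbed L₀ W Δ').domain)
    (h1 : perturbed L₀ W Δ ⟨φ, hφ⟩ ∈ D) (h2 : perturbed L₀ W Δ' ⟨φ, hφ'⟩ ∈ D) :
    ∃ x ∈ Submodule.span ℂ D, ∃ y ∈ Submodule.span ℂ D, ∀ Δ : ℝ, Δ ≠ 0 →
      ∀ hφ : φ ∈ (perturbed L₀ W Δ).domain, perturbed L₀ W Δ ⟨φ, hφ⟩ = x + (Δ : ℂ) • y := by
  have hd := (perturbed_mem_domain_iff hΔ).mp hφ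
  have key : ∀ Δ : ℝ, Δ ≠ 0 → ∀ hφ : φ ∈ (perturbed L₀ W Δ).domain,
      perturbed L₀ W Δ ⟨φ, hφ⟩ = L₀ ⟨φ, hd.1⟩ + (Δ : ℂ) • W ⟨φ, hd.2⟩ := fun Δ hΔ hφ =>
    perturbed_apply hΔ hφ
  have hsub : (Δ : ℂ) - Δ' ≠ 0 := by
    rw [sub_ne_zero]; exact_mod_cast hne
  have hW : W ⟨φ, hd.2⟩ ∈ Submodule.span ℂ D := by
    have h3 := Submodule.smul_mem _ ((Δ : ℂ) - Δ')⁻¹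
      (Submodule.sub_mem _ (Submodule.subset_span h1) (Submodule.subset_span (R := ℂ) h2))
    rwa [key Δ hΔ hφ, key Δ' hΔ' hφ', add_sub_add_left_eq_sub, ← sub_smul, smul_smul,
      inv_mul_cancel₀ hsub, one_smul] at h3
  refine ⟨_, ?_, _, hW, key⟩
  have h3 := Submodule.sub_mem _ (Submodule.subset_span (R := ℂ) h1)
    (Submodule.smul_mem _ (Δ : ℂ) hW)
  rwa [key Δ hΔ hφ, add_sub_cancel_right] at h3

/-- The limiting absorption constant for Lφ and Lψ could depend on Δ through these vectors. The case
distinction on the number of admissible couplings makes it uniform. -/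
theorem ResonanceAssumptions.exists_bound_high_energy
    (h : ResonanceAssumptions L₀ W Δ₀ α D stab unst E lam) (φ ψ : H) :
    ∃ C, 0 ≤ C ∧ ∀ Δ : ℝ, HighEnergyCoupling L₀ W Δ₀ D φ ψ Δ → ∀ z : ℂ, z.im < 0 →
      (∀ e ∈ stab ∪ unst, α < |z.re - e|) → 1 ≤ ‖z‖ →
      ‖deriv (fun w => inner ℂ φ (resolvent (perturbed L₀ W Δ) w ψ)) z‖ ≤ C / ‖z‖ ^ 2 := by
  suffices hsuff : ∃ C, ∀ Δ : ℝ, Δ ≠ 0 → |Δ| ≤ Δ₀ → ∀ (hφ : φ ∈ (perturbed L₀ W Δ).domain)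
      (hψ : ψ ∈ (perturbed L₀ W Δ).domain), perturbed L₀ W Δ ⟨φ, hφ⟩ ∈ D →
      perturbed L₀ W Δ ⟨ψ, hψ⟩ ∈ D → ∀ z : ℂ, z.im < 0 →
      (∀ e ∈ stab ∪ unst, α < |z.re - e|) →
      ‖inner ℂ φ (perturbed L₀ W Δ ⟨ψ, hψ⟩)‖ ≤ C ∧
      ‖inner ℂ (perturbed L₀ W Δ ⟨φ, hφ⟩) (resolvent (perturbed L₀ W Δ) z
        (perturbed L₀ W Δ ⟨ψ, hψ⟩))‖ ≤ C ∧
      ‖deriv (fun w => inner ℂ (perturbed L₀ W Δ ⟨φ, hφ⟩) (resolvent (perturbed L₀ W Δ) w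
        (perturbed L₀ W Δ ⟨ψ, hψ⟩))) z‖ ≤ C by
    obtain ⟨C, hC⟩ := hsuff
    refine ⟨6 * max C ‖inner ℂ φ ψ‖, by positivity, ?_⟩
    rintro Δ ⟨hΔ0, hΔ, hφ, hψ, hφD, hψD⟩ z hz hze hz1
    obtain ⟨h1, h2, h3⟩ := hC Δ hΔ0 hΔ hφ hψ hφD hψD z hz hze
    exact norm_deriv_inner_resolvent_le (h.selfAdjoint Δ hΔ) hz hφ hψ hz1 (le_max_right _ _)
      (h1.trans (le_max_left _ _)) (h2.trans (le_max_left _ _)) (h3.trans (le_max_left _ _))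
  -- Two admissible couplings give Lφ = x + Δy and Lψ = x' + Δy' with fixed vectors in the span of
  -- D, so the four constants for these pairs suffice for all Δ.
  by_cases htwo : ∃ Δ Δ', Δ ≠ Δ' ∧ HighEnergyCoupling L₀ W Δ₀ D φ ψ Δ ∧
      HighEnergyCoupling L₀ W Δ₀ D φ ψ Δ'
  · obtain ⟨Δ, Δ', hne, ⟨hΔ0, hΔ, hφ, hψ, hφD, hψD⟩, ⟨hΔ'0, hΔ', hφ', hψ', hφD', hψD'⟩⟩ := htwo
    obtain ⟨x, hx, y, hy, hxy⟩ := mem_span_of_two_couplings hΔ0 hΔ'0 hne hφ hφ' hφD hφD'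
    obtain ⟨x', hx', y', hy', hxy'⟩ := mem_span_of_two_couplings hΔ0 hΔ'0 hne hψ hψ' hψD hψD'
    obtain ⟨C₁, hC₁0, hC₁⟩ := (h.unifBddDeriv_away hx hx').exists_nonneg_bound
    obtain ⟨C₂, hC₂0, hC₂⟩ := (h.unifBddDeriv_away hx hy').exists_nonneg_bound
    obtain ⟨C₃, hC₃0, hC₃⟩ := (h.unifBddDeriv_away hy hx').exists_nonneg_bound
    obtain ⟨C₄, hC₄0, hC₄⟩ := (h.unifBddDeriv_away hy hy').exists_nonneg_bound
    have hΔ₀ := h.Δ₀_pos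
    set M := C₁ + Δ₀ * C₂ + Δ₀ * (C₃ + Δ₀ * C₄)
    set M' := ‖inner ℂ φ x'‖ + Δ₀ * ‖inner ℂ φ y'‖
    have hM0 : 0 ≤ M := by positivity
    have hM'0 : 0 ≤ M' := by positivity
    refine ⟨M + M', fun Δ hΔ0 hΔ hφ hψ _ _ z hz hze => ?_⟩
    have hsm : ∀ {k l : ℂ} {a b : ℝ}, ‖k‖ ≤ a → ‖l‖ ≤ b → ‖k + Δ * l‖ ≤ a + Δ₀ * b :=
      fun hk hl => (norm_add_le _ _).trans (add_le_add hk (by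
        rw [norm_mul, Complex.norm_real]
        exact mul_le_mul hΔ hl (norm_nonneg _) hΔ₀.le))
    have hexp : ∀ w, inner ℂ (x + (Δ : ℂ) • y) (resolvent (perturbed L₀ W Δ) w (x' + (Δ : ℂ) • y')) =
        inner ℂ x (resolvent (perturbed L₀ W Δ) w x') +
          Δ * inner ℂ x (resolvent (perturbed L₀ W Δ) w y') +
          Δ * (inner ℂ y (resolvent (perturbed L₀ W Δ) w x') +
            Δ * inner ℂ y (resolvent (perturbed L₀ W Δ) w y')) := fun w => by
      simp only [map_add, map_smul, inner_add_left, inner_add_right, inner_smul_left,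
        inner_smul_right, Complex.conj_ofReal]
      ring
    have hd := fun u v => (differentiableAt_inner_resolvent (h.selfAdjoint Δ hΔ) hz u v).hasDerivAt
    have hder := ((hd x x').add ((hd x y').const_mul (Δ : ℂ))).add
      (((hd y x').add ((hd y y').const_mul (Δ : ℂ))).const_mul (Δ : ℂ))
    have hb0 : ∀ {C : ℝ} {f : ℂ → ℂ}, (∀ k ≤ 1, ∀ z ∈ {z : ℂ | z.im < 0 ∧
        ∀ e ∈ stab ∪ unst, α < |z.re - e|}, ‖iteratedDeriv k f z‖ ≤ C) → ‖f z‖ ≤ C := fun hf => by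
      simpa only [iteratedDeriv_zero] using hf 0 (by omega) z ⟨hz, hze⟩
    have hb1 : ∀ {C : ℝ} {f : ℂ → ℂ}, (∀ k ≤ 1, ∀ z ∈ {z : ℂ | z.im < 0 ∧
        ∀ e ∈ stab ∪ unst, α < |z.re - e|}, ‖iteratedDeriv k f z‖ ≤ C) → ‖deriv f z‖ ≤ C := fun hf => by
      simpa only [iteratedDeriv_one] using hf 1 le_rfl z ⟨hz, hze⟩
    rw [hxy Δ hΔ0 hφ, hxy' Δ hΔ0 hψ]
    simp only [hexp]
    refine ⟨?_, ?_, ?_⟩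
    · rw [inner_add_right, inner_smul_right]
      exact (hsm le_rfl le_rfl).trans (by linarith)
    · exact (hsm (hsm (hb0 (hC₁ Δ hΔ).2) (hb0 (hC₂ Δ hΔ).2))
        (hsm (hb0 (hC₃ Δ hΔ).2) (hb0 (hC₄ Δ hΔ).2))).trans (by linarith)
    · have h1 := hder.deriv
      refine le_trans (le_of_eq (congrArg norm h1)) ?_
      exact (hsm (hsm (hb1 (hC₁ Δ hΔ).2) (hb1 (hC₂ Δ hΔ).2))
        (hsm (hb1 (hC₃ Δ hΔ).2) (hb1 (hC₄ Δ hΔ).2))).trans (by linarith)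
  -- With at most one admissible coupling there is nothing to be uniform in.
  · by_cases hone : ∃ Δ, HighEnergyCoupling L₀ W Δ₀ D φ ψ Δ
    · obtain ⟨Δ, hΔ⟩ := hone
      obtain ⟨-, hΔ1, hφ, hψ, hφD, hψD⟩ := id hΔ
      obtain ⟨C, hC0, hC⟩ := (h.unifBddDeriv_away (Submodule.subset_span hφD)
        (Submodule.subset_span hψD)).exists_nonneg_bound
      refine ⟨C + ‖inner ℂ φ (perturbed L₀ W Δ ⟨ψ, hψ⟩)‖,
        fun Δ' hΔ'0 hΔ' hφ' hψ' hφD' hψD' z hz hze => ?_⟩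
      have heq : Δ = Δ' := by
        by_contra hne
        exact htwo ⟨Δ, Δ', hne, hΔ, hΔ'0, hΔ', hφ', hψ', hφD', hψD'⟩
      subst heq
      have h0 := (hC Δ hΔ').2 0 (by omega) z ⟨hz, hze⟩
      have h1 := (hC Δ hΔ').2 1 le_rfl z ⟨hz, hze⟩
      rw [iteratedDeriv_zero] at h0
      rw [iteratedDeriv_one] at h1
      exact ⟨le_add_of_nonneg_left hC0, h0.trans (le_add_of_nonneg_right (norm_nonneg _)),
        h1.trans (le_add_of_nonneg_right (norm_nonneg _))⟩
    · exact ⟨0, fun Δ hΔ0 hΔ hφ hψ hφD hψD => absurd ⟨Δ, hΔ0, hΔ, hφ, hψ, hφD, hψD⟩ hone⟩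

end HighEnergy

/-! ### Gluing the regimes into one integrable bound. -/

section GlobalBound

set_option linter.unusedSectionVars false

variable {H : Type*} [NormedAddCommGroup H] [InnerProductSpace ℂ H] [CompleteSpace H]
  {L₀ W : H →ₗ.[ℂ] H} {Δ₀ α : ℝ} {D : Set H} {stab unst : Finset ℝ} {E : ℝ → ℝ → ℝ}
  {lam : ℝ → ℕ → ℂ} {e : ℝ} {m : ℕ}

theorem abs_re_sub_le (z : ℂ) (e : ℝ) : |z.re - e| ≤ ‖z - e‖ := by
  simpa using Complex.abs_re_le_norm (z - e)

theorem one_le_mul_inv_one_add_sq {x e ρ : ℝ} (h : |x - e| ≤ ρ) :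
    1 ≤ (1 + (|e| + ρ) ^ 2) * (1 / (1 + x ^ 2)) := by
  rw [mul_one_div, one_le_div (by positivity)]
  have h1 : |x| ≤ |e| + ρ := by
    have := abs_add_le (x - e) e
    rw [sub_add_cancel] at this
    linarith
  have h2 := pow_le_pow_left₀ (abs_nonneg x) h1 2
  rw [sq_abs] at h2
  linarith

theorem inv_norm_sub_sq_le {z : ℂ} {e δ : ℝ} (hδ : 0 < δ) (hz : δ ≤ ‖z - e‖) :
    1 / ‖z - e‖ ^ 2 ≤ ((1 + 2 * e ^ 2) / δ ^ 2 + 2) * (1 / (1 + z.re ^ 2)) := by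
  have hz0 : 0 < ‖z - e‖ := hδ.trans_le hz
  rw [mul_one_div, div_le_div_iff₀ (by positivity) (by positivity), one_mul]
  have h1 := pow_le_pow_left₀ (abs_nonneg _) (abs_re_sub_le z e) 2
  rw [sq_abs] at h1
  have h2 := pow_le_pow_left₀ hδ.le hz 2
  have h3 : 1 + 2 * e ^ 2 ≤ (1 + 2 * e ^ 2) / δ ^ 2 * ‖z - e‖ ^ 2 := by
    rw [div_mul_eq_mul_div, le_div_iff₀ (by positivity)]
    gcongr
  nlinarith [sq_nonneg (z.re - 2 * e)]

/-- All poles lie within δ/2 of e, so outside the disc of radius δ they are at distance at least |z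
- e|/2 from z. The square of this factor accounts for the 4. -/
theorem norm_singularPart_le {a : ℕ → ℝ → ℂ} {Δ δ B : ℝ} {q : ℕ → ℂ} {q₀ z : ℂ} (hδ : 0 < δ)
    (hB : ∀ j ∈ decayRange L₀ stab e, ‖q j‖ ≤ B) (hq₀ : ‖q₀‖ ≤ B)
    (ha : ∀ j ∈ decayRange L₀ stab e, ‖(Δ : ℂ) ^ 2 * a j Δ‖ ≤ δ / 2)
    (hE : e ∈ stab → |E e Δ - e| ≤ δ / 2) (hz : δ ≤ ‖z - e‖) :
    ‖singularPart L₀ stab E a e Δ q q₀ z‖ ≤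
      ((decayRange L₀ stab e).card + 1) * (4 * B) * (1 / ‖z - e‖ ^ 2) := by
  have hB0 : 0 ≤ B := (norm_nonneg _).trans hq₀
  have hz0 : 0 < ‖z - e‖ := hδ.trans_le hz
  have key : ∀ p w : ℂ, ‖p‖ ≤ B → ‖w‖ ≤ δ / 2 → ‖p / (e + w - z) ^ 2‖ ≤
      4 * B * (1 / ‖z - e‖ ^ 2) := fun p w hp hw => by
    have h1 : ‖z - e‖ / 2 ≤ ‖e + w - z‖ := by
      have h2 := norm_sub_le w (e + w - z)
      rw [show w - (e + w - z) = z - e by ring] at h2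
      linarith
    have h3 := pow_le_pow_left₀ (by positivity) h1 2
    rw [norm_div, norm_pow, mul_one_div]
    refine (div_le_div₀ hB0 hp (by positivity) h3).trans_eq ?_
    field_simp
    norm_num
  rw [singularPart]
  refine (norm_add_le _ _).trans ?_
  rw [add_mul, add_mul, one_mul]
  refine add_le_add ?_ ?_
  · refine (norm_sum_le _ _).trans ((Finset.sum_le_card_nsmul _ _ (4 * B * (1 / ‖z - e‖ ^ 2))
      fun j hj => key _ _ (hB j hj) (ha j hj)).trans_eq ?_)
    rw [nsmul_eq_mul]; ring
  · split_ifs with hs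
    · have h1 := key q₀ ((E e Δ : ℂ) - e) hq₀ (by
        rw [← Complex.ofReal_sub, Complex.norm_real]; exact hE hs)
      rwa [add_sub_cancel] at h1
    · rw [norm_zero]; positivity

theorem norm_inner_orthProj_le (V : Submodule ℂ H) (φ ψ : H) :
    ‖inner ℂ φ (orthProj V ψ)‖ ≤ ‖φ‖ * ‖ψ‖ :=
  (norm_inner_le_norm _ _).trans (mul_le_mul_of_nonneg_left
    (Submodule.norm_starProjection_apply_le _ _) (norm_nonneg _))

set_option maxHeartbeats 1000000 in
/-- The resonance expansion of the resolvent. -/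
theorem ResonanceAssumptions.exists_resonances
    (h : ResonanceAssumptions L₀ W Δ₀ α D stab unst E lam) :
    ∃ c > 0, c ≤ Δ₀ ∧ ∃ (a : ℝ → ℕ → ℝ → ℂ) (Q : ℝ → ℕ → ℝ → SesqForm D),
      (∃ C, ∀ e j, IsDecayIndex L₀ stab unst e j → ∀ Δ : ℝ, |Δ| < c →
        ‖a e j Δ - lam e j‖ ≤ C * |Δ| ∧ 0 < (a e j Δ).im) ∧
      (∀ (φ : H) (hφ : φ ∈ D) (ψ : H) (hψ : ψ ∈ D), ∃ C, ∀ e j, IsDecayIndex L₀ stab unst e j →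
        ∀ Δ : ℝ, |Δ| < c →
          ‖Q e j Δ ⟨φ, Submodule.subset_span hφ⟩ ⟨ψ, Submodule.subset_span hψ⟩ -
            inner ℂ φ (levelProj L₀ W e (lam e j) ψ)‖ ≤ C * |Δ|) ∧
      ∀ (φ : H) (hφ : φ ∈ D) (ψ : H) (hψ : ψ ∈ D), ∃ C, ∀ Δ : ℝ, |Δ| < c →
        HighEnergyCoupling L₀ W Δ₀ D φ ψ Δ → ∀ z : ℂ, z.im < 0 →
          ‖deriv (fun w => inner ℂ φ (resolvent (perturbed L₀ W Δ) w ψ)) z -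
            ∑ e ∈ stab ∪ unst, singularPart L₀ stab E (a e) e Δ
              (fun j => Q e j Δ ⟨φ, Submodule.subset_span hφ⟩ ⟨ψ, Submodule.subset_span hψ⟩)
              (inner ℂ φ (eigProj (perturbed L₀ W Δ) (E e Δ) ψ)) z‖ ≤
            C * (1 / (1 + z.re ^ 2) + ∑ e ∈ stab ∪ unst, Δ ^ 2 / ((z.re - e) ^ 2 + (Δ ^ 2) ^ 2)) := by
  set ev := stab ∪ unst with hev
  have hidx : ∀ {e j}, IsDecayIndex L₀ stab unst e j → e ∈ ev := fun hj =>
    Finset.mem_union.mpr (hj.2.elim Or.inr fun h => Or.inl h.1)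
  have hloc : ∀ e : ℝ, ∃ δ > 0, ∃ c > 0, ∃ (a : ℕ → ℝ → ℂ) (Q : ℕ → ℝ → SesqForm D), ∀ _ : e ∈ ev,
      (∃ C, ∀ j, IsDecayIndex L₀ stab unst e j → ∀ Δ : ℝ, |Δ| < c →
        ‖a j Δ - lam e j‖ ≤ C * |Δ| ∧ 0 < (a j Δ).im) ∧
      (∀ (φ : H) (hφ : φ ∈ D) (ψ : H) (hψ : ψ ∈ D), ∃ C, ∀ j, IsDecayIndex L₀ stab unst e j →
        ∀ Δ : ℝ, |Δ| < c →
          ‖Q j Δ ⟨φ, Submodule.subset_span hφ⟩ ⟨ψ, Submodule.subset_span hψ⟩ -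
            inner ℂ φ (levelProj L₀ W e (lam e j) ψ)‖ ≤ C * |Δ|) ∧
      ∀ (φ : H) (hφ : φ ∈ D) (ψ : H) (hψ : ψ ∈ D), ∃ C, 0 ≤ C ∧ ∀ Δ : ℝ, Δ ≠ 0 → |Δ| < c →
        ∀ z ∈ lowerHalfDisc e δ,
          ‖deriv (fun w => inner ℂ φ (resolvent (perturbed L₀ W Δ) w ψ)) z -
            singularPart L₀ stab E a e Δ
              (fun j => Q j Δ ⟨φ, Submodule.subset_span hφ⟩ ⟨ψ, Submodule.subset_span hψ⟩)
              (inner ℂ φ (eigProj (perturbed L₀ W Δ) (E e Δ) ψ)) z‖ ≤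
            C * (1 + Δ ^ 2 / (‖z - e‖ + Δ ^ 2) ^ 2) := fun e => by
    by_cases he : e ∈ ev
    · obtain ⟨δ, hδ, -, c, hc, -, a, Q, hq⟩ := h.exists_local_resonances he
      exact ⟨δ, hδ, c, hc, a, Q, fun _ => hq⟩
    · exact ⟨1, one_pos, 1, one_pos, 0, 0, fun he' => absurd he' he⟩
  choose δ₁ hδ₁ c₁ hc₁ a Q hloc using hloc
  have hA : ∀ e : ℝ, ∃ C, e ∈ ev → ∀ j, IsDecayIndex L₀ stab unst e j → ∀ Δ : ℝ, |Δ| < c₁ e →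
        ‖a e j Δ - lam e j‖ ≤ C * |Δ| ∧ 0 < (a e j Δ).im := fun e => by
    by_cases he : e ∈ ev
    · obtain ⟨C, hC⟩ := (hloc e he).1
      exact ⟨C, fun _ => hC⟩
    · exact ⟨0, fun he' => absurd he' he⟩
  choose CA hCA using hA
  obtain ⟨CA', hCA'0, hCA'⟩ := exists_forall_le ev CA
  -- the radius `δ` of the discs
  obtain ⟨δ₂, hδ₂, hδ₂'⟩ := exists_pos_forall_le ev δ₁ fun e _ => hδ₁ e
  -- Half the distance between eigenvalues keeps the discs disjoint: near e, the singular parts of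
  -- all other eigenvalues are harmless.
  obtain ⟨δ₃, hδ₃, hδ₃'⟩ := exists_pos_forall_le ev.offDiag (fun p => |p.1 - p.2| / 2) fun p hp =>
    half_pos (abs_pos.mpr (sub_ne_zero.mpr (Finset.mem_offDiag.mp hp).2.2))
  set δ := min (min δ₂ δ₃) α with hδdef
  have hδ : 0 < δ := lt_min (lt_min hδ₂ hδ₃) h.α_pos
  have hδα : δ ≤ α := min_le_right _ _
  have hδe : ∀ e ∈ ev, δ ≤ δ₁ e := fun e he =>
    ((min_le_left _ _).trans (min_le_left _ _)).trans (hδ₂' e he)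
  have hsep : ∀ e ∈ ev, ∀ e' ∈ ev, e ≠ e' → ∀ z : ℂ, ‖z - e‖ < δ → δ ≤ ‖z - e'‖ :=
    fun e he e' he' hne z hz => by
      have h1 : δ ≤ |e - e'| / 2 := ((min_le_left _ _).trans (min_le_right _ _)).trans
        (hδ₃' (e, e') (Finset.mem_offDiag.mpr ⟨he, he', hne⟩))
      have h2 := norm_sub_le (z - e') (z - e)
      rw [sub_sub_sub_cancel_left, ← Complex.ofReal_sub, Complex.norm_real, Real.norm_eq_abs] at h2
      linarith
  -- the range `c` of the coupling constant
  obtain ⟨c₂, hc₂, hc₂'⟩ := exists_pos_forall_le ev c₁ fun e _ => hc₁ e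
  have hoff : ∀ e : ℝ, ∃ c > 0, e ∈ ev → ∀ φ ∈ D, ∀ ψ ∈ D, ∃ C, 0 ≤ C ∧ ∀ Δ : ℝ, |Δ| < c → |Δ| ≤ Δ₀ →
      ∀ z : ℂ, z.im < 0 → |z.re - e| ≤ α → δ ≤ ‖z - e‖ →
      ‖deriv (fun w => inner ℂ φ (resolvent (perturbed L₀ W Δ) w ψ)) z‖ ≤ C := fun e => by
    by_cases he : e ∈ ev
    · obtain ⟨c, hc, hC⟩ := h.exists_bound_off_resonance he hδ
      exact ⟨c, hc, fun _ => hC⟩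
    · exact ⟨1, one_pos, fun he' => absurd he' he⟩
  choose c₃ hc₃ hoff using hoff
  obtain ⟨c₄, hc₄, hc₄'⟩ := exists_pos_forall_le ev c₃ fun e _ => hc₃ e
  have hEc : ∀ e : ℝ, ∃ c > 0, e ∈ stab → ∀ Δ : ℝ, Δ ≠ 0 → |Δ| < c → |E e Δ - e| ≤ δ / 2 := fun e => by
    by_cases hs : e ∈ stab
    · have h1 := (h.eigenvalues.tendsto e hs).eventually (Metric.ball_mem_nhds e (half_pos hδ))
      rw [eventually_nhdsWithin_iff, Metric.eventually_nhds_iff_ball] at h1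
      obtain ⟨c, hc, h2⟩ := h1
      refine ⟨c, hc, fun _ Δ hΔ0 hΔ => ?_⟩
      have h3 := h2 Δ (by simpa using hΔ) hΔ0
      rw [Real.dist_eq] at h3
      exact h3.le
    · exact ⟨1, one_pos, fun hs' => absurd hs' hs⟩
  choose c₅ hc₅ hEc using hEc
  obtain ⟨c₆, hc₆, hc₆'⟩ := exists_pos_forall_le stab c₅ fun e _ => hc₅ e
  obtain ⟨M, hM0, hM⟩ := exists_forall_le (ev.sigma fun e => decayRange L₀ stab e)
    fun p => ‖lam p.1 p.2‖
  -- The last two entries keep Δ²a_{e,j} below δ/2, since |a_{e,j}| ≤ CA' + M. The entry c₆ does the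
  -- same for E_e - e.
  set c := min (min (min c₂ c₄) (min c₆ Δ₀)) (min 1 (δ / (2 * (CA' + M + 1)))) with hcdef
  have hc : 0 < c := lt_min (lt_min (lt_min hc₂ hc₄) (lt_min hc₆ h.Δ₀_pos))
    (lt_min one_pos (by positivity))
  have hcc₁ : ∀ e ∈ ev, c ≤ c₁ e := fun e he =>
    ((min_le_left _ _).trans ((min_le_left _ _).trans (min_le_left _ _))).trans (hc₂' e he)
  have hcc₃ : ∀ e ∈ ev, c ≤ c₃ e := fun e he =>
    ((min_le_left _ _).trans ((min_le_left _ _).trans (min_le_right _ _))).trans (hc₄' e he)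
  have hcc₅ : ∀ e ∈ stab, c ≤ c₅ e := fun e he =>
    ((min_le_left _ _).trans ((min_le_right _ _).trans (min_le_left _ _))).trans (hc₆' e he)
  have hcΔ₀ : c ≤ Δ₀ := (min_le_left _ _).trans ((min_le_right _ _).trans (min_le_right _ _))
  have hc1 : c ≤ 1 := (min_le_right _ _).trans (min_le_left _ _)
  have hcM : c ≤ δ / (2 * (CA' + M + 1)) := (min_le_right _ _).trans (min_le_right _ _)
  have hasmall : ∀ e ∈ ev, ∀ Δ : ℝ, |Δ| < c → ∀ j ∈ decayRange L₀ stab e,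
      ‖(Δ : ℂ) ^ 2 * a e j Δ‖ ≤ δ / 2 := fun e he Δ hΔ j hj => by
    have h1 := (hCA e he j ((h.mem_decayRange he).mp hj) Δ (hΔ.trans_le (hcc₁ e he))).1
    have h2 : ‖a e j Δ‖ ≤ CA' + M := by
      have h3 := norm_add_le (a e j Δ - lam e j) (lam e j)
      rw [sub_add_cancel] at h3
      have h4 := hM ⟨e, j⟩ (Finset.mem_sigma.mpr ⟨he, hj⟩)
      have h5 : CA e * |Δ| ≤ CA' * 1 :=
        mul_le_mul (hCA' e he) (hΔ.le.trans hc1) (abs_nonneg _) hCA'0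
      simp only at h4
      linarith
    rw [norm_mul, norm_pow, Complex.norm_real, Real.norm_eq_abs]
    have h6 : |Δ| < δ / (2 * (CA' + M + 1)) := hΔ.trans_le hcM
    rw [lt_div_iff₀ (by positivity)] at h6
    have h7 : |Δ| ^ 2 ≤ |Δ| := by nlinarith [abs_nonneg Δ]
    have h8 : |Δ| ^ 2 * ‖a e j Δ‖ ≤ |Δ| * (CA' + M) := by gcongr
    nlinarith [abs_nonneg Δ]
  refine ⟨c, hc, hcΔ₀, a, Q, ⟨CA', fun e j hj Δ hΔ => ?_⟩, fun φ hφ ψ hψ => ?_,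
    fun φ hφ ψ hψ => ?_⟩
  · obtain ⟨h1, h2⟩ := hCA e (hidx hj) j hj Δ (hΔ.trans_le (hcc₁ e (hidx hj)))
    exact ⟨h1.trans (mul_le_mul_of_nonneg_right (hCA' e (hidx hj)) (abs_nonneg _)), h2⟩
  · choose! C hC using fun e he => (hloc e he).2.1 φ hφ ψ hψ
    obtain ⟨C', -, hC'⟩ := exists_forall_le ev C
    refine ⟨C', fun e j hj Δ hΔ => ?_⟩
    exact (hC e (hidx hj) j hj Δ (hΔ.trans_le (hcc₁ e (hidx hj)))).trans
      (mul_le_mul_of_nonneg_right (hC' e (hidx hj)) (abs_nonneg _))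
  choose! C₁ hC₁ using fun e he => (hloc e he).2.1 φ hφ ψ hψ
  obtain ⟨C₁', hC₁'0, hC₁'⟩ := exists_forall_le ev C₁
  obtain ⟨P, hP0, hP⟩ := exists_forall_le (ev.sigma fun e => decayRange L₀ stab e)
    fun p => ‖inner ℂ φ (levelProj L₀ W p.1 (lam p.1 p.2) ψ)‖
  set B := C₁' + P + ‖φ‖ * ‖ψ‖ with hB
  have hB0 : 0 ≤ B := by positivity
  choose! C₂ hC₂0 hC₂ using fun e he => (hloc e he).2.2 φ hφ ψ hψ
  obtain ⟨C₂', hC₂'0, hC₂'⟩ := exists_forall_le ev C₂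
  choose! C₃ hC₃0 hC₃ using fun e he => hoff e he φ hφ ψ hψ
  obtain ⟨C₃', hC₃'0, hC₃'⟩ := exists_forall_le ev C₃
  obtain ⟨C₄, hC₄0, hC₄⟩ :=
    (h.unifBddDeriv_away (Submodule.subset_span hφ) (Submodule.subset_span hψ)).exists_nonneg_bound
  obtain ⟨C₅, hC₅0, hC₅⟩ := h.exists_bound_high_energy φ ψ
  obtain ⟨R, hR0, hR⟩ := exists_forall_le ev fun e => 1 + (|e| + α) ^ 2
  let Cs : ℝ → ℝ := fun e =>
    ((decayRange L₀ stab e).card + 1) * (4 * B) * ((1 + 2 * e ^ 2) / δ ^ 2 + 2)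
  have hCs0 : ∀ e, 0 ≤ Cs e := fun e => by positivity
  set S := ∑ e ∈ ev, Cs e with hS
  have hS0 : 0 ≤ S := Finset.sum_nonneg fun e _ => hCs0 e
  refine ⟨C₂' + C₂' * R + C₃' * R + 2 * C₄ + 2 * C₅ + S, fun Δ hΔ hgood z hz => ?_⟩
  have hΔ0 := hgood.1
  have hΔ' := hgood.2.1
  set f' := deriv (fun w => inner ℂ φ (resolvent (perturbed L₀ W Δ) w ψ)) z with hf'
  set sp : ℝ → ℂ := fun e => singularPart L₀ stab E (a e) e Δ
    (fun j => Q e j Δ ⟨φ, Submodule.subset_span hφ⟩ ⟨ψ, Submodule.subset_span hψ⟩)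
    (inner ℂ φ (eigProj (perturbed L₀ W Δ) (E e Δ) ψ)) z with hsp
  set Y : ℝ := 1 / (1 + z.re ^ 2) with hY
  set Z : ℝ := ∑ e ∈ ev, Δ ^ 2 / ((z.re - e) ^ 2 + (Δ ^ 2) ^ 2) with hZ
  have hY0 : 0 ≤ Y := by positivity
  have hZ0 : 0 ≤ Z := Finset.sum_nonneg fun e _ => by positivity
  have hspb : ∀ e ∈ ev, δ ≤ ‖z - e‖ → ‖sp e‖ ≤ Cs e * Y := fun e he hze => by
    refine (norm_singularPart_le hδ (B := B) (fun j hj => ?_) ?_ (hasmall e he Δ hΔ)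
      (fun hs => hEc e hs Δ hΔ0 (hΔ.trans_le (hcc₅ e hs))) hze).trans ?_
    · have h1 := hC₁ e he j ((h.mem_decayRange he).mp hj) Δ (hΔ.trans_le (hcc₁ e he))
      have h2 := hP ⟨e, j⟩ (Finset.mem_sigma.mpr ⟨he, hj⟩)
      have h3 : C₁ e * |Δ| ≤ C₁' * 1 :=
        mul_le_mul (hC₁' e he) (hΔ.le.trans hc1) (abs_nonneg _) hC₁'0
      have h4 := norm_add_le (Q e j Δ ⟨φ, Submodule.subset_span hφ⟩ ⟨ψ, Submodule.subset_span hψ⟩ -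
        inner ℂ φ (levelProj L₀ W e (lam e j) ψ)) (inner ℂ φ (levelProj L₀ W e (lam e j) ψ))
      rw [sub_add_cancel] at h4
      simp only at h2
      have h5 : 0 ≤ ‖φ‖ * ‖ψ‖ := by positivity
      linarith
    · have h1 : ‖inner ℂ φ (eigProj (perturbed L₀ W Δ) (E e Δ) ψ)‖ ≤ ‖φ‖ * ‖ψ‖ :=
        norm_inner_orthProj_le _ φ ψ
      linarith
    · have h1 := mul_le_mul_of_nonneg_left (inv_norm_sub_sq_le hδ hze)
        (by positivity : 0 ≤ ((decayRange L₀ stab e).card + 1) * (4 * B))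
      exact h1.trans_eq (mul_assoc _ _ _).symm
  have hsum : ∀ s ⊆ ev, (∀ e ∈ s, δ ≤ ‖z - e‖) → ‖∑ e ∈ s, sp e‖ ≤ S * Y := fun s hs hse => by
    refine (norm_sum_le _ _).trans ((Finset.sum_le_sum fun e he => hspb e (hs he) (hse e he)).trans ?_)
    rw [← Finset.sum_mul]
    exact mul_le_mul_of_nonneg_right
      (Finset.sum_le_sum_of_subset_of_nonneg hs fun e _ _ => hCs0 e) hY0
  have hRY : ∀ e ∈ ev, |z.re - e| ≤ α → 1 ≤ R * Y := fun e he hze =>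
    (one_le_mul_inv_one_add_sq hze).trans (mul_le_mul_of_nonneg_right (hR e he) hY0)
  have p1 := mul_nonneg hC₂'0 hY0
  have p2 := mul_nonneg (mul_nonneg hC₂'0 hR0) hY0
  have p3 := mul_nonneg (mul_nonneg hC₃'0 hR0) hY0
  have p4 := mul_nonneg hC₄0 hY0
  have p5 := mul_nonneg hC₅0 hY0
  have p6 := mul_nonneg hS0 hY0
  have q1 := mul_nonneg hC₂'0 hZ0
  have q2 := mul_nonneg (mul_nonneg hC₂'0 hR0) hZ0
  have q3 := mul_nonneg (mul_nonneg hC₃'0 hR0) hZ0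
  have q4 := mul_nonneg hC₄0 hZ0
  have q5 := mul_nonneg hC₅0 hZ0
  have q6 := mul_nonneg hS0 hZ0
  by_cases hcase : ∃ e ∈ ev, ‖z - e‖ < δ
  · obtain ⟨e, he, hze⟩ := hcase
    have h1 := hC₂ e he Δ hΔ0 (hΔ.trans_le (hcc₁ e he)) z ⟨hz, hze.trans_le (hδe e he)⟩
    have h2 := hsum (ev.erase e) (Finset.erase_subset _ _) fun e' he' =>
      hsep e he e' (Finset.mem_of_mem_erase he') (Finset.ne_of_mem_erase he').symm z hze
    -- The square of |z - e| + Δ² dominates (Re z - e)² + Δ⁴. The bound then depends on Re z only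
    -- and is a Lorentzian of width Δ².
    have h3 : Δ ^ 2 / (‖z - e‖ + Δ ^ 2) ^ 2 ≤ Z := by
      refine le_trans ?_ (Finset.single_le_sum
        (f := fun e => Δ ^ 2 / ((z.re - e) ^ 2 + (Δ ^ 2) ^ 2)) (fun e _ => by positivity) he)
      have h4 := pow_le_pow_left₀ (abs_nonneg _) (abs_re_sub_le z e) 2
      rw [sq_abs] at h4
      gcongr
      nlinarith [norm_nonneg (z - e), sq_nonneg Δ, mul_nonneg (norm_nonneg (z - e)) (sq_nonneg Δ)]
    have h5 := hRY e he ((abs_re_sub_le z e).trans (hze.le.trans hδα))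
    have h6 : ‖f' - sp e‖ ≤ C₂' * (R * Y + Z) := h1.trans
      (mul_le_mul (hC₂' e he) (add_le_add h5 h3) (by positivity) hC₂'0)
    have h7 : f' - ∑ e ∈ ev, sp e = (f' - sp e) - ∑ e ∈ ev.erase e, sp e := by
      rw [← Finset.add_sum_erase _ _ he]; ring
    rw [h7]
    refine (norm_sub_le _ _).trans ((add_le_add h6 h2).trans ?_)
    linarith
  · push Not at hcase
    have h2 := hsum ev subset_rfl hcase
    have h3 : ‖f'‖ ≤ (C₃' * R + 2 * C₄ + 2 * C₅) * Y := by
      by_cases hnear : ∃ e ∈ ev, |z.re - e| ≤ α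
      · obtain ⟨e, he, hze⟩ := hnear
        have h4 := (hC₃ e he Δ (hΔ.trans_le (hcc₃ e he)) hΔ' z hz hze (hcase e he)).trans (hC₃' e he)
        have h5 := mul_le_mul_of_nonneg_left (hRY e he hze) hC₃'0
        linarith
      · push Not at hnear
        -- The high energy estimate needs |z| ≥ 1. For |Re z| ≤ 1 plain boundedness suffices,
        -- because 1/(1 + (Re z)²) ≥ 1/2 there.
        by_cases hx : |z.re| ≤ 1
        · have h4 := (hC₄ Δ hΔ').2 1 le_rfl z ⟨hz, hnear⟩
          rw [iteratedDeriv_one] at h4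
          have h5 : 1 ≤ 2 * Y := by
            have := one_le_mul_inv_one_add_sq (x := z.re) (e := 0) (ρ := 1) (by simpa using hx)
            simp only [abs_zero, zero_add, one_pow] at this
            linarith
          have h6 := mul_le_mul_of_nonneg_left h5 hC₄0
          linarith
        · push Not at hx
          have hzx : |z.re| ≤ ‖z‖ := Complex.abs_re_le_norm z
          have h4 := hC₅ Δ hgood z hz hnear (hx.le.trans hzx)
          have h5 : 1 / ‖z‖ ^ 2 ≤ 2 * Y := by
            have h7 : 1 ≤ z.re ^ 2 := by rw [← sq_abs]; nlinarith
            have h8 := pow_le_pow_left₀ (abs_nonneg _) hzx 2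
            rw [sq_abs] at h8
            rw [hY, mul_one_div, div_le_div_iff₀ (by linarith) (by positivity)]
            linarith
          have h6 := mul_le_mul_of_nonneg_left h5 hC₅0
          rw [mul_one_div] at h6
          linarith
    refine (norm_sub_le _ _).trans ((add_le_add h3 h2).trans ?_)
    linarith

end GlobalBound

/-! ### From the resolvent expansion back to the propagator. -/

section Expansion

set_option linter.unusedSectionVars false

/-- `r` is continuous, bounded on the half line, and its Laplace transform is `i F`. -/
structure IsLaplacePair (r : ℝ → ℂ) (F : ℂ → ℂ) : Prop where
  continuous : Continuous r
  bounded : ∃ M, ∀ t, 0 ≤ t → ‖r t‖ ≤ M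
  laplace_eq : ∀ z : ℂ, z.im < 0 → laplace r z = Complex.I * F z

theorem IsLaplacePair.add {r r' : ℝ → ℂ} {F F' : ℂ → ℂ} (h : IsLaplacePair r F)
    (h' : IsLaplacePair r' F') : IsLaplacePair (fun t => r t + r' t) fun z => F z + F' z := by
  obtain ⟨M, hM⟩ := h.bounded
  obtain ⟨M', hM'⟩ := h'.bounded
  refine ⟨h.continuous.add h'.continuous,
    ⟨M + M', fun t ht => (norm_add_le _ _).trans (add_le_add (hM t ht) (hM' t ht))⟩, fun z hz => ?_⟩
  rw [mul_add, ← h.laplace_eq z hz, ← h'.laplace_eq z hz]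
  simp only [laplace, mul_add]
  exact integral_add (integrableOn_laplace h.continuous hM hz)
    (integrableOn_laplace h'.continuous hM' hz)

theorem IsLaplacePair.const_mul {r : ℝ → ℂ} {F : ℂ → ℂ} (h : IsLaplacePair r F) (k : ℂ) :
    IsLaplacePair (fun t => k * r t) fun z => k * F z := by
  obtain ⟨M, hM⟩ := h.bounded
  refine ⟨continuous_const.mul h.continuous, ⟨‖k‖ * M, fun t ht => ?_⟩, fun z hz => ?_⟩
  · rw [norm_mul]; exact mul_le_mul_of_nonneg_left (hM t ht) (norm_nonneg _)
  · rw [mul_left_comm, ← h.laplace_eq z hz]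
    simp only [laplace, mul_left_comm _ k]
    exact integral_const_mul _ _

theorem IsLaplacePair.zero : IsLaplacePair (fun _ => 0) fun _ => 0 :=
  ⟨continuous_const, ⟨0, by simp⟩, by simp [laplace]⟩

theorem IsLaplacePair.sum {ι : Type*} (s : Finset ι) {r : ι → ℝ → ℂ} {F : ι → ℂ → ℂ}
    (h : ∀ i ∈ s, IsLaplacePair (r i) (F i)) :
    IsLaplacePair (fun t => ∑ i ∈ s, r i t) fun z => ∑ i ∈ s, F i z := by
  classical
  induction s using Finset.induction_on with
  | empty => simpa using IsLaplacePair.zero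
  | insert a s ha ih =>
    simp only [Finset.sum_insert ha]
    exact (h a (Finset.mem_insert_self _ _)).add
      (ih fun i hi => h i (Finset.mem_insert_of_mem hi))

theorem isLaplacePair_exp {b : ℂ} (hb : 0 ≤ b.im) :
    IsLaplacePair (fun t => Complex.exp (Complex.I * t * b)) fun z => 1 / (b - z) :=
  ⟨by fun_prop, ⟨1, fun _ ht => norm_exp_I_mul_le_one hb ht⟩, fun z hz => by
    rw [laplace_exp (hz.trans_le hb), mul_one_div]⟩

/-- The transform of -it r(t) is iF'. A bound depending on Re z alone is exactly the uniformity up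
to the real axis that the inversion argument needs. -/
theorem IsLaplacePair.norm_le {r : ℝ → ℂ} {F : ℂ → ℂ} (h : IsLaplacePair r F) {g : ℝ → ℝ} {C : ℝ}
    (hg : Integrable g) (hgC : ∫ x, g x ≤ C)
    (hF : ∀ z : ℂ, z.im < 0 → ‖deriv F z‖ ≤ g z.re) {t : ℝ} (ht : 0 < t) : ‖r t‖ ≤ C / t := by
  obtain ⟨M, hM⟩ := h.bounded
  refine norm_le_div_of_laplace_bound h.continuous hM one_pos hg hgC (fun η hη _ x => ?_) ht
  have hz : ((x : ℂ) - Complex.I * η).im < 0 := by simpa using hη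
  have h1 : laplace r =ᶠ[𝓝 (x - Complex.I * η : ℂ)] fun z => Complex.I * F z := by
    filter_upwards [(isOpen_lt Complex.continuous_im continuous_const).mem_nhds hz] with z hz'
    exact h.laplace_eq z hz'
  rw [← (hasDerivAt_laplace h.continuous hM hz).deriv, h1.deriv_eq, deriv_const_mul_field,
    norm_mul, Complex.norm_I, one_mul]
  simpa using hF _ hz

variable {H : Type*} [NormedAddCommGroup H] [InnerProductSpace ℂ H] [CompleteSpace H]
  {L₀ W : H →ₗ.[ℂ] H} {Δ₀ α : ℝ} {D : Set H} {stab unst : Finset ℝ} {E : ℝ → ℝ → ℝ}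
  {lam : ℝ → ℕ → ℂ} {e : ℝ}

theorem isLaplacePair_propagator {A : H →ₗ.[ℂ] H} (hA : IsSelfAdjoint A) (φ ψ : H) :
    IsLaplacePair (fun t => inner ℂ φ (propagator A t ψ)) fun z => inner ℂ φ (resolvent A z ψ) := by
  have hU := isUnitaryGroup_propagator hA
  refine ⟨continuous_const.inner (hU.continuous ψ), ⟨‖φ‖ * ‖ψ‖, fun t _ => ?_⟩, fun z hz =>
    laplace_unitaryGroup hU hz (isResolvent_resolvent hA hz.ne) φ ψ⟩
  exact (norm_inner_le_norm _ _).trans_eq (by rw [hU.norm_map])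

theorem hasDerivAt_div_sub (q : ℂ) {b z : ℂ} (hbz : b - z ≠ 0) :
    HasDerivAt (fun w => q * (1 / (b - w))) (q / (b - z) ^ 2) z := by
  have h1 := ((hasDerivAt_const z (1 : ℂ)).div ((hasDerivAt_id z).const_sub b) hbz).const_mul q
  exact h1.congr_deriv (by simp only [id]; ring)

/-- The transform is i times a sum of simple poles, whose derivative is the sum of double poles in
`singularPart`. The condition Im a_j ≥ 0 keeps the exponentials bounded and the poles out of the
open lower half plane. -/
theorem exists_laplacePair_singularPart {a : ℕ → ℝ → ℂ} {Δ : ℝ} (q : ℕ → ℂ) (q₀ : ℂ)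
    (ha : ∀ j ∈ decayRange L₀ stab e, 0 ≤ (a j Δ).im) :
    ∃ F : ℂ → ℂ, IsLaplacePair (fun t => ∑ j ∈ decayRange L₀ stab e,
        Complex.exp (Complex.I * t * (e + Δ ^ 2 * a j Δ)) * q j +
        if e ∈ stab then Complex.exp (Complex.I * t * E e Δ) * q₀ else 0) F ∧
      ∀ z : ℂ, z.im < 0 → HasDerivAt F (singularPart L₀ stab E a e Δ q q₀ z) z := by
  have hb : ∀ j ∈ decayRange L₀ stab e, 0 ≤ ((e : ℂ) + Δ ^ 2 * a j Δ).im := fun j hj => by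
    have h1 : ((e : ℂ) + Δ ^ 2 * a j Δ).im = Δ ^ 2 * (a j Δ).im := by
      rw [← Complex.ofReal_pow, Complex.add_im, Complex.im_ofReal_mul, Complex.ofReal_im, zero_add]
    rw [h1]
    exact mul_nonneg (sq_nonneg _) (ha j hj)
  have hne : ∀ {b z : ℂ}, 0 ≤ b.im → z.im < 0 → b - z ≠ 0 := fun hb hz h0 => by
    rw [sub_eq_zero.mp h0] at hb; exact absurd hz hb.not_gt
  have hE : 0 ≤ ((E e Δ : ℝ) : ℂ).im := by simp
  refine ⟨fun z => ∑ j ∈ decayRange L₀ stab e, q j * (1 / (e + Δ ^ 2 * a j Δ - z)) +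
    if e ∈ stab then q₀ * (1 / (E e Δ - z)) else 0, IsLaplacePair.add (IsLaplacePair.sum _
      fun j hj => ?_) ?_, fun z hz => HasDerivAt.add (HasDerivAt.fun_sum fun j hj =>
        hasDerivAt_div_sub _ (hne (hb j hj) hz)) ?_⟩
  · simpa only [mul_comm] using (isLaplacePair_exp (hb j hj)).const_mul (q j)
  · split_ifs
    · simpa only [mul_comm] using (isLaplacePair_exp hE).const_mul q₀
    · exact IsLaplacePair.zero
  · split_ifs
    · exact hasDerivAt_div_sub _ (hne hE hz)
    · exact hasDerivAt_const _ _

theorem sum_expansion_eq (h : Disjoint stab unst) {a : ℝ → ℕ → ℝ → ℂ} {Δ : ℝ} (q : ℝ → ℕ → ℂ)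
    (q₀ : ℝ → ℂ) (t : ℝ) :
    ∑ e ∈ stab ∪ unst, (∑ j ∈ decayRange L₀ stab e,
        Complex.exp (Complex.I * t * (e + Δ ^ 2 * a e j Δ)) * q e j +
        if e ∈ stab then Complex.exp (Complex.I * t * E e Δ) * q₀ e else 0) =
      ∑ e ∈ stab, (Complex.exp (Complex.I * t * E e Δ) * q₀ e + ∑ j ∈ Finset.Ico 1 (mult L₀ e),
        Complex.exp (Complex.I * t * (e + Δ ^ 2 * a e j Δ)) * q e j) +
      ∑ e ∈ unst, ∑ j ∈ Finset.range (mult L₀ e),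
        Complex.exp (Complex.I * t * (e + Δ ^ 2 * a e j Δ)) * q e j := by
  rw [Finset.sum_union h]
  congr 1
  · refine Finset.sum_congr rfl fun e he => ?_
    rw [decayRange, if_pos he, if_pos he, add_comm]
  · refine Finset.sum_congr rfl fun e he => ?_
    have : e ∉ stab := fun hs => Finset.disjoint_left.mp h hs he
    rw [decayRange, if_neg this, if_neg this, add_zero]

theorem integral_sum_lorentzian (ev : Finset ℝ) {s : ℝ} (hs : 0 < s) (C : ℝ) :
    Integrable (fun x : ℝ => C * (1 / (1 + x ^ 2) + ∑ e ∈ ev, s / ((x - e) ^ 2 + s ^ 2))) ∧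
      ∫ x : ℝ, C * (1 / (1 + x ^ 2) + ∑ e ∈ ev, s / ((x - e) ^ 2 + s ^ 2)) =
        C * (Real.pi + ev.card * Real.pi) := by
  have h1 : Integrable fun x : ℝ => 1 / (1 + x ^ 2) := by
    simpa only [one_div] using integrable_inv_one_add_sq
  have h2 : Integrable fun x : ℝ => ∑ e ∈ ev, s / ((x - e) ^ 2 + s ^ 2) :=
    integrable_finsetSum _ fun e _ => integrable_lorentzian hs e
  refine ⟨(h1.add h2).const_mul C, ?_⟩
  rw [integral_const_mul, integral_add h1 h2,
    integral_finsetSum _ fun e _ => integrable_lorentzian hs e]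
  simp only [integral_lorentzian hs, one_div, integral_univ_inv_one_add_sq, Finset.sum_const,
    nsmul_eq_mul]

end Expansion
end Resonance

/-! ### The resonance expansion of the propagator. -/

theorem theorem1p1 {H : Type*} [NormedAddCommGroup H] [InnerProductSpace ℂ H] [CompleteSpace H]
    (L₀ W : H →ₗ.[ℂ] H) (Δ₀ α : ℝ) (D : Set H) (stab unst : Finset ℝ)
    (E : ℝ → ℝ → ℝ) (lam : ℝ → ℕ → ℂ)
    (hΔ₀ : 0 < Δ₀) (hα : 0 < α)
    (hL₀ : IsSelfAdjoint L₀) (hW : IsSelfAdjoint W)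
    (hL : ∀ Δ : ℝ, |Δ| ≤ Δ₀ → IsSelfAdjoint (Resonance.perturbed L₀ W Δ))
    (hE : Resonance.EigenvalueAssumptions L₀ W Δ₀ stab unst E)
    (hA1 : Resonance.FirstOrderVanishes L₀ W (stab ∪ unst))
    (hA2 : Resonance.LimitingAbsorption L₀ W Δ₀ α D (stab ∪ unst))
    (hA3 : Resonance.RegularInCoupling L₀ W Δ₀ α (stab ∪ unst))
    (hA4 : Resonance.FermiGoldenRule L₀ W stab unst lam) :
    ∃ c : ℝ, 0 < c ∧ c ≤ Δ₀ ∧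
      ∃ (a : ℝ → ℕ → ℝ → ℂ) (Q : ℝ → ℕ → ℝ → Resonance.SesqForm D),
        -- the exponents are close to the eigenvalues of the level shift operators
        (∃ C : ℝ, ∀ e j, Resonance.IsDecayIndex L₀ stab unst e j →
          ∀ Δ : ℝ, Δ ≠ 0 → |Δ| < c → ‖a e j Δ - lam e j‖ ≤ C * |Δ| ∧ 0 < (a e j Δ).im) ∧
        -- the forms are close to the spectral projections of the level shift operators
        (∀ (φ : H) (hφ : φ ∈ D) (ψ : H) (hψ : ψ ∈ D), ∃ C : ℝ, ∀ e j,
          Resonance.IsDecayIndex L₀ stab unst e j → ∀ Δ : ℝ, Δ ≠ 0 → |Δ| < c →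
            ‖Q e j Δ ⟨φ, Submodule.subset_span hφ⟩ ⟨ψ, Submodule.subset_span hψ⟩ -
              inner ℂ φ (Resonance.levelProj L₀ W e (lam e j) ψ)‖ ≤ C * |Δ|) ∧
        -- the resonance expansion, with remainder bounded by `C / t`
        ∀ (φ : H) (hφ : φ ∈ D) (ψ : H) (hψ : ψ ∈ D), ∃ C : ℝ, ∀ Δ : ℝ, Δ ≠ 0 → |Δ| < c →
          ∀ (hφ' : φ ∈ (Resonance.perturbed L₀ W Δ).domain)
            (hψ' : ψ ∈ (Resonance.perturbed L₀ W Δ).domain),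
            Resonance.perturbed L₀ W Δ ⟨φ, hφ'⟩ ∈ D → Resonance.perturbed L₀ W Δ ⟨ψ, hψ'⟩ ∈ D →
            ∀ t : ℝ, 0 < t →
              ‖inner ℂ φ (Resonance.propagator (Resonance.perturbed L₀ W Δ) t ψ) -
                (∑ e ∈ stab,
                    (Complex.exp (Complex.I * t * E e Δ) *
                        inner ℂ φ (Resonance.eigProj (Resonance.perturbed L₀ W Δ) (E e Δ) ψ) +
                      ∑ j ∈ Finset.Ico 1 (Resonance.mult L₀ e),
                        Complex.exp (Complex.I * t * (e + Δ ^ 2 * a e j Δ)) *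
                          Q e j Δ ⟨φ, Submodule.subset_span hφ⟩ ⟨ψ, Submodule.subset_span hψ⟩) +
                  ∑ e ∈ unst, ∑ j ∈ Finset.range (Resonance.mult L₀ e),
                    Complex.exp (Complex.I * t * (e + Δ ^ 2 * a e j Δ)) *
                      Q e j Δ ⟨φ, Submodule.subset_span hφ⟩ ⟨ψ, Submodule.subset_span hψ⟩)‖ ≤
                C / t := by
  have h : Resonance.ResonanceAssumptions L₀ W Δ₀ α D stab unst E lam :=
    ⟨hΔ₀, hα, hL, hE, hA1, hA2, hA3, hA4⟩
  obtain ⟨c, hc, hcΔ, a, Q, ⟨Ca, hCa⟩, hQ, hf⟩ := h.exists_resonances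
  refine ⟨c, hc, hcΔ, a, Q, ⟨Ca, fun e j hj Δ _ hΔ => hCa e j hj Δ hΔ⟩, fun φ hφ ψ hψ => ?_,
    fun φ hφ ψ hψ => ?_⟩
  · obtain ⟨C, hC⟩ := hQ φ hφ ψ hψ
    exact ⟨C, fun e j hj Δ _ hΔ => hC e j hj Δ hΔ⟩
  obtain ⟨C, hC⟩ := hf φ hφ ψ hψ
  -- The total mass of the dominating function: π for 1/(1 + x²) and π for each Lorentzian, whatever
  -- Δ is.
  refine ⟨C * (Real.pi + (stab ∪ unst).card * Real.pi),
    fun Δ hΔ0 hΔ hφ' hψ' hφD hψD t ht => ?_⟩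
  have hΔ' : |Δ| ≤ Δ₀ := hΔ.le.trans hcΔ
  have hA := hL Δ hΔ'
  let q : ℝ → ℕ → ℂ := fun e j =>
    Q e j Δ ⟨φ, Submodule.subset_span hφ⟩ ⟨ψ, Submodule.subset_span hψ⟩
  let q₀ : ℝ → ℂ := fun e =>
    inner ℂ φ (Resonance.eigProj (Resonance.perturbed L₀ W Δ) (E e Δ) ψ)
  have hex : ∀ e, ∃ F : ℂ → ℂ, e ∈ stab ∪ unst → Resonance.IsLaplacePair (fun t =>
      ∑ j ∈ Resonance.decayRange L₀ stab e,
        Complex.exp (Complex.I * t * (e + Δ ^ 2 * a e j Δ)) * q e j +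
        if e ∈ stab then Complex.exp (Complex.I * t * E e Δ) * q₀ e else 0) F ∧
      ∀ z : ℂ, z.im < 0 →
        HasDerivAt F (Resonance.singularPart L₀ stab E (a e) e Δ (q e) (q₀ e) z) z := fun e => by
    by_cases he : e ∈ stab ∪ unst
    · obtain ⟨F, hF⟩ := Resonance.exists_laplacePair_singularPart (L₀ := L₀) (stab := stab) (E := E)
        (e := e) (a := a e) (Δ := Δ) (q e) (q₀ e) fun j hj =>
        (hCa e j ((h.mem_decayRange he).mp hj) Δ hΔ).2.le
      exact ⟨F, fun _ => hF⟩
    · exact ⟨0, fun he' => absurd he' he⟩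
  choose F hF using hex
  -- The remainder, propagator minus exponentials, as a Laplace pair. The derivative of its second
  -- member is the quantity bounded by the resolvent expansion.
  have hpair := (Resonance.isLaplacePair_propagator hA φ ψ).add
    ((Resonance.IsLaplacePair.sum (stab ∪ unst) fun e he => (hF e he).1).const_mul (-1))
  obtain ⟨hg, hgC⟩ := Resonance.integral_sum_lorentzian (stab ∪ unst) (s := Δ ^ 2) (by positivity) C
  have key := hpair.norm_le hg hgC.le (fun z hz => ?_) ht
  · rw [Resonance.sum_expansion_eq hE.disjoint q q₀ t, neg_one_mul, ← sub_eq_add_neg] at key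
    exact key
  · have h1 := (Resonance.differentiableAt_inner_resolvent hA hz φ ψ).hasDerivAt.add
      ((HasDerivAt.fun_sum fun e he => (hF e he).2 z hz).const_mul (-1))
    have h2 := hC Δ hΔ ⟨hΔ0, hΔ', hφ', hψ', hφD, hψD⟩ z hz
    rw [sub_eq_add_neg, ← neg_one_mul] at h2
    exact (congrArg norm h1.deriv).le.trans h2
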